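/- A data $\omega$-word $\sigma$ over a finite alphabet $\Sigma$ is an $\omega$-word $\sigma(0)\sigma(1)\cdots$ over $\Sigma$ together with an equivalence relation $\sim$ on $\mathbb{N}$; $[i]$ denotes the class of position $i$. A safety one-way alternating automaton with one register (safety 1ARA$_1$) is a tuple $\langle \Sigma, Q, q_I, \delta\rangle$ with $\Sigma$ a finite alphabet, $Q$ a finite set of states, $q_I \in Q$, and $\delta$ mapping each element of $Q\times\Sigma\times\{\uparrow,\not\uparrow\}$ to a positive Boolean formula over $Q \uplus {\downarrow}Q$. A pair of sets $Q', Q'_\downarrow \subseteq Q$ satisfies the atom $q$ iff $q\in Q'$, and the atom ${\downarrow}q$ iff $q\in Q'_\downarrow$. A configuration is a pair $\langle q, D\rangle$ with $q\in Q$ and $D\in\mathbb{N}/{\sim}$. There is a step $F \to F'$ at position $i$ between sets of configurations iff for each $c=\langle q,D\rangle\in F$ there are sets $Q^c,Q^c_\downarrow\subseteq Q$ that satisfy $\delta(q,\sigma(i),\uparrow)$ if $D=[i]$, or $\delta(q,\sigma(i),\not\uparrow)$ if $D\ne[i]$, such that $F' = \{\langle q',D\rangle : c = \langle q,D\rangle\in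 F,\ q'\in Q^c\}\cup\{\langle q',[i]\rangle : c\in F,\ q'\in Q^c_\downarrow\}$. The automaton accepts $\sigma$ iff there is an infinite run $F_0\to F_1\to\cdots$, with the step from $F_i$ to $F_{i+1}$ at position $i$ and $F_0=\{\langle q_I,[0]\rangle\}$. Safety 1ARA$_1$ nonemptiness is the problem: given a safety 1ARA$_1$, does it accept some data $\omega$-word over its alphabet? Formulae of safety LTL$^\downarrow_1(\mathtt{X},\mathtt{R})$ over a finite alphabet $\Sigma$ are given by $$\phi ::= a \mid \top \mid \bot \mid \phi\wedge\phi \mid \phi\vee\phi \mid \mathtt{X}\phi \mid \phi\,\mathtt{R}\,\phi \mid {\downarrow}\phi \mid {\uparrow} \mid {\not\uparrow} \qquad (a \in \Sigma).$$ With respect to a data $\omega$-word $\sigma$, a position $i$ and a register value $D\in\mathbb{N}/{\sim}$: $a$ means $\sigma(i)=a$; $\mathtt{X}\phi$ means $\phi$ at $i+1$ with the same $D$; $\phi\,\mathtt{R}\,\psi$ means that, with the same $D$, either $\psi$ holds at all $k\ge i$, or for some $j\ge i$, $\phi$ holds at $j$ and $\psi$ holds at all $k\in\{i,\dots,j\}$;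 ${\downarrow}\phi$ means $\phi$ at $i$ with register value $[i]$; $\uparrow$ means $i\in D$; $\not\uparrow$ means $i\notin D$; the Boolean cases are as usual. A sentence is a formula in which each $\uparrow$ and each $\not\uparrow$ is in the scope of a ${\downarrow}$. Safety LTL$^\downarrow_1(\mathtt{X},\mathtt{R})$ satisfiability is the problem: given a finite alphabet $\Sigma$ and a sentence over $\Sigma$, is there a data $\omega$-word over $\Sigma$ that satisfies it at position $0$? Instances are written as strings over a fixed finite alphabet by listing the alphabet, the states, the transition table and the formulae explicitly. **Theorem.** Safety 1ARA$_1$ nonemptiness and safety LTL$^\downarrow_1(\mathtt{X},\mathtt{R})$ satisfiability are both ExpSpace-hard with respect to logarithmic-space many-one reductions: every language decidable by a deterministic Turing machine in space $2^{p(n)}$, for some polynomial $p$, is reducible to each of the two problems by a function computable in logarithmic space. -/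

import Mathlib

/-! ## Data words -/

/-- A data `ω`-word over `A`: an `ω`-word together with an equivalence relation on positions. -/
structure DataWord (A : Type) where
  letter : ℕ → A
  sim : Setoid ℕ

/-- The data of `σ`: the classes of its equivalence relation. -/
abbrev DataWord.Datum {A : Type} (σ : DataWord A) : Type := Quotient σ.sim

/-- The class of the position `i`. -/
def DataWord.cls {A : Type} (σ : DataWord A) (i : ℕ) : σ.Datum := Quotient.mk σ.sim i

/-! ## Safety one-way alternating automata with one register -/

/-- Positive Boolean formulae over `Q ∪ ↓Q`. -/
inductive PosBool (Q : Type) : Type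
  | keep (q : Q)
  | down (q : Q)
  | top
  | bot
  | and (φ ψ : PosBool Q)
  | or (φ ψ : PosBool Q)

/-- Satisfaction of a positive Boolean formula by a pair of sets of states. -/
def PosBool.Sat {Q : Type} (S T : Set Q) : PosBool Q → Prop
  | .keep q => q ∈ S
  | .down q => q ∈ T
  | .top => True
  | .bot => False
  | .and φ ψ => φ.Sat S T ∧ ψ.Sat S T
  | .or φ ψ => φ.Sat S T ∨ ψ.Sat S T

/-- A safety 1ARA₁ with alphabet `A` and set of states `Q`. The Boolean argument of `trans`
is `true` for `↑` and `false` for its negation. -/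
structure SafetyARA (A Q : Type) where
  start : Q
  trans : Q → A → Bool → PosBool Q

namespace SafetyARA

variable {A Q : Type}

/-- Configurations: a state and a register value. -/
abbrev Config (Q : Type) (σ : DataWord A) : Type := Q × σ.Datum

open Classical in
/-- The formula that governs the configuration `c` at position `i`. -/
noncomputable def rule (M : SafetyARA A Q) (σ : DataWord A) (i : ℕ) (c : Config Q σ) :
    PosBool Q :=
  M.trans c.1 (σ.letter i) (decide (c.2 = σ.cls i))

/-- One step of a run at position `i`: for each configuration `c` of `F`, a pair of sets of states
`S c`, `T c` satisfying the governing formula is chosen, and `F'` consists of the resulting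
configurations. (If `Q` and `F` are finite then so is `F'`.) -/
def Step (M : SafetyARA A Q) (σ : DataWord A) (i : ℕ) (F F' : Set (Config Q σ)) : Prop :=
  ∃ S T : Config Q σ → Set Q,
    (∀ c ∈ F, (M.rule σ i c).Sat (S c) (T c)) ∧
    F' = {d | ∃ c ∈ F, d.1 ∈ S c ∧ d.2 = c.2} ∪ {d | ∃ c ∈ F, d.1 ∈ T c ∧ d.2 = σ.cls i}

/-- Acceptance: existence of an infinite run from the initial configuration. -/
def Accepts (M : SafetyARA A Q) (σ : DataWord A) : Prop :=
  ∃ F : ℕ → Set (Config Q σ),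
    F 0 = {(M.start, σ.cls 0)} ∧ ∀ i, M.Step σ i (F i) (F (i + 1))

/-- The language of the automaton. -/
def lang (M : SafetyARA A Q) : Set (DataWord A) := {σ | M.Accepts σ}

end SafetyARA

/-! ## Safety future-time linear temporal logic with one register -/

/-- Formulae of safety LTL↓₁(X, R) over the alphabet `A`. -/
inductive SafetyLTL (A : Type) : Type
  | letter (a : A)
  | top
  | bot
  | and (φ ψ : SafetyLTL A)
  | or (φ ψ : SafetyLTL A)
  | next (φ : SafetyLTL A)
  | release (φ ψ : SafetyLTL A)
  | freeze (φ : SafetyLTL A)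
  | up
  | notUp

namespace SafetyLTL

variable {A : Type}

/-- `φ.Sat σ i D`: satisfaction of `φ` by `σ` at position `i` with register value `D`. -/
def Sat (σ : DataWord A) : SafetyLTL A → ℕ → σ.Datum → Prop
  | .letter a, i, _ => σ.letter i = a
  | .top, _, _ => True
  | .bot, _, _ => False
  | .and φ ψ, i, D => φ.Sat σ i D ∧ ψ.Sat σ i D
  | .or φ ψ, i, D => φ.Sat σ i D ∨ ψ.Sat σ i D
  | .next φ, i, D => φ.Sat σ (i + 1) D
  | .release φ ψ, i, D =>
      (∀ k, i ≤ k → ψ.Sat σ k D) ∨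
        ∃ j, i ≤ j ∧ φ.Sat σ j D ∧ ∀ k, i ≤ k → k ≤ j → ψ.Sat σ k D
  | .freeze φ, i, _ => φ.Sat σ i (σ.cls i)
  | .up, i, D => σ.cls i = D
  | .notUp, i, D => σ.cls i ≠ D

/-- Sentences: no occurrence of `↑` or of its negation outside the scope of a freeze quantifier. -/
def IsSentence : SafetyLTL A → Prop
  | .letter _ => True
  | .top => True
  | .bot => True
  | .and φ ψ => φ.IsSentence ∧ ψ.IsSentence
  | .or φ ψ => φ.IsSentence ∧ ψ.IsSentence
  | .next φ => φ.IsSentence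
  | .release φ ψ => φ.IsSentence ∧ ψ.IsSentence
  | .freeze _ => True
  | .up => False
  | .notUp => False

/-- The language of a sentence (whose satisfaction does not depend on the register value). -/
def lang (φ : SafetyLTL A) : Set (DataWord A) := {σ | ∀ D : σ.Datum, φ.Sat σ 0 D}

end SafetyLTL

/-! ## Instances as strings

Alphabets and sets of states of instances are `Fin m`; their sizes and elements are written in
unary, formulae in Polish notation, and transition functions as tables. -/

/-- The string alphabet for automata. -/
inductive ARASym : Type
  | tick | sep | keep | down | top | bot | and | or
  deriving DecidableEq

/-- The string alphabet for temporal formulae. -/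
inductive LTLSym : Type
  | tick | sep | letter | top | bot | and | or | next | release | freeze | up | notUp
  deriving DecidableEq

/-- The number `n` in unary, written with `s` and terminated by `t`. -/
def unary {B : Type} (s t : B) (n : ℕ) : List B := List.replicate n s ++ [t]

/-- The string for a positive Boolean formula. -/
def PosBool.encode {k : ℕ} : PosBool (Fin k) → List ARASym
  | .keep q => .keep :: unary .tick .sep q
  | .down q => .down :: unary .tick .sep q
  | .top => [.top]
  | .bot => [.bot]
  | .and φ ψ => .and :: (φ.encode ++ ψ.encode)
  | .or φ ψ => .or :: (φ.encode ++ ψ.encode)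

/-- The string for an automaton: the number of letters, the number of states, the initial state,
and the table of the transition function. -/
def SafetyARA.encode {m k : ℕ} (M : SafetyARA (Fin m) (Fin k)) : List ARASym :=
  unary .tick .sep m ++ unary .tick .sep k ++ unary .tick .sep M.start ++
    (List.finRange k).flatMap fun q => (List.finRange m).flatMap fun a =>
      (M.trans q a true).encode ++ (M.trans q a false).encode

/-- The string for a temporal formula. -/
def SafetyLTL.encodeFormula {m : ℕ} : SafetyLTL (Fin m) → List LTLSym
  | .letter a => .letter :: unary .tick .sep a
  | .top => [.top]
  | .bot => [.bot]
  | .and φ ψ => .and :: (φ.encodeFormula ++ ψ.encodeFormula)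
  | .or φ ψ => .or :: (φ.encodeFormula ++ ψ.encodeFormula)
  | .next φ => .next :: φ.encodeFormula
  | .release φ ψ => .release :: (φ.encodeFormula ++ ψ.encodeFormula)
  | .freeze φ => .freeze :: φ.encodeFormula
  | .up => [.up]
  | .notUp => [.notUp]

/-- The string for a temporal formula together with its alphabet. -/
def SafetyLTL.encode {m : ℕ} (φ : SafetyLTL (Fin m)) : List LTLSym :=
  unary .tick .sep m ++ φ.encodeFormula

theorem unary_append_inj {B : Type} {s t : B} (h : s ≠ t) {m n : ℕ} {u v : List B}
    (e : unary s t m ++ u = unary s t n ++ v) : m = n ∧ u = v := by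
  induction m generalizing n with
  | zero =>
    cases n with
    | zero => simpa [unary] using e
    | succ n => simp [unary, List.replicate_succ, h.symm] at e
  | succ m ih =>
    cases n with
    | zero => simp [unary, List.replicate_succ, h] at e
    | succ n =>
      have := @ih n (by simpa [unary, List.replicate_succ] using e)
      exact ⟨by rw [this.1], this.2⟩

theorem PosBool.encode_append_inj {k : ℕ} {φ ψ : PosBool (Fin k)} {u v : List ARASym}
    (e : φ.encode ++ u = ψ.encode ++ v) : φ = ψ ∧ u = v := by
  induction φ generalizing ψ u v with
  | keep q | down q =>
    cases ψ <;> simp [encode] at e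
    have := unary_append_inj (s := ARASym.tick) (t := .sep) (by decide) e
    exact ⟨by rw [Fin.ext this.1], this.2⟩
  | top | bot => cases ψ <;> simp [encode] at e ⊢; exact e
  | and φ₁ φ₂ ih₁ ih₂ | or φ₁ φ₂ ih₁ ih₂ =>
    cases ψ <;> simp [encode] at e
    obtain ⟨rfl, e₁⟩ := ih₁ e
    obtain ⟨rfl, e₂⟩ := ih₂ e₁
    exact ⟨rfl, e₂⟩

theorem flatMap_append_inj {X B : Type} {f g : X → List B}
    (h : ∀ x u v, f x ++ u = g x ++ v → f x = g x ∧ u = v) (l : List X) {u v : List B}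
    (e : l.flatMap f ++ u = l.flatMap g ++ v) : (∀ x ∈ l, f x = g x) ∧ u = v := by
  induction l with
  | nil => simpa using e
  | cons x l ih =>
    simp only [List.flatMap_cons, List.append_assoc] at e
    obtain ⟨h₁, e⟩ := h _ _ _ e
    obtain ⟨h₂, e⟩ := ih e
    exact ⟨by simpa [h₁] using h₂, e⟩

/-- Distinct automata have distinct strings. -/
theorem SafetyARA.encode_inj {m k m' k' : ℕ} {M : SafetyARA (Fin m) (Fin k)}
    {N : SafetyARA (Fin m') (Fin k')} (e : M.encode = N.encode) :
    m = m' ∧ k = k' ∧ HEq M N := by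
  simp only [encode, List.append_assoc] at e
  obtain ⟨rfl, e⟩ := unary_append_inj (by decide) e
  obtain ⟨rfl, e⟩ := unary_append_inj (by decide) e
  obtain ⟨hs, e⟩ := unary_append_inj (by decide) e
  refine ⟨rfl, rfl, heq_of_eq ?_⟩
  have cell : ∀ q a (u v : List ARASym),
      ((M.trans q a true).encode ++ (M.trans q a false).encode) ++ u =
        ((N.trans q a true).encode ++ (N.trans q a false).encode) ++ v →
      (M.trans q a true = N.trans q a true ∧ M.trans q a false = N.trans q a false) ∧ u = v := by
    intro q a u v e
    simp only [List.append_assoc] at e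
    obtain ⟨h₁, e⟩ := PosBool.encode_append_inj e
    obtain ⟨h₂, e⟩ := PosBool.encode_append_inj e
    exact ⟨⟨h₁, h₂⟩, e⟩
  have row := fun q (u v : List ARASym) => flatMap_append_inj (u := u) (v := v)
    (fun a u v e => by
      obtain ⟨⟨h₁, h₂⟩, e⟩ := cell q a u v e
      exact ⟨by rw [h₁, h₂], e⟩) (List.finRange m)
  have tab := (flatMap_append_inj (u := []) (v := [])
    (fun q u v e => by
      obtain ⟨h, e⟩ := row q u v e
      refine ⟨?_, e⟩
      simp only [List.flatMap]
      exact congrArg List.flatten (List.map_congr_left h)) (List.finRange k) (by simpa using e)).1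
  cases M with | mk sM tM => cases N with | mk sN tN =>
  obtain rfl : sM = sN := Fin.ext hs
  congr 1
  funext q a b
  have h := (row q [] [] (by simpa using tab q (List.mem_finRange q))).1 a (List.mem_finRange a)
  have := (cell q a [] [] (by simpa using h)).1
  cases b
  · exact this.2
  · exact this.1

theorem SafetyLTL.encodeFormula_append_inj {m : ℕ} {φ ψ : SafetyLTL (Fin m)} {u v : List LTLSym}
    (e : φ.encodeFormula ++ u = ψ.encodeFormula ++ v) : φ = ψ ∧ u = v := by
  induction φ generalizing ψ u v with
  | letter q =>
    cases ψ <;> simp [encodeFormula] at e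
    have := unary_append_inj (s := LTLSym.tick) (t := .sep) (by decide) e
    exact ⟨by rw [Fin.ext this.1], this.2⟩
  | top | bot | up | notUp => cases ψ <;> simp [encodeFormula] at e ⊢; exact e
  | next φ ih | freeze φ ih =>
    cases ψ <;> simp [encodeFormula] at e
    obtain ⟨rfl, e₁⟩ := ih e
    exact ⟨rfl, e₁⟩
  | and φ₁ φ₂ ih₁ ih₂ | or φ₁ φ₂ ih₁ ih₂ | release φ₁ φ₂ ih₁ ih₂ =>
    cases ψ <;> simp [encodeFormula] at e
    obtain ⟨rfl, e₁⟩ := ih₁ e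
    obtain ⟨rfl, e₂⟩ := ih₂ e₁
    exact ⟨rfl, e₂⟩

/-- Distinct formulae have distinct strings. -/
theorem SafetyLTL.encode_inj {m m' : ℕ} {φ : SafetyLTL (Fin m)} {ψ : SafetyLTL (Fin m')}
    (e : φ.encode = ψ.encode) : m = m' ∧ HEq φ ψ := by
  simp only [encode] at e
  obtain ⟨rfl, e⟩ := unary_append_inj (by decide) e
  exact ⟨rfl, heq_of_eq (encodeFormula_append_inj (u := []) (v := []) (by simpa using e)).1⟩

/-- Safety 1ARA₁ nonemptiness: given a safety 1ARA₁, is its language nonempty? -/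
def safetyARANonemptiness : Language ARASym :=
  {w | ∃ (m k : ℕ) (M : SafetyARA (Fin m) (Fin k)), w = M.encode ∧ M.lang.Nonempty}

/-- Safety LTL↓₁(X, R) satisfiability: given a sentence, is its language nonempty? -/
def safetyLTLSatisfiability : Language LTLSym :=
  {w | ∃ (m : ℕ) (φ : SafetyLTL (Fin m)), w = φ.encode ∧ φ.IsSentence ∧ φ.lang.Nonempty}

/-! ## The class ExpSpace -/

/-- Deterministic Turing machines with input alphabet `A` and one tape, which is infinite to the
right. The machine halts when `trans` is undefined. -/
structure TuringDecider (A : Type) where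
  Sym : Type
  [symFintype : Fintype Sym]
  State : Type
  [stateFintype : Fintype State]
  inSym : A ↪ Sym
  blank : Sym
  inSym_ne_blank : ∀ a, inSym a ≠ blank
  start : State
  accept : Set State
  trans : State → Sym → Option (State × Sym × Turing.Dir)

namespace TuringDecider

variable {A : Type}

/-- Configurations: the state, the position of the head and the contents of the tape. -/
structure Cfg (M : TuringDecider A) where
  state : M.State
  head : ℕ
  tape : ℕ → M.Sym

/-- Head movement on a tape with cells `0, 1, 2, …`; at cell `0`, a move to the left has
no effect. -/
def moveHead (i : ℕ) : Turing.Dir → ℕ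
  | .left => i - 1
  | .right => i + 1

/-- The initial configuration on the input `x`. -/
def initial (M : TuringDecider A) (x : List A) : M.Cfg where
  state := M.start
  head := 0
  tape i := (x[i]?.map M.inSym).getD M.blank

/-- One computation step. -/
def step (M : TuringDecider A) (c : M.Cfg) : Option M.Cfg :=
  (M.trans c.state (c.tape c.head)).map fun r =>
    { state := r.1
      head := moveHead c.head r.2.2
      tape := Function.update c.tape c.head r.2.1 }

end TuringDecider

/-- `L` is decided by a deterministic Turing machine that halts on every input and, on inputs of
length `n`, visits only the first `2 ^ p(n)` tape cells, for some polynomial `p`. -/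
def InExpSpace {A : Type} (L : Language A) : Prop :=
  ∃ (M : TuringDecider A) (p : Polynomial ℕ), ∀ x : List A,
    (∀ c, StateTransition.Reaches M.step (M.initial x) c → c.head < 2 ^ p.eval x.length) ∧
    ∃ c, StateTransition.Reaches M.step (M.initial x) c ∧ M.step c = none ∧
      (c.state ∈ M.accept ↔ x ∈ L)

/-! ## Logarithmic-space reductions -/

/-- Movements of a head. -/
inductive HeadMove : Type
  | left | stay | right

/-- Head movement on a tape with cells `0, 1, 2, …`; at cell `0`, a move to the left has
no effect. -/
def HeadMove.apply (i : ℕ) : HeadMove → ℕ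
  | .left => i - 1
  | .stay => i
  | .right => i + 1

/-- The contents of a cell of a read-only input tape. -/
inductive InCell (A : Type) : Type
  | leftEnd
  | sym (a : A)
  | rightEnd

/-- The cell `i` of the input tape for `x`: cell `0` holds the left end marker, cells
`1, …, |x|` hold `x`, and the next cell holds the right end marker. -/
def inputCell {A : Type} (x : List A) : ℕ → InCell A
  | 0 => .leftEnd
  | i + 1 => (x[i]?.map InCell.sym).getD .rightEnd

/-- Deterministic Turing machines with a two-way read-only input tape over `A`, finitely many
work tapes, and a one-way write-only output tape over `B`. In each step at most one symbol
is appended to the output. The machine halts when `trans` is undefined. -/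
structure Transducer (A B : Type) where
  tapes : ℕ
  Sym : Type
  [symFintype : Fintype Sym]
  blank : Sym
  State : Type
  [stateFintype : Fintype State]
  start : State
  trans : State → InCell A → (Fin tapes → Sym) →
    Option (State × HeadMove × (Fin tapes → Sym × HeadMove) × Option B)

namespace Transducer

variable {A B : Type}

/-- Configurations: the state, the position of the input head, the positions of the work heads,
the contents of the work tapes, and the output written so far. -/
structure Cfg (T : Transducer A B) where
  state : T.State
  inHead : ℕ
  head : Fin T.tapes → ℕ
  tape : Fin T.tapes → ℕ → T.Sym
  out : List B

/-- The initial configuration. -/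
def initial (T : Transducer A B) : T.Cfg where
  state := T.start
  inHead := 0
  head _ := 0
  tape _ _ := T.blank
  out := []

/-- One computation step on the input `x`. The input head stays between the end markers. -/
def step (T : Transducer A B) (x : List A) (c : T.Cfg) : Option T.Cfg :=
  (T.trans c.state (inputCell x c.inHead) fun t => c.tape t (c.head t)).map
    fun (q, d, w, o) =>
      { state := q
        inHead := min (d.apply c.inHead) (x.length + 1)
        head := fun t => (w t).2.apply (c.head t)
        tape := fun t => Function.update (c.tape t) (c.head t) (w t).1
        out := c.out ++ o.toList }

end Transducer

/-- `f` is computed by a transducer that halts on every input and, on inputs of length `n`, visits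
only `O(log n)` cells of each work tape. -/
def LogspaceComputable {A B : Type} (f : List A → List B) : Prop :=
  ∃ (T : Transducer A B) (C : ℕ), ∀ x : List A,
    (∀ c, StateTransition.Reaches (T.step x) T.initial c →
      ∀ t, c.head t < C * (Nat.log 2 x.length + 1)) ∧
    ∃ c, StateTransition.Reaches (T.step x) T.initial c ∧ T.step x c = none ∧ c.out = f x

/-- Logarithmic-space many-one reducibility. -/
def LogspaceReducible {A B : Type} (L : Language A) (P : Language B) : Prop :=
  ∃ f : List A → List B, LogspaceComputable f ∧ ∀ x, x ∈ L ↔ f x ∈ P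

/-- `P` is ExpSpace-hard: every language in ExpSpace, over any finite alphabet, is reducible
to `P` in logarithmic space. -/
def ExpSpaceHard {B : Type} (P : Language B) : Prop :=
  ∀ (A : Type) [Finite A] (L : Language A), InExpSpace L → LogspaceReducible L P

/-! A deterministic machine working in space `2 ^ p(n)` is turned into a cellular automaton on `K =
2 ^ N` cells with forbidden contents, where `N` dominates a polynomial in `n`. Halting
configurations repeat forever, so the machine accepts iff an infinite space-time diagram without
forbidden contents exists (`InExpSpace.exists_cellRule`).

The diagram is written as a data word, one configuration after another; each cell is a letter
followed by the `N` bits of its address. Cell letters also record the contents of both neighbours,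
and bit letters record a carry. Hence the shape of the word, the counting of addresses modulo `K`
and the agreement of neighbours reduce to conditions on letters at distance `1` and `N + 1`
(`CellRule.letter_structure`), which instances of size polynomial in `n` can express.

It remains to compare a cell with the same cell of the next configuration, exponentially many
positions later. This is what the data are for. Cells with equal data must have equal addresses,
which is checked separately for each bit; and the datum of a cell must recur before the next but one
first cell, with the contents prescribed by the rule. The deadline turns the recurrence into a
safety condition, because missing it is visible at a finite position. Within the deadline only one
cell has the same address, so the recurrence happens at the right cell.

Correctness of both reductions comes from one cycle: a diagram gives a word satisfying the sentence
(`CellRule.sat_sentence`), words satisfying the sentence are accepted by the automaton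
(`CellRule.automaton_accepts_of_sat`), and accepted words yield a diagram
(`CellRule.exists_run_of_accepts`).

For logarithmic space, `N` is the range `(b + 2) ^ (n.size + 1)` of a counter with `n.size + 1`
digits in base `b + 2`; a large base `b + 2` makes it exceed the given polynomial, so no polynomial
has to be evaluated. Instances are printed by nested loops over such counters. The loops are
composed from fragments that sweep over a word, and fragments are compiled into transducers once and
for all (`Frag.logspaceComputable`). -/

/-! ## Sweeping fragments -/

/-- A program fragment that operates on a word over `S` held on a work tape. In each round it passes
over the word from left to right with a Mealy machine, and then, depending on the state and on the
current input cell, moves the input head, possibly extends the word by one symbol, possibly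
produces an output symbol, and either starts a new round or exits with a value in `E`. -/
structure Frag (A O S E : Type) where
  Q : Type
  [fintype : Fintype Q]
  start : Q
  mealy : Q → S → Q × S
  act : Q → InCell A → (Q ⊕ E) × HeadMove × Option S × Option O

attribute [instance] Frag.fintype

/-- One pass of a Mealy machine over a word. -/
def mealyRun {Q S : Type} (δ : Q → S → Q × S) : Q → List S → Q × List S
  | q, [] => (q, [])
  | q, s :: w => ((mealyRun δ (δ q s).1 w).1, (δ q s).2 :: (mealyRun δ (δ q s).1 w).2)

theorem mealyRun_length {Q S : Type} (δ : Q → S → Q × S) (q : Q) (w : List S) :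
    (mealyRun δ q w).2.length = w.length := by
  induction w generalizing q with
  | nil => rfl
  | cons s w ih => simp [mealyRun, ih]

namespace Frag

variable {A O S E E₂ : Type}

/-- `F.Path x bd q w h e w' h' o`: started in state `q` with word `w` and input head at `h`, the
fragment exits with value `e`, word `w'` and input head at `h'`, after producing the output `o`;
at the start of each round the word has length at most `bd`. -/
inductive Path (F : Frag A O S E) (x : List A) (bd : ℕ) :
    F.Q → List S → ℕ → E → List S → ℕ → List O → Prop
  | exit {q : F.Q} {w : List S} {h : ℕ} {e : E} {mv : HeadMove} {ap : Option S} {o : Option O}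
      {w' : List S} {h' : ℕ} {os : List O} (hbd : w.length ≤ bd)
      (hact : F.act (mealyRun F.mealy q w).1 (inputCell x h) = (.inr e, mv, ap, o))
      (hw : w' = (mealyRun F.mealy q w).2 ++ ap.toList)
      (hh : h' = min (mv.apply h) (x.length + 1)) (ho : os = o.toList) :
      Path F x bd q w h e w' h' os
  | step {q q₁ : F.Q} {w : List S} {h : ℕ} {e : E} {mv : HeadMove} {ap : Option S} {o : Option O}
      {w₁ w₂ : List S} {h₁ h₂ : ℕ} {os outs : List O} (hbd : w.length ≤ bd)
      (hact : F.act (mealyRun F.mealy q w).1 (inputCell x h) = (.inl q₁, mv, ap, o))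
      (hw : w₁ = (mealyRun F.mealy q w).2 ++ ap.toList)
      (hh : h₁ = min (mv.apply h) (x.length + 1))
      (next : Path F x bd q₁ w₁ h₁ e w₂ h₂ os) (ho : outs = o.toList ++ os) :
      Path F x bd q w h e w₂ h₂ outs

/-- Runs from the start state. -/
abbrev Runs (F : Frag A O S E) (x : List A) (bd : ℕ) (w : List S) (h : ℕ) (e : E)
    (w₂ : List S) (h₂ : ℕ) (o : List O) : Prop :=
  F.Path x bd F.start w h e w₂ h₂ o

/-- A fragment that makes a single pass. -/
def pass {Q : Type} [Fintype Q] (start : Q) (mealy : Q → S → Q × S)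
    (fin : Q → InCell A → E × HeadMove × Option S × Option O) : Frag A O S E where
  Q := Q
  start := start
  mealy := mealy
  act q a := (.inr (fin q a).1, (fin q a).2)

theorem pass_runs {Q : Type} [Fintype Q] (start : Q) (mealy : Q → S → Q × S)
    (fin : Q → InCell A → E × HeadMove × Option S × Option O) (x : List A) (bd : ℕ) (w : List S)
    (h : ℕ) (hbd : w.length ≤ bd) {e : E} {w' : List S} {h' : ℕ} {o : List O}
    (he : e = (fin (mealyRun mealy start w).1 (inputCell x h)).1)
    (hw : w' = (mealyRun mealy start w).2 ++
      (fin (mealyRun mealy start w).1 (inputCell x h)).2.2.1.toList)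
    (hh : h' = min ((fin (mealyRun mealy start w).1 (inputCell x h)).2.1.apply h) (x.length + 1))
    (ho : o = (fin (mealyRun mealy start w).1 (inputCell x h)).2.2.2.toList) :
    (pass start mealy fin).Runs x bd w h e w' h' o :=
  .exit hbd (by subst he; rfl) hw hh ho

/-- Sequential composition. -/
def bind [Fintype E] (F : Frag A O S E) (G : E → Frag A O S E₂) : Frag A O S E₂ where
  Q := F.Q ⊕ Σ e, (G e).Q
  start := .inl F.start
  mealy q s := match q with
    | .inl q => (.inl (F.mealy q s).1, (F.mealy q s).2)
    | .inr ⟨e, q⟩ => (.inr ⟨e, ((G e).mealy q s).1⟩, ((G e).mealy q s).2)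
  act q a := match q with
    | .inl q => ((match (F.act q a).1 with
        | .inl q' => .inl (.inl q')
        | .inr e => .inl (.inr ⟨e, (G e).start⟩)), (F.act q a).2)
    | .inr ⟨e, q⟩ => ((match ((G e).act q a).1 with
        | .inl q' => .inl (.inr ⟨e, q'⟩)
        | .inr e' => .inr e'), ((G e).act q a).2)

theorem bind_mealyRun_inl [Fintype E] (F : Frag A O S E) (G : E → Frag A O S E₂) (q : F.Q)
    (w : List S) : mealyRun (F.bind G).mealy (.inl q) w =
      (.inl (mealyRun F.mealy q w).1, (mealyRun F.mealy q w).2) := by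
  induction w generalizing q with
  | nil => rfl
  | cons s w ih => simp only [mealyRun, bind] at ih ⊢; simp [ih]

theorem bind_mealyRun_inr [Fintype E] (F : Frag A O S E) (G : E → Frag A O S E₂) (e : E)
    (q : (G e).Q) (w : List S) : mealyRun (F.bind G).mealy (.inr ⟨e, q⟩) w =
      (.inr ⟨e, (mealyRun (G e).mealy q w).1⟩, (mealyRun (G e).mealy q w).2) := by
  induction w generalizing q with
  | nil => rfl
  | cons s w ih => simp only [mealyRun, bind] at ih ⊢; simp [ih]

/-- The exit of `F` becomes an ordinary step into the start state of `G e`; its head movement,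
appended symbol and output are still carried out. Each part is lifted by induction on its path. -/
theorem bind_runs [Fintype E] {F : Frag A O S E} {G : E → Frag A O S E₂} {x : List A} {bd : ℕ}
    {w w₁ w₂ : List S} {h h₁ h₂ : ℕ} {e : E} {e' : E₂} {o₁ o₂ : List O}
    (hF : F.Runs x bd w h e w₁ h₁ o₁) (hG : (G e).Runs x bd w₁ h₁ e' w₂ h₂ o₂) :
    (F.bind G).Runs x bd w h e' w₂ h₂ (o₁ ++ o₂) := by
  have key₂ : ∀ {q w h e' w₂ h₂ o₂}, (G e).Path x bd q w h e' w₂ h₂ o₂ →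
      (F.bind G).Path x bd (.inr ⟨e, q⟩) w h e' w₂ h₂ o₂ := by
    intro q w h e' w₂ h₂ o₂ hp
    induction hp with
    | @exit _ _ _ _ _ ap _ _ _ _ hbd hact hw hh ho =>
      refine .exit (ap := ap) hbd ?_ ?_ hh ho
      · rw [bind_mealyRun_inr]; simp [bind, hact]
      · rw [bind_mealyRun_inr]; exact hw
    | @step _ _ _ _ _ _ ap _ _ _ _ _ _ _ hbd hact hw hh _ ho ih =>
      refine .step (ap := ap) hbd ?_ ?_ hh ih ho
      · rw [bind_mealyRun_inr]; simp [bind, hact]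
      · rw [bind_mealyRun_inr]; exact hw
  have key₁ : ∀ {q w h w₁ h₁ o₁}, F.Path x bd q w h e w₁ h₁ o₁ →
      (G e).Runs x bd w₁ h₁ e' w₂ h₂ o₂ →
      (F.bind G).Path x bd (.inl q) w h e' w₂ h₂ (o₁ ++ o₂) := by
    clear hF hG
    intro q w h w₁ h₁ o₁ hp hG
    induction hp with
    | @exit _ _ _ _ _ ap _ _ _ _ hbd hact hw hh ho =>
      refine .step (ap := ap) hbd ?_ ?_ hh (key₂ hG) (by rw [ho])
      · rw [bind_mealyRun_inl]; simp [bind, hact]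
      · rw [bind_mealyRun_inl]; exact hw
    | @step _ _ _ _ _ _ ap _ _ _ _ _ _ _ hbd hact hw hh _ ho ih =>
      refine .step (ap := ap) hbd ?_ ?_ hh (ih key₂ hG) (by rw [ho, List.append_assoc])
      · rw [bind_mealyRun_inl]; simp [bind, hact]
      · rw [bind_mealyRun_inl]; exact hw
  exact key₁ hF hG

/-- Repetition as long as the exit value is `true`. -/
def doWhile (F : Frag A O S Bool) : Frag A O S Unit where
  Q := F.Q
  start := F.start
  mealy := F.mealy
  act q a := ((match (F.act q a).1 with
    | .inl q' => .inl q'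
    | .inr true => .inl F.start
    | .inr false => .inr ()), (F.act q a).2)

theorem doWhile_exit {F : Frag A O S Bool} {x : List A} {bd : ℕ} {w w₁ : List S} {h h₁ : ℕ}
    {o₁ : List O} (hF : F.Runs x bd w h false w₁ h₁ o₁) :
    F.doWhile.Runs x bd w h () w₁ h₁ o₁ := by
  have key : ∀ {q w h b w₁ h₁ o₁}, F.Path x bd q w h b w₁ h₁ o₁ → b = false →
      F.doWhile.Path x bd q w h () w₁ h₁ o₁ := by
    intro q w h b w₁ h₁ o₁ hp hb
    induction hp with
    | exit hbd hact hw hh ho =>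
      subst hb
      exact .exit hbd (by simp [doWhile, hact]) hw hh ho
    | step hbd hact hw hh _ ho ih =>
      exact .step hbd (by simp [doWhile, hact]) hw hh (ih hb) ho
  exact key hF rfl

theorem doWhile_again {F : Frag A O S Bool} {x : List A} {bd : ℕ} {w w₁ w₂ : List S}
    {h h₁ h₂ : ℕ} {o₁ o₂ : List O} (hF : F.Runs x bd w h true w₁ h₁ o₁)
    (hr : F.doWhile.Runs x bd w₁ h₁ () w₂ h₂ o₂) :
    F.doWhile.Runs x bd w h () w₂ h₂ (o₁ ++ o₂) := by
  have key : ∀ {q w h b w₁ h₁ o₁}, F.Path x bd q w h b w₁ h₁ o₁ → b = true →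
      F.doWhile.Runs x bd w₁ h₁ () w₂ h₂ o₂ →
      F.doWhile.Path x bd q w h () w₂ h₂ (o₁ ++ o₂) := by
    intro q w h b w₁ h₁ o₁ hp hb hr
    induction hp with
    | exit hbd hact hw hh ho =>
      subst hb
      exact .step hbd (by simp [doWhile, hact]; rfl) hw hh hr (by rw [ho])
    | step hbd hact hw hh _ ho ih =>
      exact .step hbd (by simp [doWhile, hact]; rfl) hw hh (ih hb hr)
        (by rw [ho, List.append_assoc])
  exact key hF rfl hr

/-! ### Fragments as transducers -/

/-- Control states of the transducer for a fragment. -/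
inductive Ctl (Q : Type) : Type
  | init
  | halt
  | right (q : Q)
  | left (q : Q)
  deriving Fintype

/-- The work tape that holds the word `w`. -/
def tapeOf (w : List S) : ℕ → Option (Option S)
  | 0 => some none
  | i + 1 => w[i]?.map some

theorem update_tapeOf (u v : List S) (s s' : S) :
    Function.update (tapeOf (u ++ s :: v)) (u.length + 1) (some (some s')) =
      tapeOf (u ++ s' :: v) := by
  funext i
  rcases i with _ | i
  · simp [tapeOf]
  · by_cases hi : i = u.length
    · subst hi; simp [tapeOf]
    · rw [Function.update_of_ne (by omega)]
      simp only [tapeOf]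
      rcases Nat.lt_or_gt_of_ne hi with h | h
      · rw [List.getElem?_append_left h, List.getElem?_append_left h]
      · rw [List.getElem?_append_right h.le, List.getElem?_append_right h.le]
        obtain ⟨d, hd⟩ : ∃ d, i - u.length = d + 1 := ⟨i - u.length - 1, by omega⟩
        rw [hd]; simp

/-- At the end of a round the head is on the first blank. This treats both the appending of a symbol
and the rewriting of the blank. -/
theorem update_tapeOf_end (w : List S) (ap : Option S) :
    Function.update (tapeOf w) (w.length + 1) (ap.map some) = tapeOf (w ++ ap.toList) := by
  funext i
  rcases i with _ | i
  · simp [tapeOf]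
  · by_cases hi : i = w.length
    · subst hi; cases ap <;> simp [tapeOf]
    · rw [Function.update_of_ne (by omega)]
      simp only [tapeOf]
      rcases Nat.lt_or_gt_of_ne hi with h | h
      · rw [List.getElem?_append_left h]
      · rw [List.getElem?_eq_none h.le, List.getElem?_eq_none]
        have : ap.toList.length ≤ 1 := by cases ap <;> simp
        simp; omega

variable [Fintype S]

/-- The transducer for a fragment: cell `0` of its work tape holds a marker, and the next cells
hold the word. -/
def toTransducer (F : Frag A O S E) : Transducer A O where
  tapes := 1
  Sym := Option (Option S)
  blank := none
  State := Ctl F.Q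
  start := .init
  trans q a s := match q, s 0 with
    | .init, _ => some (.right F.start, .stay, fun _ => (some none, .right), none)
    | .halt, _ => none
    | .right q, some (some s) =>
        some (.right (F.mealy q s).1, .stay, fun _ => (some (some (F.mealy q s).2), .right), none)
    | .right q, none =>
        some ((match (F.act q a).1 with
          | .inl q' => .left q'
          | .inr _ => .halt), (F.act q a).2.1,
          fun _ => ((F.act q a).2.2.1.map some, .left), (F.act q a).2.2.2)
    | .right _, some none => none
    | .left q, some (some s) => some (.left q, .stay, fun _ => (some (some s), .left), none)
    | .left q, some none => some (.right q, .stay, fun _ => (some none, .right), none)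
    | .left _, none => none

/-- Configurations of the transducer for a fragment. -/
def cfgOf (F : Frag A O S E) (q : Ctl F.Q) (h k : ℕ) (w : List S) (o : List O) :
    F.toTransducer.Cfg where
  state := q
  inHead := h
  head _ := k
  tape _ := tapeOf w
  out := o

/-- Steps of a transducer from configurations whose work heads are at most at `bd`. -/
def BStep (T : Transducer A O) (x : List A) (bd : ℕ) (c c' : T.Cfg) : Prop :=
  T.step x c = some c' ∧ ∀ t, c.head t ≤ bd

theorem steps_right (F : Frag A O S E) (x : List A) {bd h : ℕ} (o : List O)
    (hh : h ≤ x.length + 1) (u v : List S) (q : F.Q) (hbd : u.length + v.length ≤ bd) :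
    Relation.ReflTransGen (BStep F.toTransducer x (bd + 1))
      (F.cfgOf (.right q) h (u.length + 1) (u ++ v) o)
      (F.cfgOf (.right (mealyRun F.mealy q v).1) h (u.length + v.length + 1)
        (u ++ (mealyRun F.mealy q v).2) o) := by
  induction v generalizing u q with
  | nil => exact .refl
  | cons s v ih =>
    have := ih (u ++ [(F.mealy q s).2]) (F.mealy q s).1 (by simp at hbd ⊢; omega)
    simp only [List.append_assoc, List.singleton_append, List.length_append, List.length_cons,
      List.length_nil, Nat.zero_add] at this
    refine .head (b := F.cfgOf (.right (F.mealy q s).1) h (u.length + 1 + 1)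
      (u ++ (F.mealy q s).2 :: v) o) ⟨?_, fun _ => by simp [cfgOf] at hbd ⊢; omega⟩ ?_
    · simp only [Transducer.step, toTransducer, cfgOf]
      have : tapeOf (u ++ s :: v) (u.length + 1) = some (some s) := by simp [tapeOf]
      simp [this, HeadMove.apply, hh, update_tapeOf]
    · simpa [mealyRun, Nat.add_assoc, Nat.add_comm 1] using this

theorem steps_left (F : Frag A O S E) (x : List A) {bd h : ℕ} (o : List O)
    (hh : h ≤ x.length + 1) (w : List S) (q : F.Q) (k : ℕ) (hk : k ≤ w.length)
    (hbd : k ≤ bd) :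
    Relation.ReflTransGen (BStep F.toTransducer x (bd + 1))
      (F.cfgOf (.left q) h k w o) (F.cfgOf (.right q) h 1 w o) := by
  induction k with
  | zero =>
    refine .single ⟨?_, fun _ => by simp [cfgOf]⟩
    have : Function.update (tapeOf w) 0 (some none) = tapeOf w := by
      funext i; rcases i with _ | i <;> simp [tapeOf]
    simp [Transducer.step, toTransducer, cfgOf, tapeOf, HeadMove.apply, hh]
    exact funext fun _ => this
  | succ k ih =>
    refine .head (b := F.cfgOf (.left q) h k w o) ⟨?_, fun _ => by simp [cfgOf]; omega⟩
      (ih (by omega) (by omega))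
    have h1 : tapeOf w (k + 1) = some (some w[k]) := by
      simp [tapeOf, List.getElem?_eq_getElem (show k < w.length by omega)]
    have h2 : Function.update (tapeOf w) (k + 1) (some (some w[k])) = tapeOf w := by
      rw [← h1, Function.update_eq_self]
    simp [Transducer.step, toTransducer, cfgOf, h1, HeadMove.apply, hh, h2]

/-- A round is simulated by a sweep to the right that runs the Mealy machine, the action at the
first blank, and a return to the marker in cell `0`. Words of length at most `bd` keep the head at
most at cell `bd + 1`. -/
theorem path_steps (F : Frag A O S E) (x : List A) {bd : ℕ} {q : F.Q} {w w' : List S}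
    {h h' : ℕ} {e : E} {os : List O} (hp : F.Path x bd q w h e w' h' os) (o : List O)
    (hh : h ≤ x.length + 1) :
    ∃ c, Relation.ReflTransGen (BStep F.toTransducer x (bd + 1))
      (F.cfgOf (.right q) h 1 w o) c ∧ F.toTransducer.step x c = none ∧ c.out = o ++ os ∧
      ∀ t, c.head t ≤ bd + 1 := by
  induction hp generalizing o with
  | @exit q w h e mv ap o' w' h' os hbd hact hw hh' ho =>
    have hr := F.steps_right x o hh [] w q (bd := bd) (by simpa using hbd)
    have hl := mealyRun_length F.mealy q w
    revert hact hw hr hl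
    generalize mealyRun F.mealy q w = r
    intro hact hw hr hl
    refine ⟨F.cfgOf .halt h' w.length w' (o ++ os), hr.tail ⟨?_, fun _ => ?_⟩, ?_, rfl,
      fun _ => ?_⟩
    · have h1 : tapeOf r.2 (w.length + 1) = none := by
        simp [tapeOf, hl]
      have h2 := update_tapeOf_end r.2 ap
      rw [hl] at h2
      simp [Transducer.step, toTransducer, cfgOf, h1, hact, HeadMove.apply, h2, hw, hh', ho]
    · simp [cfgOf]; omega
    · simp [Transducer.step, toTransducer, cfgOf]
    · simp [cfgOf]; omega
  | @step q q₁ w h e mv ap o' w₁ w' h₁ h' os os' hbd hact hw hh' _ ho ih =>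
    have hr := F.steps_right x o hh [] w q (bd := bd) (by simpa using hbd)
    have hl := mealyRun_length F.mealy q w
    revert hact hw hr hl
    generalize mealyRun F.mealy q w = r
    intro hact hw hr hl
    obtain ⟨c, hc, hs, hc', hb⟩ := ih (o ++ o'.toList) (by rw [hh']; exact min_le_right _ _)
    refine ⟨c, ?_, hs, by rw [hc', ho, List.append_assoc], hb⟩
    refine (hr.tail (c := F.cfgOf (.left q₁) h₁ w.length w₁ (o ++ o'.toList)) ⟨?_, fun _ => ?_⟩).trans
      ((F.steps_left x _ (by rw [hh']; exact min_le_right _ _) w₁ q₁ w.length ?_ hbd).trans hc)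
    · have h1 : tapeOf r.2 (w.length + 1) = none := by
        simp [tapeOf, hl]
      have h2 := update_tapeOf_end r.2 ap
      rw [hl] at h2
      simp [Transducer.step, toTransducer, cfgOf, h1, hact, HeadMove.apply, h2, hw, hh']
    · simp [cfgOf]; omega
    · rw [hw]; simp [hl]

/-- By determinism every reachable configuration lies on the given halting computation, so a bound
along that computation bounds them all. -/
theorem head_le_of_reaches {T : Transducer A O} {x : List A} {bd : ℕ} {c₀ c : T.Cfg}
    (h : Relation.ReflTransGen (BStep T x bd) c₀ c) (hc : T.step x c = none)
    (hb : ∀ t, c.head t ≤ bd) {d : T.Cfg} (hd : StateTransition.Reaches (T.step x) c₀ d) (t) :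
    d.head t ≤ bd := by
  induction h using Relation.ReflTransGen.head_induction_on with
  | refl =>
    rcases Relation.ReflTransGen.cases_head hd with rfl | ⟨c', h', _⟩
    · exact hb t
    · rw [hc] at h'; cases h'
  | head h _ ih =>
    rcases Relation.ReflTransGen.cases_head hd with rfl | ⟨c', h', hd₂⟩
    · exact h.2 t
    · rw [h.1] at h'; cases h'
      exact ih hd₂

/-- A function is computable in logarithmic space if some fragment, started on the empty word,
computes it with words of logarithmic length. -/
theorem logspaceComputable (F : Frag A O S E) (g : List A → List O) (C : ℕ)
    (hF : ∀ x, ∃ e w h, F.Runs x (C * (Nat.log 2 x.length + 1)) [] 0 e w h (g x)) :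
    LogspaceComputable g := by
  refine ⟨F.toTransducer, C + 2, fun x => ?_⟩
  obtain ⟨e, w, h, hp⟩ := hF x
  obtain ⟨c, hc, hs, ho, hb⟩ := F.path_steps x hp [] (by omega)
  have h0 : Relation.ReflTransGen (BStep F.toTransducer x (C * (Nat.log 2 x.length + 1) + 1))
      F.toTransducer.initial c := by
    refine .head ⟨?_, fun _ => by simp [Transducer.initial]⟩ hc
    have : Function.update (fun _ : ℕ => (none : Option (Option S))) 0 (some none) =
        tapeOf [] := by
      funext i; rcases i with _ | i <;> simp [tapeOf]
    simp [Transducer.step, Transducer.initial, toTransducer, cfgOf, HeadMove.apply]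
    exact funext fun _ => this
  refine ⟨fun d hd t => ?_, c, Relation.ReflTransGen.mono (fun _ _ h => h.1) _ _ h0, hs, by simpa using ho⟩
  have := head_le_of_reaches h0 hs hb hd t
  -- The summand `2` in `C + 2` pays for the marker in cell `0` and the blank after the word.
  rw [Nat.add_mul]
  omega

end Frag

/-! ### Loops of prescribed length and output of fixed strings -/

namespace Frag

variable {A O S E : Type}

theorem Path.mono {F : Frag A O S E} {x : List A} {bd bd' : ℕ} (hb : bd ≤ bd') {q : F.Q}
    {w w' : List S} {h h' : ℕ} {e : E} {o : List O} (hp : F.Path x bd q w h e w' h' o) :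
    F.Path x bd' q w h e w' h' o := by
  induction hp with
  | exit hbd hact hw hh ho => exact .exit (hbd.trans hb) hact hw hh ho
  | step hbd hact hw hh _ ho ih => exact .step (hbd.trans hb) hact hw hh ih ho

/-- The body is executed before its exit value is tested, which is why `0 < N` is needed; `W` and
`H` are the loop invariants for the word and the input head. -/
theorem doWhile_range {F : Frag A O S Bool} {x : List A} {bd N : ℕ} (hN : 0 < N)
    (W : ℕ → List S) (H : ℕ → ℕ) (g : ℕ → List O)
    (hF : ∀ i < N, F.Runs x bd (W i) (H i) (decide (i + 1 < N)) (W (i + 1)) (H (i + 1)) (g i)) :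
    F.doWhile.Runs x bd (W 0) (H 0) () (W N) (H N) ((List.range N).flatMap g) := by
  have key : ∀ k, ∀ i < N, N = i + k →
      F.doWhile.Runs x bd (W i) (H i) () (W N) (H N) ((List.range' i k).flatMap g) := by
    intro k
    induction k with
    | zero => intro i hi h; omega
    | succ k ih =>
      intro i hi h
      have := hF i hi
      rw [List.range'_succ, List.flatMap_cons]
      by_cases hk : i + 1 < N
      · rw [decide_eq_true hk] at this
        exact doWhile_again this (ih (i + 1) hk (by omega))
      · obtain rfl : k = 0 := by omega
        rw [decide_eq_false hk] at this
        obtain rfl : N = i + 1 := by omega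
        simpa using doWhile_exit this
  simpa [List.range_eq_range'] using key N 0 hN (by omega)

/-- The fragment that only moves the input head and produces output. -/
def simple (mv : HeadMove) (o : Option O) : Frag A O S Unit :=
  pass () (fun q s => (q, s)) fun _ _ => ((), mv, none, o)

theorem mealyRun_id {Q : Type} (q : Q) (w : List S) :
    mealyRun (fun (q : Q) (s : S) => (q, s)) q w = (q, w) := by
  induction w with
  | nil => rfl
  | cons s w ih => simp [mealyRun, ih]

theorem simple_runs (mv : HeadMove) (o : Option O) (x : List A) (bd : ℕ) (w : List S) (h : ℕ)
    (hbd : w.length ≤ bd) :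
    (simple mv o).Runs x bd w h () w (min (mv.apply h) (x.length + 1)) o.toList :=
  pass_runs _ _ _ _ _ _ _ hbd rfl (by simp [mealyRun_id]) rfl rfl

/-- The fragment that produces the output `l`. -/
def emit : List O → Frag A O S Unit
  | [] => simple .stay none
  | a :: l => (simple .stay (some a)).bind fun _ => emit l

theorem emit_runs (l : List O) (x : List A) (bd : ℕ) (w : List S) (h : ℕ)
    (hbd : w.length ≤ bd) (hh : h ≤ x.length + 1) :
    (emit l).Runs x bd w h () w h l := by
  induction l with
  | nil =>
    have := simple_runs (A := A) (O := O) .stay none x bd w h hbd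
    rw [HeadMove.apply, min_eq_left hh] at this
    exact this
  | cons a l ih =>
    have := simple_runs (A := A) (O := O) .stay (some a) x bd w h hbd
    rw [HeadMove.apply, min_eq_left hh] at this
    exact bind_runs this ih

end Frag

/-! ## Counters -/

/-- Pairs of digits in base `b + 2`. -/
abbrev DigitPair (b : ℕ) : Type := Fin (b + 2) × Fin (b + 2)

/-- The `L` lowest digits of `j` and of `i` in base `b + 2`, lowest digits first. -/
def digitPairs (b : ℕ) : ℕ → ℕ → ℕ → List (DigitPair b)
  | 0, _, _ => []
  | L + 1, j, i => (Fin.ofNat (b + 2) j, Fin.ofNat (b + 2) i) ::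
      digitPairs b L (j / (b + 2)) (i / (b + 2))

theorem digitPairs_length (b L j i : ℕ) : (digitPairs b L j i).length = L := by
  induction L generalizing j i with
  | zero => rfl
  | succ L ih => simp [digitPairs, ih]

/-- Addition of a carry to a digit. -/
def carryStep {b : ℕ} (c : Bool) (d : Fin (b + 2)) : Bool × Fin (b + 2) :=
  if c then (if (d : ℕ) = b + 1 then (true, 0) else (false, Fin.ofNat (b + 2) (d + 1)))
  else (false, d)

theorem carryStep_false {b : ℕ} (d : Fin (b + 2)) : carryStep false d = (false, d) := rfl

theorem carryStep_true (b i : ℕ) :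
    carryStep true (Fin.ofNat (b + 2) i) =
      (decide (i % (b + 2) = b + 1), Fin.ofNat (b + 2) (i + 1)) := by
  unfold carryStep
  by_cases h : i % (b + 2) = b + 1
  · simp only [Fin.val_ofNat, h, if_true, decide_true, Prod.mk.injEq, true_and]
    ext
    simp [Nat.add_mod, h]
  · simp only [Fin.val_ofNat, h, if_true, if_false, decide_false, Prod.mk.injEq, true_and]
    ext
    simp

/-- Increment of the first counter. -/
def incFst {b : ℕ} (c : Bool) (s : DigitPair b) : Bool × DigitPair b :=
  ((carryStep c s.1).1, ((carryStep c s.1).2, s.2))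

/-- Increment of the second counter. -/
def incSnd {b : ℕ} (c : Bool) (s : DigitPair b) : Bool × DigitPair b :=
  ((carryStep c s.2).1, (s.1, (carryStep c s.2).2))

/-- Comparison of the second counter with the first one. -/
def ltStep {b : ℕ} (c : Bool) (s : DigitPair b) : Bool × DigitPair b :=
  (if s.2 = s.1 then c else decide (s.2 < s.1), s)

theorem succ_div_of_mod_ne {B i : ℕ} (hB : 0 < B) (h : i % B ≠ B - 1) :
    (i + 1) / B = i / B := by
  have := Nat.mod_lt i hB
  rw [Nat.succ_div_of_not_dvd]
  intro hd
  have h1 := Nat.div_add_mod i B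
  obtain ⟨c, hc⟩ := hd
  have : i % B + 1 = B * (c - i / B) := by rw [Nat.mul_sub]; omega
  have h2 : B ∣ i % B + 1 := ⟨_, this⟩
  have := Nat.le_of_dvd (by omega) h2
  omega

theorem succ_div_of_mod_eq {B i : ℕ} (hB : 0 < B) (h : i % B = B - 1) :
    (i + 1) / B = i / B + 1 := by
  rw [Nat.succ_div_of_dvd]
  have h1 := Nat.div_add_mod i B
  exact ⟨i / B + 1, by rw [Nat.mul_add]; omega⟩

theorem mealyRun_incFst_false (b L j i : ℕ) :
    mealyRun incFst false (digitPairs b L j i) = (false, digitPairs b L j i) := by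
  induction L generalizing j i with
  | zero => rfl
  | succ L ih => simp [digitPairs, mealyRun, incFst, carryStep_false, ih]

theorem mealyRun_incSnd_false (b L j i : ℕ) :
    mealyRun incSnd false (digitPairs b L j i) = (false, digitPairs b L j i) := by
  induction L generalizing j i with
  | zero => rfl
  | succ L ih => simp [digitPairs, mealyRun, incSnd, carryStep_false, ih]

theorem succ_div_eq_pow_iff {B i L : ℕ} (hB : 0 < B) (h : i % B = B - 1) :
    i / B + 1 = B ^ L ↔ i + 1 = B ^ (L + 1) := by
  have h1 := Nat.div_add_mod i B
  have h2 : i + 1 = B * (i / B + 1) := by rw [Nat.mul_add]; omega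
  rw [h2, pow_succ']
  exact (Nat.mul_right_inj (by omega)).symm

theorem succ_ne_pow {B i L : ℕ} (hB : 0 < B) (h : i % B ≠ B - 1) : i + 1 ≠ B ^ (L + 1) := by
  intro he
  apply h
  have h1 := Nat.div_add_mod i B
  have h3 := Nat.mod_lt i hB
  have h2 : i % B + 1 = B * (B ^ L - i / B) := by rw [Nat.mul_sub, ← pow_succ']; omega
  have := Nat.le_of_dvd (by omega) (⟨_, h2⟩ : B ∣ i % B + 1)
  omega

/-- The carry that leaves the highest digit signals that `i + 1` is the full range; in that case the
digits shown are already those of `0`. -/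
theorem mealyRun_incSnd (b L j i : ℕ) (hi : i < (b + 2) ^ L) :
    mealyRun incSnd true (digitPairs b L j i) =
      (decide (i + 1 = (b + 2) ^ L), digitPairs b L j (i + 1)) := by
  induction L generalizing j i with
  | zero => simp at hi; subst hi; simp [mealyRun, digitPairs]
  | succ L ih =>
    have hd : i / (b + 2) < (b + 2) ^ L := by
      rw [Nat.div_lt_iff_lt_mul (by omega), ← pow_succ]; exact hi
    simp only [digitPairs, mealyRun, incSnd, carryStep_true]
    by_cases h : i % (b + 2) = b + 1
    · have h' : i % (b + 2) = b + 2 - 1 := h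
      simp only [h, decide_true]
      erw [ih _ _ hd]
      rw [succ_div_of_mod_eq (by omega) h']
      simp only [succ_div_eq_pow_iff (show 0 < b + 2 by omega) h']
    · have h' : i % (b + 2) ≠ b + 2 - 1 := h
      simp only [h, decide_false]
      erw [mealyRun_incSnd_false]
      rw [succ_div_of_mod_ne (by omega) h']
      simp [succ_ne_pow (show 0 < b + 2 by omega) h']

theorem mealyRun_incFst (b L j i : ℕ) (hj : j < (b + 2) ^ L) :
    mealyRun incFst true (digitPairs b L j i) =
      (decide (j + 1 = (b + 2) ^ L), digitPairs b L (j + 1) i) := by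
  induction L generalizing j i with
  | zero => simp at hj; subst hj; simp [mealyRun, digitPairs]
  | succ L ih =>
    have hd : j / (b + 2) < (b + 2) ^ L := by
      rw [Nat.div_lt_iff_lt_mul (by omega), ← pow_succ]; exact hj
    simp only [digitPairs, mealyRun, incFst, carryStep_true]
    by_cases h : j % (b + 2) = b + 1
    · have h' : j % (b + 2) = b + 2 - 1 := h
      simp only [h, decide_true]
      erw [ih _ _ hd]
      rw [succ_div_of_mod_eq (by omega) h']
      simp only [succ_div_eq_pow_iff (show 0 < b + 2 by omega) h']
    · have h' : j % (b + 2) ≠ b + 2 - 1 := h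
      simp only [h, decide_false]
      erw [mealyRun_incFst_false]
      rw [succ_div_of_mod_ne (by omega) h']
      simp [succ_ne_pow (show 0 < b + 2 by omega) h']

/-- A loop over the full range leaves its counter at `0` again, so loops can be nested and repeated
without a reset. -/
theorem digitPairs_pow_right (b L j : ℕ) : digitPairs b L j ((b + 2) ^ L) = digitPairs b L j 0 := by
  induction L generalizing j with
  | zero => rfl
  | succ L ih =>
    have : (b + 2) ^ (L + 1) / (b + 2) = (b + 2) ^ L := by
      rw [pow_succ, Nat.mul_div_cancel _ (by omega)]
    simp only [digitPairs, this, ih, Nat.zero_div]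
    congr 2
    ext
    simp [pow_succ]

theorem digitPairs_pow_left (b L i : ℕ) : digitPairs b L ((b + 2) ^ L) i = digitPairs b L 0 i := by
  induction L generalizing i with
  | zero => rfl
  | succ L ih =>
    have : (b + 2) ^ (L + 1) / (b + 2) = (b + 2) ^ L := by
      rw [pow_succ, Nat.mul_div_cancel _ (by omega)]
    simp only [digitPairs, this, ih, Nat.zero_div]
    congr 2
    ext
    simp [pow_succ]

/-- Digits come lowest first, so each unequal pair overrides the verdict of the lower ones and equal
pairs preserve it. -/
theorem mealyRun_ltStep (b L j i : ℕ) (c : Bool) (hj : j < (b + 2) ^ L) (hi : i < (b + 2) ^ L) :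
    mealyRun ltStep c (digitPairs b L j i) =
      (if i = j then c else decide (i < j), digitPairs b L j i) := by
  induction L generalizing j i c with
  | zero => simp at hi hj; subst hi hj; simp [mealyRun, digitPairs]
  | succ L ih =>
    have hdi : i / (b + 2) < (b + 2) ^ L := by
      rw [Nat.div_lt_iff_lt_mul (by omega), ← pow_succ]; exact hi
    have hdj : j / (b + 2) < (b + 2) ^ L := by
      rw [Nat.div_lt_iff_lt_mul (by omega), ← pow_succ]; exact hj
    simp only [digitPairs, mealyRun, ltStep]
    erw [ih _ _ _ hdj hdi]
    simp only [Prod.mk.injEq, and_true]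
    have h1 := Nat.div_add_mod i (b + 2)
    have h2 := Nat.div_add_mod j (b + 2)
    have h3 := Nat.mod_lt i (show 0 < b + 2 by omega)
    have h4 := Nat.mod_lt j (show 0 < b + 2 by omega)
    simp only [Fin.ext_iff, Fin.lt_def, Fin.val_ofNat]
    generalize i / (b + 2) = p at *
    generalize i % (b + 2) = r at *
    generalize j / (b + 2) = p' at *
    generalize j % (b + 2) = r' at *
    subst h1 h2
    rcases lt_trichotomy p p' with h | rfl | h
    · have : (b + 2) * p + (b + 2) ≤ (b + 2) * p' := by
        rw [← Nat.mul_succ]; exact Nat.mul_le_mul_left _ h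
      rw [if_neg (by omega), if_neg (by omega), decide_eq_true h, decide_eq_true (by omega)]
    · simp
    · have : (b + 2) * p' + (b + 2) ≤ (b + 2) * p := by
        rw [← Nat.mul_succ]; exact Nat.mul_le_mul_left _ h
      rw [if_neg (by omega), if_neg (by omega), decide_eq_false (by omega),
        decide_eq_false (by omega)]

theorem decide_succ_lt {i N : ℕ} (h : i < N) : decide (i + 1 < N) = !decide (i + 1 = N) := by
  rw [← decide_not]
  exact decide_eq_decide.mpr (by omega)

/-! ### Counter operations as fragments -/

namespace Frag

variable {A O : Type}

/-- Increment of the first counter; the value tells whether there was no overflow. -/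
def inc₁ (b : ℕ) (mv : HeadMove) : Frag A O (DigitPair b) Bool :=
  pass true incFst fun c _ => (!c, mv, none, none)

/-- Increment of the second counter; the value tells whether there was no overflow. -/
def inc₂ (b : ℕ) : Frag A O (DigitPair b) Bool :=
  pass true incSnd fun c _ => (!c, .stay, none, none)

/-- Whether the second counter is less than the first one. -/
def less (b : ℕ) : Frag A O (DigitPair b) Bool :=
  pass false ltStep fun c _ => (c, .stay, none, none)

theorem inc₁_runs (b : ℕ) (mv : HeadMove) (x : List A) {L j i h : ℕ} (hj : j < (b + 2) ^ L) :
    (inc₁ (O := O) b mv).Runs x L (digitPairs b L j i) h (decide (j + 1 < (b + 2) ^ L))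
      (digitPairs b L (j + 1) i) (min (mv.apply h) (x.length + 1)) [] := by
  refine pass_runs _ _ _ _ _ _ _ (digitPairs_length ..).le ?_ ?_ ?_ ?_ <;>
    rw [mealyRun_incFst _ _ _ _ hj] <;> simp [decide_succ_lt hj]

theorem inc₂_runs (b : ℕ) (x : List A) {L j i h : ℕ} (hi : i < (b + 2) ^ L)
    (hh : h ≤ x.length + 1) :
    (inc₂ (O := O) b).Runs x L (digitPairs b L j i) h (decide (i + 1 < (b + 2) ^ L))
      (digitPairs b L j (i + 1)) h [] := by
  refine pass_runs _ _ _ _ _ _ _ (digitPairs_length ..).le ?_ ?_ ?_ ?_ <;>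
    rw [mealyRun_incSnd _ _ _ _ hi] <;> simp [HeadMove.apply, hh, decide_succ_lt hi]

theorem less_runs (b : ℕ) (x : List A) {L j i h : ℕ} (hj : j < (b + 2) ^ L)
    (hi : i < (b + 2) ^ L) (hh : h ≤ x.length + 1) :
    (less (O := O) b).Runs x L (digitPairs b L j i) h (decide (i < j))
      (digitPairs b L j i) h [] := by
  refine pass_runs _ _ _ _ _ _ _ (digitPairs_length ..).le ?_ ?_ ?_ ?_ <;>
    rw [mealyRun_ltStep _ _ _ _ _ hj hi] <;> simp [HeadMove.apply, hh]
  omega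

end Frag

/-! ## Generable output -/

/-- The output `g N j` can be generated by a fragment when `N` is the range of the counters and
`j` the value of the first counter. -/
def Gen (A : Type) {O : Type} (b : ℕ) (g : ℕ → ℕ → List O) : Prop :=
  ∃ F : Frag A O (DigitPair b) Unit, ∀ (x : List A) (L j h : ℕ), j < (b + 2) ^ L →
    h ≤ x.length + 1 →
    F.Runs x L (digitPairs b L j 0) h () (digitPairs b L j 0) h (g ((b + 2) ^ L) j)

/-- The output `g x N` can be generated by a fragment on the input `x` when `N` is the range of
the counters. -/
def GenFrom {A O : Type} (b : ℕ) (g : List A → ℕ → List O) : Prop :=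
  ∃ F : Frag A O (DigitPair b) Unit, ∀ (x : List A) (L : ℕ), ∃ h ≤ x.length + 1,
    F.Runs x L (digitPairs b L 0 0) 0 () (digitPairs b L 0 0) h (g x ((b + 2) ^ L))

section Gen

variable {A O : Type} {b : ℕ}

theorem Gen.const (l : List O) : Gen A b fun _ _ => l :=
  ⟨Frag.emit l, fun _ _ _ _ _ hh => Frag.emit_runs _ _ _ _ _ (digitPairs_length ..).le hh⟩

theorem Gen.append {g g' : ℕ → ℕ → List O} (h : Gen A b g) (h' : Gen A b g') :
    Gen A b fun N j => g N j ++ g' N j := by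
  obtain ⟨F, hF⟩ := h
  obtain ⟨G, hG⟩ := h'
  exact ⟨F.bind fun _ => G, fun x L j h hj hh => Frag.bind_runs (hF x L j h hj hh)
    (hG x L j h hj hh)⟩

theorem Gen.cons {g : ℕ → ℕ → List O} (o : O) (h : Gen A b g) :
    Gen A b fun N j => o :: g N j :=
  (Gen.const [o]).append h

theorem Gen.congr {g g' : ℕ → ℕ → List O} (h : Gen A b g) (e : ∀ N, ∀ j < N, g N j = g' N j) :
    Gen A b g' := by
  obtain ⟨F, hF⟩ := h
  exact ⟨F, fun x L j h hj hh => e _ j hj ▸ hF x L j h hj hh⟩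

theorem Gen.flatMap {X : Type} {g : X → ℕ → ℕ → List O} (l : List X)
    (h : ∀ a ∈ l, Gen A b (g a)) : Gen A b fun N j => l.flatMap fun a => g a N j := by
  induction l with
  | nil => exact Gen.const []
  | cons a l ih =>
    simp only [List.flatMap_cons]
    exact (h a (by simp)).append (ih fun a ha => h a (by simp [ha]))

theorem flatMap_range_const (N : ℕ) (l : List O) :
    ((List.range N).flatMap fun _ => l) = (List.replicate N l).flatten := by
  induction N with
  | zero => rfl
  | succ N ih => simp [List.range_succ, List.replicate_succ', ih]

theorem flatMap_range_ite_lt (N j : ℕ) (hj : j ≤ N) (l : List O) :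
    ((List.range N).flatMap fun i => if i < j then l else []) = (List.replicate j l).flatten := by
  obtain ⟨d, rfl⟩ := Nat.exists_eq_add_of_le hj
  induction d with
  | zero =>
    rw [← flatMap_range_const]
    simp only [List.flatMap]
    congr 1
    refine List.map_congr_left fun i hi => ?_
    rw [if_pos (by simpa using hi)]
  | succ d ih => rw [← Nat.add_assoc, List.range_succ]; simp [ih]

theorem Gen.replicate_range (l : List O) :
    Gen A b fun N _ => (List.replicate N l).flatten := by
  refine ⟨((Frag.emit l).bind fun _ => Frag.inc₂ b).doWhile, fun x L j h hj hh => ?_⟩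
  have := Frag.doWhile_range (F := (Frag.emit l).bind fun _ => Frag.inc₂ b) (x := x) (bd := L)
    (N := (b + 2) ^ L) (by positivity) (fun i => digitPairs b L j i) (fun _ => h) (fun _ => l)
    fun i hi => by
      simpa using Frag.bind_runs
        (Frag.emit_runs l x L (digitPairs b L j i) h (digitPairs_length ..).le hh)
        (G := fun _ => Frag.inc₂ b) (Frag.inc₂_runs b x hi hh)
  rwa [digitPairs_pow_right, flatMap_range_const] at this

/-- The second counter runs through its whole range and `l` is printed only while it is below the
first one. The first counter is thus used as a loop bound without being changed. -/
theorem Gen.replicate_counter (l : List O) :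
    Gen A b fun _ j => (List.replicate j l).flatten := by
  refine ⟨(((Frag.less b).bind fun c => Frag.emit (if c then l else [])).bind
    fun _ => Frag.inc₂ b).doWhile, fun x L j h hj hh => ?_⟩
  have := Frag.doWhile_range (F := ((Frag.less b).bind fun c => Frag.emit (if c then l else [])).bind
    fun _ => Frag.inc₂ b) (x := x) (bd := L)
    (N := (b + 2) ^ L) (by positivity) (fun i => digitPairs b L j i) (fun _ => h)
    (fun i => if i < j then l else [])
    fun i hi => by
      have := Frag.bind_runs (Frag.bind_runs (Frag.less_runs b x hj hi hh)
        (G := fun c => Frag.emit (if c then l else []))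
        (Frag.emit_runs (if decide (i < j) then l else []) x L (digitPairs b L j i) h
          (digitPairs_length ..).le hh))
        (G := fun _ => Frag.inc₂ b) (Frag.inc₂_runs b x hi hh)
      simpa using this
  rwa [digitPairs_pow_right, flatMap_range_ite_lt _ _ hj.le] at this

theorem GenFrom.append_gen {g : List A → ℕ → List O} {g' : ℕ → ℕ → List O} (hg : GenFrom b g)
    (hg' : Gen A b g') : GenFrom b fun x N => g x N ++ g' N 0 := by
  obtain ⟨F, hF⟩ := hg
  obtain ⟨G, hG⟩ := hg'
  refine ⟨F.bind fun _ => G, fun x L => ?_⟩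
  obtain ⟨h, hh, hr⟩ := hF x L
  exact ⟨h, hh, Frag.bind_runs hr (hG x L 0 h (by positivity) hh)⟩

theorem GenFrom.gen_append {g : List A → ℕ → List O} {g' : ℕ → ℕ → List O} (hg' : Gen A b g')
    (hg : GenFrom b g) : GenFrom b fun x N => g' N 0 ++ g x N := by
  obtain ⟨F, hF⟩ := hg
  obtain ⟨G, hG⟩ := hg'
  refine ⟨G.bind fun _ => F, fun x L => ?_⟩
  obtain ⟨h, hh, hr⟩ := hF x L
  exact ⟨h, hh, Frag.bind_runs (hG x L 0 0 (by positivity) (by omega)) hr⟩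

/-- The first counter drives the loop and wraps to `0` at the end, while the second stays free for
the loops inside `g'`. -/
theorem GenFrom.append_range {g : List A → ℕ → List O} {g' : ℕ → ℕ → List O} (hg : GenFrom b g)
    (hg' : Gen A b g') : GenFrom b fun x N => g x N ++ (List.range N).flatMap (g' N) := by
  obtain ⟨F, hF⟩ := hg
  obtain ⟨G, hG⟩ := hg'
  refine ⟨F.bind fun _ => (G.bind fun _ => Frag.inc₁ b .stay).doWhile, fun x L => ?_⟩
  obtain ⟨h, hh, hr⟩ := hF x L
  refine ⟨h, hh, Frag.bind_runs hr ?_⟩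
  have := Frag.doWhile_range (F := G.bind fun _ => Frag.inc₁ b .stay) (x := x) (bd := L)
    (N := (b + 2) ^ L) (by positivity) (fun j => digitPairs b L j 0) (fun _ => h)
    (g' ((b + 2) ^ L)) fun j hj => by
      have := Frag.bind_runs (hG x L j h hj hh) (G := fun _ => Frag.inc₁ b .stay)
        (Frag.inc₁_runs b .stay x hj)
      simpa [HeadMove.apply, hh] using this
  rwa [digitPairs_pow_left] at this

/-- The symbol of an input cell. -/
def InCell.toOption : InCell A → Option A
  | .sym a => some a
  | _ => none

theorem inputCell_toOption (x : List A) (j : ℕ) :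
    (inputCell x (min (j + 1) (x.length + 1))).toOption = x[j]? := by
  rw [← Nat.succ_eq_add_one, ← Nat.succ_eq_add_one, Nat.succ_min_succ]
  simp only [inputCell]
  rcases lt_or_ge j x.length with h | h
  · rw [min_eq_left h.le, List.getElem?_eq_getElem h]; rfl
  · rw [min_eq_right h, List.getElem?_eq_none h, List.getElem?_eq_none le_rfl]; rfl

/-- The input head advances together with the first counter and waits at the right end marker, where
it reads `none`. The symbol read is the exit value that selects the next fragment, hence the finite
alphabet. -/
theorem GenFrom.input_range [Fintype A] {g : Option A → ℕ → ℕ → List O}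
    (hg : ∀ o, Gen A b (g o)) :
    GenFrom (A := A) b fun x N => (List.range N).flatMap fun j => g x[j]? N j := by
  choose F hF using hg
  let R : Frag A O (DigitPair b) (Option A) :=
    Frag.pass () (fun q s => (q, s)) fun _ a => (a.toOption, .stay, none, none)
  refine ⟨(Frag.simple .right none).bind fun _ =>
    ((R.bind F).bind fun _ => Frag.inc₁ b .right).doWhile, fun x L => ?_⟩
  refine ⟨min ((b + 2) ^ L + 1) (x.length + 1), min_le_right _ _, ?_⟩
  have h1 := Frag.simple_runs (A := A) (O := O) .right none x L (digitPairs b L 0 0) 0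
    (digitPairs_length ..).le
  have := Frag.doWhile_range (F := (R.bind F).bind fun _ => Frag.inc₁ b .right) (x := x) (bd := L)
    (N := (b + 2) ^ L) (by positivity) (fun j => digitPairs b L j 0)
    (fun j => min (j + 1) (x.length + 1))
    (fun j => g x[j]? ((b + 2) ^ L) j) fun j hj => by
      have hR : R.Runs x L (digitPairs b L j 0) (min (j + 1) (x.length + 1)) x[j]?
          (digitPairs b L j 0) (min (j + 1) (x.length + 1)) [] := by
        refine Frag.pass_runs _ _ _ _ _ _ _ (digitPairs_length ..).le ?_ ?_ ?_ rfl
        · exact (inputCell_toOption x j).symm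
        · simp [Frag.mealyRun_id]
        · simp [HeadMove.apply]
      have := Frag.bind_runs (Frag.bind_runs hR (hF _ x L j _ hj (min_le_right _ _)))
        (G := fun _ => Frag.inc₁ b .right) (Frag.inc₁_runs b .right x hj)
      have e : min (HeadMove.right.apply (min (j + 1) (x.length + 1))) (x.length + 1) =
          min (j + 1 + 1) (x.length + 1) := by
        simp only [HeadMove.apply]; omega
      rw [e] at this
      simpa using this
  rw [digitPairs_pow_left] at this
  have h2 := Frag.bind_runs h1 (G := fun _ => Frag.doWhile
    ((R.bind F).bind fun _ => Frag.inc₁ b .right)) this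
  simpa using h2

/-! ### Initialization of the counters -/

/-- Bits as pairs of digits. -/
def bitWord (b : ℕ) (l : List Bool) : List (DigitPair b) :=
  l.map fun c => (if c then 1 else 0, 0)

/-- Increment of a number in binary. -/
def incBits {b : ℕ} (c : Bool) (s : DigitPair b) : Bool × DigitPair b :=
  if c then (if s.1 = 0 then (false, (1, 0)) else (true, (0, 0))) else (false, s)

theorem mealyRun_incBits_false (w : List (DigitPair b)) :
    mealyRun incBits false w = (false, w) := by
  induction w with
  | nil => rfl
  | cons s w ih => simp [mealyRun, incBits] at ih ⊢; simp [ih]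

/-- Induction on halves: an even number absorbs the carry in its lowest bit, and an odd one passes
it on to its half. A carry that leaves the word becomes a new leading bit. -/
theorem mealyRun_incBits (n : ℕ) :
    (mealyRun incBits true (bitWord b n.bits)).2 ++
      (if (mealyRun incBits true (bitWord b n.bits)).1 then [(1, 0)] else []) =
        bitWord b (n + 1).bits := by
  induction n using Nat.strong_induction_on with
  | _ n ih =>
    rcases Nat.even_or_odd' n with ⟨m, rfl | rfl⟩
    · rcases Nat.eq_zero_or_pos m with rfl | hm
      · simp [bitWord, mealyRun]
      · rw [Nat.bit0_bits _ (by omega), Nat.bit1_bits]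
        have := mealyRun_incBits_false (bitWord b m.bits)
        simp only [bitWord] at this
        simp [bitWord, mealyRun, incBits, this]
    · have := ih m (by omega)
      rw [show 2 * m + 1 + 1 = 2 * (m + 1) by ring, Nat.bit0_bits _ (by omega), Nat.bit1_bits]
      simp only [bitWord] at this
      simp [bitWord, mealyRun, incBits]
      exact this

/-- Binary counting of the input symbols. -/
def countInput (A O : Type) (b : ℕ) : Frag A O (DigitPair b) Unit :=
  (Frag.simple .right none).bind fun _ => Frag.doWhile <|
    (Frag.pass () (fun q s => (q, s)) fun _ a => (a.toOption.isSome, .stay, none, none) :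
      Frag A O (DigitPair b) Bool).bind fun c =>
      if c then Frag.pass true incBits fun c _ => (true, .right, if c then some (1, 0) else none, none)
      else Frag.pass () (fun q s => (q, s)) fun _ _ => (false, .stay, none, none)

theorem bitWord_length (n : ℕ) : (bitWord b n.bits).length = n.size := by
  simp [bitWord, Nat.size_eq_bits_len]

theorem countInput_runs (x : List A) :
    (countInput A O b).Runs x (x.length.size + 1) [] 0 () (bitWord b x.length.bits)
      (x.length + 1) [] := by
  have h1 := Frag.simple_runs (A := A) (O := O) .right none x (x.length.size + 1)
    ([] : List (DigitPair b)) 0 (by simp)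
  have hl : ∀ i, i ≤ x.length → (bitWord b i.bits).length ≤ x.length.size + 1 := fun i hi => by
    rw [bitWord_length]; exact (Nat.size_le_size hi).trans (by omega)
  have h2 := Frag.doWhile_range (F := (Frag.pass () (fun q s => (q, s)) fun _ a =>
      (a.toOption.isSome, .stay, none, none) : Frag A O (DigitPair b) Bool).bind fun c =>
      if c then Frag.pass true incBits fun c _ => (true, .right, if c then some (1, 0) else none, none)
      else Frag.pass () (fun q s => (q, s)) fun _ _ => (false, .stay, none, none))
    -- There is one iteration per input symbol and a last one that meets the right end marker and
    -- exits; `min i x.length` keeps the count constant in the last one.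
    (x := x) (bd := x.length.size + 1) (N := x.length + 1) (by omega)
    (fun i => bitWord b (min i x.length).bits) (fun i => min (i + 1) (x.length + 1))
    (fun _ => []) fun i hi => by
      refine Frag.bind_runs (e := decide (i < x.length)) (o₁ := []) (o₂ := [])
        (w₁ := bitWord b (min i x.length).bits) (h₁ := min (i + 1) (x.length + 1)) ?_ ?_
      · refine Frag.pass_runs _ _ _ _ _ _ _ (hl _ (min_le_right _ _)) ?_ ?_ ?_ rfl
        · simp only [inputCell_toOption]
          rcases lt_or_ge i x.length with h | h <;> simp [h]
        · simp [Frag.mealyRun_id]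
        · simp [HeadMove.apply]
      · rcases lt_or_ge i x.length with h | h
        · rw [decide_eq_true h, decide_eq_true (by omega)]
          refine Frag.pass_runs _ _ _ _ _ _ _ (hl _ (min_le_right _ _)) rfl ?_ ?_ rfl
          · rw [min_eq_left h.le, min_eq_left (by omega), ← mealyRun_incBits]
            split_ifs <;> simp
          · simp only [HeadMove.apply]; omega
        · rw [decide_eq_false (by omega), decide_eq_false (by omega)]
          refine Frag.pass_runs _ _ _ _ _ _ _ (hl _ (min_le_right _ _)) rfl ?_ ?_ rfl
          · simp [Frag.mealyRun_id, min_eq_right h, min_eq_right (show x.length ≤ i + 1 by omega)]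
          · simp only [HeadMove.apply]; omega
  have := Frag.bind_runs h1 (G := fun _ => _) (by simpa [bitWord, HeadMove.apply] using h2)
  simpa [bitWord, flatMap_range_const, countInput] using this

/-- Return of the input head to the left end. -/
def rewind (A O : Type) (S : Type) : Frag A O S Unit :=
  Frag.doWhile <| Frag.pass () (fun q s => (q, s)) fun _ a => match a with
    | .leftEnd => (false, .stay, none, none)
    | _ => (true, .left, none, none)

theorem inputCell_succ_ne (x : List A) (i : ℕ) : inputCell x (i + 1) ≠ .leftEnd := by
  simp only [inputCell]
  cases x[i]? <;> simp

theorem rewind_runs {S : Type} (x : List A) {bd h : ℕ} (hh : h ≤ x.length + 1) (w : List S)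
    (hw : w.length ≤ bd) : (rewind A O S).Runs x bd w h () w 0 [] := by
  have := Frag.doWhile_range (F := (Frag.pass () (fun q s => (q, s)) fun _ a => match a with
    | .leftEnd => (false, .stay, none, none)
    | _ => (true, .left, none, none) : Frag A O S Bool))
    (x := x) (bd := bd) (N := h + 1) (by omega) (fun _ => w) (fun i => h - i) (fun _ => [])
    fun i hi => by
      by_cases hi' : i = h
      · subst hi'
        simp only [Nat.sub_self, lt_self_iff_false, decide_false]
        refine Frag.pass_runs _ _ _ _ _ _ _ hw rfl ?_ ?_ ?_ <;>
          simp [Frag.mealyRun_id, inputCell, HeadMove.apply]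
      · obtain ⟨d, hd⟩ : ∃ d, h - i = d + 1 := ⟨h - i - 1, by omega⟩
        have hne := inputCell_succ_ne x d
        rw [hd, decide_eq_true (by omega), show h - (i + 1) = d by omega]
        refine Frag.pass_runs _ _ _ _ _ _ _ hw ?_ ?_ ?_ ?_ <;>
          (revert hne; cases inputCell x (d + 1) <;> simp [Frag.mealyRun_id, HeadMove.apply])
        all_goals omega
  simpa [rewind, flatMap_range_const] using this

/-- Overwriting of the word by zeros, with one more pair of digits. -/
def clearWord (A O : Type) (b : ℕ) : Frag A O (DigitPair b) Unit :=
  Frag.pass () (fun q _ => (q, (0, 0))) fun _ _ => ((), .stay, some (0, 0), none)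

theorem digitPairs_zero (b L : ℕ) : digitPairs b L 0 0 = List.replicate L (0, 0) := by
  induction L with
  | zero => rfl
  | succ L ih => simp [digitPairs, ih, List.replicate_succ]

theorem clearWord_runs (x : List A) {bd : ℕ} (w : List (DigitPair b)) (hw : w.length ≤ bd) :
    (clearWord A O b).Runs x bd w 0 () (digitPairs b (w.length + 1) 0 0) 0 [] := by
  refine Frag.pass_runs _ _ _ _ _ _ _ hw rfl ?_ (by simp [HeadMove.apply]) rfl
  rw [digitPairs_zero, List.replicate_succ']
  congr 1
  induction w with
  | nil => rfl
  | cons s w ih =>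
    simp only [List.length_cons, List.replicate_succ, mealyRun, List.cons.injEq, true_and]
    exact ih (by simp at hw; omega)

/-- The range of the counters for inputs of length `n`. -/
def counterRange (b n : ℕ) : ℕ := (b + 2) ^ (n.size + 1)

/-- Counting the input in binary reserves `n.size` cells; clearing them and adding one more yields
the zero counters with range `counterRange b n`. Their length is at most `2 * (Nat.log 2 n + 1)`. -/
theorem GenFrom.logspaceComputable {g : List A → ℕ → List O} (hg : GenFrom b g) :
    LogspaceComputable fun x => g x (counterRange b x.length) := by
  obtain ⟨F, hF⟩ := hg
  refine Frag.logspaceComputable ((((countInput A O b).bind fun _ => rewind A O _).bind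
    fun _ => clearWord A O b).bind fun _ => F) _ 2 fun x => ?_
  obtain ⟨h, -, hr⟩ := hF x (x.length.size + 1)
  have hl : (bitWord b x.length.bits).length ≤ x.length.size + 1 := by
    rw [bitWord_length]; omega
  have h1 := countInput_runs (O := O) (b := b) x
  have h2 := rewind_runs (O := O) x le_rfl (bitWord b x.length.bits) hl
  have h3 := clearWord_runs (O := O) x (bitWord b x.length.bits) hl
  rw [bitWord_length] at h3
  have := Frag.bind_runs (Frag.bind_runs (Frag.bind_runs h1 h2 (G := fun _ => _)) h3
    (G := fun _ => _)) hr (G := fun _ => _)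
  refine ⟨(), _, _, Frag.Path.mono ?_ (by simpa [counterRange] using this)⟩
  have : x.length.size ≤ Nat.log 2 x.length + 1 :=
    Nat.size_le.mpr (Nat.lt_pow_succ_log_self (by omega) _)
  omega

end Gen

/-! ## Cellular automata for Turing machines -/

/-- A one-dimensional cellular automaton with a set of forbidden cell contents. -/
structure CellRule (A : Type) where
  Γ : Type
  [fintype : Fintype Γ]
  first : Γ
  blank : Γ
  inp : A → Γ
  next : Γ → Γ → Γ → Γ
  bad : Γ → Prop

attribute [instance] CellRule.fintype

namespace CellRule

variable {A : Type}

/-- The initial contents of the cells for the input `x`. -/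
def initial (R : CellRule A) (x : List A) : ℕ → R.Γ
  | 0 => R.first
  | k + 1 => (x[k]?.map R.inp).getD R.blank

/-- `row` is the space-time diagram of a computation on `K` cells that avoids forbidden contents. -/
def Run (R : CellRule A) (x : List A) (K : ℕ) (row : ℕ → ℕ → R.Γ) : Prop :=
  (∀ k < K, row 0 k = R.initial x k) ∧ ∀ t, ∀ k < K, ¬R.bad (row t k) ∧
    row (t + 1) k = R.next (if k = 0 then R.first else row t (k - 1)) (row t k)
      (if k + 1 = K then R.blank else row t (k + 1))

end CellRule

/-! ### Space-time diagrams of Turing machines -/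

namespace TuringDecider

variable {A : Type} (M : TuringDecider A)

attribute [local instance] TuringDecider.symFintype TuringDecider.stateFintype

/-- Cell contents: a tape symbol, with the state if the head is there; `inl true` is the left end
before the start of the computation, and `inl false` later. -/
abbrev CellSym : Type := Bool ⊕ (M.Sym × Option M.State)

/-- The state that arrives from the right neighbour. -/
def fromRight : M.CellSym → Option M.State
  | .inr (s, some q) => match M.trans q s with
    | some (q', _, .left) => some q'
    | _ => none
  | _ => none

/-- The state that arrives from one of the neighbours. -/
def incoming (l r : M.CellSym) : Option M.State :=
  match l with
  | .inl true => some M.start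
  | .inr (s, some q) => match M.trans q s with
    | some (q', _, .right) => some q'
    | _ => M.fromRight r
  | _ => M.fromRight r

/-- The contents of a cell after a step. -/
def cellNext (l c r : M.CellSym) : M.CellSym :=
  match c with
  | .inl _ => .inl false
  | .inr (s, some q) => match M.trans q s with
    | none => .inr (s, some q)
    | some (q', s', .left) => .inr (s', match l with
      | .inl _ => some q'
      | .inr _ => none)
    | some (_, s', .right) => .inr (s', none)
  | .inr (s, none) => .inr (s, M.incoming l r)

/-- The cellular automaton that simulates `M`. -/
def cellRule : CellRule A where
  Γ := M.CellSym
  first := .inl true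
  blank := .inr (M.blank, none)
  inp a := .inr (M.inSym a, none)
  next := M.cellNext
  bad c := match c with
    | .inr (s, some q) => M.trans q s = none ∧ q ∉ M.accept
    | _ => False

/-- One computation step, where halting configurations are repeated. -/
def stepOrStay (c : M.Cfg) : M.Cfg := (M.step c).getD c

/-- The configuration after `t` steps. -/
def run (x : List A) (t : ℕ) : M.Cfg := M.stepOrStay^[t] (M.initial x)

open Classical in
/-- The cell contents for a configuration. -/
noncomputable def cfgRow (c : M.Cfg) : ℕ → M.CellSym
  | 0 => .inl false
  | k + 1 => .inr (c.tape k, if k = c.head then some c.state else none)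

/-- The space-time diagram of the computation on `x`. -/
noncomputable def diagram (x : List A) : ℕ → ℕ → M.CellSym
  | 0, k => M.cellRule.initial x k
  | t + 1, k => M.cfgRow (M.run x t) k

theorem run_succ (x : List A) (t : ℕ) : M.run x (t + 1) = M.stepOrStay (M.run x t) :=
  Function.iterate_succ_apply' _ _ _

theorem reaches_run (x : List A) (t : ℕ) :
    StateTransition.Reaches M.step (M.initial x) (M.run x t) := by
  induction t with
  | zero => exact .refl
  | succ t ih =>
    rw [run_succ, stepOrStay]
    cases h : M.step (M.run x t) with
    | none => exact ih
    | some c => exact ih.tail h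

theorem exists_run_eq {x : List A} {c : M.Cfg}
    (h : StateTransition.Reaches M.step (M.initial x) c) : ∃ t, M.run x t = c := by
  induction h with
  | refl => exact ⟨0, rfl⟩
  | tail _ h ih =>
    obtain ⟨t, rfl⟩ := ih
    refine ⟨t + 1, ?_⟩
    rw [run_succ, stepOrStay]
    simp only [Option.mem_def] at h
    rw [h]; rfl

theorem run_add_of_halt {x : List A} {t : ℕ} (h : M.step (M.run x t) = none) (d : ℕ) :
    M.run x (t + d) = M.run x t := by
  induction d with
  | zero => rfl
  | succ d ih => rw [← Nat.add_assoc, run_succ, ih, stepOrStay, h]; rfl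

/-- A halting configuration is repeated forever, so any two of them agree with the configuration at
a common later time. -/
theorem run_eq_of_halt {x : List A} {t t' : ℕ} (h : M.step (M.run x t) = none)
    (h' : M.step (M.run x t') = none) : M.run x t = M.run x t' := by
  rw [← M.run_add_of_halt h t', ← M.run_add_of_halt h' t, Nat.add_comm]

/-- Case distinction on the position of the head relative to the cell. Cell `0` is the left end and
ignores its neighbours, so nothing is required of `l` there. -/
theorem cfgRow_stepOrStay (c : M.Cfg) (k : ℕ) (l : M.CellSym) (hl : k ≠ 0 → l = M.cfgRow c (k - 1)) :
    M.cfgRow (M.stepOrStay c) k = M.cellNext l (M.cfgRow c k) (M.cfgRow c (k + 1)) := by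
  rcases k with _ | k
  · rfl
  obtain rfl : l = M.cfgRow c k := hl (by omega)
  rcases ht : M.trans c.state (c.tape c.head) with _ | ⟨q', s', d⟩
  · have : M.stepOrStay c = c := by simp [stepOrStay, step, ht]
    rw [this]
    by_cases hk : k = c.head
    · subst hk
      simp [cfgRow, cellNext, ht]
    · simp only [cfgRow, cellNext, hk, if_false, Sum.inr.injEq, Prod.mk.injEq, true_and]
      rcases k with _ | k
      · simp only [incoming, fromRight]
        by_cases h1 : 0 + 1 = c.head
        · rw [if_pos h1]; rw [← h1] at ht; simp [ht]
        · rw [if_neg h1]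
      · simp only [incoming, fromRight]
        by_cases h1 : k + 1 + 1 = c.head
        · rw [if_pos h1, if_neg (by omega)]; rw [← h1] at ht; simp [ht]
        · rw [if_neg h1]
          by_cases h2 : k = c.head
          · rw [if_pos h2]; rw [← h2] at ht; simp [ht]
          · rw [if_neg h2]
  · have hs : M.stepOrStay c = ⟨q', moveHead c.head d, Function.update c.tape c.head s'⟩ := by
      simp [stepOrStay, step, ht]
    rw [hs]
    by_cases hk : k = c.head
    · subst hk
      simp only [cfgRow, cellNext, ht, if_true, Function.update_self]
      cases d with
      | left =>
        rcases hh : c.head with _ | h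
        · simp [moveHead]
        · simp [moveHead]
      | right => simp [moveHead]
    · simp only [cfgRow, cellNext, hk, if_false, Sum.inr.injEq, Prod.mk.injEq,
        Function.update_of_ne hk, true_and]
      rcases k with _ | k
      · simp only [incoming, fromRight]
        by_cases h1 : 0 + 1 = c.head
        · rw [if_pos h1]; rw [← h1] at ht ⊢
          cases d <;> simp [ht, moveHead]
        · rw [if_neg h1, if_neg]
          cases d <;> simp [moveHead]; omega
      · simp only [incoming, fromRight]
        by_cases h1 : k + 1 + 1 = c.head
        · rw [if_pos h1, if_neg (show ¬k = c.head by omega)]; rw [← h1] at ht ⊢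
          cases d <;> simp [ht, moveHead]
        · rw [if_neg h1]
          by_cases h2 : k = c.head
          · rw [if_pos h2]; rw [← h2] at ht ⊢
            cases d <;> simp [ht, moveHead]
            exact if_neg (by omega)
          · rw [if_neg h2, if_neg]
            cases d <;> simp [moveHead] <;> omega

/-- Row `0` shows the input without a head. The symbol `inl true` then sends the start state into
cell `1` and turns into `inl false`, so that row `t + 1` shows the configuration after `t` steps. -/
theorem diagram_succ (x : List A) (t k : ℕ) (l : M.CellSym)
    (hl : l = if k = 0 then .inl true else M.diagram x t (k - 1)) :
    M.diagram x (t + 1) k = M.cellNext l (M.diagram x t k) (M.diagram x t (k + 1)) := by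
  rcases t with _ | t
  · have hx : ∀ i, M.diagram x 0 (i + 1) = .inr ((M.initial x).tape i, none) := fun i => by
      simp only [diagram, CellRule.initial, cellRule, initial]
      cases x[i]? <;> rfl
    rcases k with _ | k
    · rfl
    · simp only [hx, cellNext]
      show M.cfgRow (M.initial x) (k + 1) = _
      simp only [cfgRow]
      rcases k with _ | k
      · simp only [Nat.add_sub_cancel] at hl
        subst hl
        rfl
      · simp only [Nat.add_sub_cancel, hx] at hl
        rw [if_neg (by omega)] at hl
        subst hl
        simp [initial, incoming, fromRight]
  · rw [diagram, run_succ]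
    exact M.cfgRow_stepOrStay _ _ _ fun hk => by rw [hl, if_neg hk]; rfl

theorem tape_run {x : List A} {m : ℕ}
    (hm : ∀ c, StateTransition.Reaches M.step (M.initial x) c → c.head < m) (t : ℕ) {i : ℕ}
    (hi : m ≤ i) : (M.run x t).tape i = (M.initial x).tape i := by
  induction t with
  | zero => rfl
  | succ t ih =>
    rw [run_succ, ← ih, stepOrStay, step]
    cases M.trans (M.run x t).state ((M.run x t).tape (M.run x t).head) with
    | none => rfl
    | some r =>
      have := hm _ (M.reaches_run x t)
      simp only [Option.map_some, Option.getD_some]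
      rw [Function.update_of_ne (by omega)]

/-- Cell `K` shows the tape cell `K - 1`, which lies beyond both the input and every cell visited.
Cutting the diagram at `K` cells with a blank border therefore loses nothing. -/
theorem diagram_blank {x : List A} {m K : ℕ}
    (hm : ∀ c, StateTransition.Reaches M.step (M.initial x) c → c.head < m) (hK : m < K)
    (hx : x.length < K) (t : ℕ) : M.diagram x t K = .inr (M.blank, none) := by
  obtain ⟨k, rfl⟩ : ∃ k, K = k + 1 := ⟨K - 1, by omega⟩
  have hk : x[k]? = none := List.getElem?_eq_none (by omega)
  rcases t with _ | t
  · simp [diagram, CellRule.initial, cellRule, hk]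
  · have := hm _ (M.reaches_run x t)
    simp only [diagram, cfgRow]
    rw [if_neg (by omega), M.tape_run hm t (by omega)]
    simp [initial, hk]

theorem run_unique {x : List A} {m K : ℕ}
    (hm : ∀ c, StateTransition.Reaches M.step (M.initial x) c → c.head < m) (hK : m < K)
    (hx : x.length < K) {row : ℕ → ℕ → M.CellSym} (hr : M.cellRule.Run x K row) (t : ℕ) :
    ∀ k < K, row t k = M.diagram x t k := by
  induction t with
  | zero => exact hr.1
  | succ t ih =>
    intro k hk
    rw [(hr.2 t k hk).2, M.diagram_succ x t k (if k = 0 then .inl true else row t (k - 1))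
      (by split_ifs with h0; · rfl
          exact ih _ (by omega)), ih k hk]
    congr 1
    by_cases h : k + 1 = K
    · rw [h, M.diagram_blank hm hK hx]; exact if_pos rfl
    · exact (if_neg h).trans (ih _ (by omega))

/-- An accepting computation never shows forbidden contents, because its halting configuration is
unique. Conversely a run must coincide with `diagram` by `run_unique`, and a rejecting halt would
show forbidden contents there. -/
theorem run_diagram_iff {x : List A} {m K : ℕ}
    (hm : ∀ c, StateTransition.Reaches M.step (M.initial x) c → c.head < m) (hK : m < K)
    (hx : x.length < K) {P : Prop}
    (hP : ∃ c, StateTransition.Reaches M.step (M.initial x) c ∧ M.step c = none ∧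
      (c.state ∈ M.accept ↔ P)) : P ↔ ∃ row, M.cellRule.Run x K row := by
  obtain ⟨c, hc, hs, hP⟩ := hP
  obtain ⟨t, rfl⟩ := M.exists_run_eq hc
  rw [← hP]
  constructor
  · intro hacc
    refine ⟨M.diagram x, fun _ _ => rfl, fun t' k hk => ⟨?_, ?_⟩⟩
    · rcases k with _ | k
      · rcases t' with _ | t' <;> exact id
      rcases t' with _ | t'
      · simp only [diagram, CellRule.initial, cellRule]
        cases x[k]? <;> simp
      · simp only [diagram, cfgRow, cellRule]
        by_cases h : k = (M.run x t').head
        · rw [if_pos h]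
          rintro ⟨h1, h2⟩
          have : M.step (M.run x t') = none := by
            rw [h] at h1; simp [step, h1]
          exact h2 (M.run_eq_of_halt hs this ▸ hacc)
        · rw [if_neg h]; exact id
    · rw [M.diagram_succ x t' k _ rfl]
      show M.cellNext _ _ _ = M.cellNext _ _ _
      congr 1
      by_cases h : k + 1 = K
      · rw [h, M.diagram_blank hm hK hx]; exact (if_pos rfl).symm
      · exact (if_neg h).symm
  · rintro ⟨row, hr⟩
    by_contra hacc
    have hh := hm _ hc
    -- Both indices are shifted: row `t + 1` shows the configuration after `t` steps, and tape cell
    -- `i` is shown by cell `i + 1`.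
    have h1 := (hr.2 (t + 1) ((M.run x t).head + 1) (by omega)).1
    rw [M.run_unique hm hK hx hr _ _ (by omega)] at h1
    simp only [diagram, cfgRow, cellRule, if_true] at h1
    refine h1 ⟨?_, hacc⟩
    simpa [step] using hs

end TuringDecider

theorem InExpSpace.exists_cellRule {A : Type} {L : Language A} (h : InExpSpace L) :
    ∃ (R : CellRule A) (p : Polynomial ℕ), ∀ (x : List A) (N : ℕ), p.eval x.length ≤ N →
      (x ∈ L ↔ ∃ row, R.Run x (2 ^ N) row) := by
  obtain ⟨M, p, h⟩ := h
  -- The additional `X + 1` makes `2 ^ N` exceed both the space bound and the length of the input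
  -- strictly.
  refine ⟨M.cellRule, p + Polynomial.X + 1, fun x N hN => ?_⟩
  simp only [Polynomial.eval_add, Polynomial.eval_X, Polynomial.eval_one] at hN
  refine M.run_diagram_iff (h x).1 (Nat.pow_lt_pow_right (by omega) (by omega)) ?_ (h x).2
  exact lt_of_lt_of_le Nat.lt_two_pow_self (Nat.pow_le_pow_right (by omega) (by omega))

/-! ## Letters and the temporal sentence -/

/-- Letters of the words that represent computations on `2 ^ N` cells. A cell is represented by a
letter `inl (f, l, c, r)`, where `c` is the contents of the cell, `l` and `r` are those of its
neighbours, and `f` tells whether the cell is the first one, followed by `N` letters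
`inr (b, e)`, where the `b` are the bits of the address of the cell, lowest bit first, and `e` tells
whether all lower bits are `true`. -/
abbrev CellRule.Letter {A : Type} (R : CellRule A) : Type :=
  (Bool × R.Γ × R.Γ × R.Γ) ⊕ (Bool × Bool)

namespace CellRule

variable {A : Type} (R : CellRule A)

/-- The contents of a cell for an optional input symbol. -/
def inpAt (o : Option A) : R.Γ := (o.map R.inp).getD R.blank

variable {R}

namespace Letter

/-- Letters for cells. -/
def IsCell : R.Letter → Prop
  | .inl _ => True
  | .inr _ => False

/-- Letters for bits of addresses. -/
def IsBit : R.Letter → Prop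
  | .inl _ => False
  | .inr _ => True

/-- Letters for first cells. -/
def IsFirst : R.Letter → Prop
  | .inl (f, _) => f = true
  | .inr _ => False

/-- Letters for cells other than the first one. -/
def IsLater : R.Letter → Prop
  | .inl (f, _) => f = false
  | .inr _ => False

/-- Letters for cells with contents `γ`. -/
def Holds (γ : R.Γ) : R.Letter → Prop
  | .inl (_, _, c, _) => c = γ
  | .inr _ => False

/-- Letters for bits with value `b`. -/
def HasBit (b : Bool) : R.Letter → Prop
  | .inl _ => False
  | .inr (c, _) => c = b

/-- Letters at the start of a word. -/
def IsStart : R.Letter → Prop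
  | .inl (f, _, c, _) => f = true ∧ c = R.first
  | .inr _ => False

/-- Allowed letters. -/
def Valid : R.Letter → Prop
  | .inl (f, l, c, _) => ¬R.bad c ∧ (f = true → l = R.first)
  | .inr _ => True

/-- Possible pairs of consecutive letters. -/
def Adj : R.Letter → R.Letter → Prop
  | .inl _, .inl _ => False
  | .inl _, .inr (_, e) => e = true
  | .inr (b, e), .inr (_, e') => e' = (e && b)
  | .inr (b, e), .inl (f, _) => f = (e && b)

/-- Possible pairs of letters with the same role in consecutive cells. -/
def Shift : R.Letter → R.Letter → Prop
  | .inl (_, _, c, r), .inl (f', l', c', _) =>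
      (f' = true → r = R.blank) ∧ (f' = false → l' = c ∧ c' = r)
  | .inr (b, e), .inr (b', _) => b' = xor b e
  | .inl _, .inr _ => False
  | .inr _, .inl _ => False

end Letter

end CellRule

namespace SafetyLTL

variable {A : Type}

/-- The disjunction over all letters `a` of `a ∧ F a`. -/
noncomputable def caseLetter [Fintype A] (F : A → SafetyLTL A) : SafetyLTL A :=
  Finset.univ.toList.foldr (fun a φ => .or (.and (.letter a) (F a)) φ) .bot

theorem sat_caseLetter [Fintype A] (F : A → SafetyLTL A) (σ : DataWord A) (i : ℕ) (D : σ.Datum) :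
    (caseLetter F).Sat σ i D ↔ (F (σ.letter i)).Sat σ i D := by
  have : ∀ l : List A, (l.foldr (fun a φ => SafetyLTL.or (.and (.letter a) (F a)) φ) .bot).Sat σ i D ↔
      σ.letter i ∈ l ∧ (F (σ.letter i)).Sat σ i D := by
    intro l
    induction l with
    | nil => simp [Sat]
    | cons a l ih =>
      rw [List.foldr_cons, Sat, Sat, Sat, ih, List.mem_cons]
      constructor
      · rintro (⟨rfl, h⟩ | h)
        · exact ⟨.inl rfl, h⟩
        · exact ⟨.inr h.1, h.2⟩
      · rintro ⟨rfl | h, h'⟩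
        · exact .inl ⟨rfl, h'⟩
        · exact .inr ⟨h, h'⟩
  simp [caseLetter, this]

open Classical in
/-- The current letter is in `P`. -/
noncomputable def anyOf [Fintype A] (P : A → Prop) : SafetyLTL A :=
  caseLetter fun a => if P a then .top else .bot

theorem sat_anyOf [Fintype A] (P : A → Prop) (σ : DataWord A) (i : ℕ) (D : σ.Datum) :
    (anyOf P).Sat σ i D ↔ P (σ.letter i) := by
  rw [anyOf, sat_caseLetter]
  split_ifs with h <;> simp [Sat, h]

/-- `φ` holds from now on. -/
def always (φ : SafetyLTL A) : SafetyLTL A := .release .bot φ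

theorem sat_always (φ : SafetyLTL A) (σ : DataWord A) (i : ℕ) (D : σ.Datum) :
    (always φ).Sat σ i D ↔ ∀ k, i ≤ k → φ.Sat σ k D := by
  simp [always, Sat]

/-- `φ` holds `n` positions later. -/
def nexts : ℕ → SafetyLTL A → SafetyLTL A
  | 0, φ => φ
  | n + 1, φ => .next (nexts n φ)

theorem sat_nexts (n : ℕ) (φ : SafetyLTL A) (σ : DataWord A) (i : ℕ) (D : σ.Datum) :
    (nexts n φ).Sat σ i D ↔ φ.Sat σ (i + n) D := by
  induction n generalizing i with
  | zero => rfl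
  | succ n ih => rw [nexts, Sat, ih, Nat.add_assoc, Nat.add_comm 1]

/-- The one-step unfolding that matches a transition of the automaton: the operand now, and either
the release now or the same obligation at the next position. -/
theorem sat_release_iff (φ ψ : SafetyLTL A) (σ : DataWord A) (i : ℕ) (D : σ.Datum) :
    (release φ ψ).Sat σ i D ↔
      ψ.Sat σ i D ∧ (φ.Sat σ i D ∨ (release φ ψ).Sat σ (i + 1) D) := by
  simp only [Sat]
  constructor
  · rintro (h | ⟨j, hj, h, h'⟩)
    · exact ⟨h i le_rfl, .inr (.inl fun k hk => h k (by omega))⟩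
    · refine ⟨h' i le_rfl hj, ?_⟩
      rcases hj.eq_or_lt with rfl | hj
      · exact .inl h
      · exact .inr (.inr ⟨j, hj, h, fun k hk hk' => h' k (by omega) hk'⟩)
  · rintro ⟨h, h' | h' | ⟨j, hj, h₁, h₂⟩⟩
    · exact .inr ⟨i, le_rfl, h', fun k hk hk' => by rwa [le_antisymm hk' hk]⟩
    · refine .inl fun k hk => ?_
      rcases hk.eq_or_lt with rfl | hk
      · exact h
      · exact h' k hk
    · refine .inr ⟨j, by omega, h₁, fun k hk hk' => ?_⟩
      rcases hk.eq_or_lt with rfl | hk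
      · exact h
      · exact h₂ k hk hk'

end SafetyLTL

namespace CellRule

open SafetyLTL Letter

variable {A : Type} (R : CellRule A)

/-- The current letter is for a cell with contents `γ` and its datum is in the register. -/
noncomputable def hereF (γ : R.Γ) : SafetyLTL R.Letter := .and (anyOf (Holds γ)) .up

/-- The datum in the register occurs at a cell before the next first cell, and the contents of that
cell is `γ`. -/
noncomputable def waitLateF (γ : R.Γ) : SafetyLTL R.Letter :=
  .release (R.hereF γ)
    (.or (anyOf IsBit) (.and (anyOf IsLater) (.or .notUp (R.hereF γ))))

/-- The datum in the register occurs at a cell before the next but one first cell, and the contents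
of that cell is `γ`. -/
noncomputable def waitF (γ : R.Γ) : SafetyLTL R.Letter :=
  .release (R.hereF γ)
    (.or (anyOf IsBit) (.or (R.hereF γ) (.and .notUp
      (.or (anyOf IsLater) (.and (anyOf IsFirst) (.next (R.waitLateF γ)))))))

/-- The next cell is a first one, or has contents `γ` and `φ` holds after it. -/
noncomputable def initStepF (γ : R.Γ) (φ : SafetyLTL R.Letter) : SafetyLTL R.Letter :=
  .release (anyOf IsCell)
    (.or (anyOf IsBit) (.or (anyOf IsFirst) (.and (anyOf (Holds γ)) (.next φ))))

/-- All cells before the next first cell are blank. -/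
noncomputable def initEndF : SafetyLTL R.Letter :=
  .release (anyOf IsFirst) (.or (anyOf IsBit) (.or (anyOf IsFirst) (anyOf (Holds R.blank))))

/-- The next `n` cells hold the input from position `j` on, and the later cells are blank. -/
noncomputable def initF (x : List A) (j n : ℕ) : SafetyLTL R.Letter :=
  (List.range' j n).foldr (fun j φ => R.initStepF (R.inpAt x[j]?) φ) R.initEndF

open Classical in
/-- Conditions at a letter that do not depend on the input. -/
noncomputable def letterF (N : ℕ) (a : R.Letter) : SafetyLTL R.Letter :=
  .and (if Valid a then .top else .bot) (.and (.next (anyOf (Adj a)))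
    (.and (.next (nexts N (anyOf (Shift a)))) (match a with
      | .inl (_, l, c, r) => .freeze (.next (R.waitF (R.next l c r)))
      | .inr _ => .top)))

/-- Cells with the same datum have the same bit `j` of the address, if it is `b` in the first of
them. -/
noncomputable def addrF (j : ℕ) (b : Bool) : SafetyLTL R.Letter :=
  always (.or (anyOf IsBit) (.or (.next (nexts j (anyOf fun a => ¬HasBit b a)))
    (.freeze (.next (always (.or (anyOf IsBit)
      (.or .notUp (.next (nexts j (anyOf (HasBit b)))))))))))

/-- Cells with the same datum have the same address. -/
noncomputable def addrsF (N : ℕ) : SafetyLTL R.Letter :=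
  (List.range N).foldr (fun j φ => .and (R.addrF j true) (.and (R.addrF j false) φ)) .top

/-- The next `N` letters are for bits `false`. -/
noncomputable def zerosF (N : ℕ) : SafetyLTL R.Letter :=
  (List.range N).foldr (fun _ φ => .and (anyOf (HasBit false)) (.next φ)) .top

/-- The sentence for the input `x` and `2 ^ N` cells. -/
noncomputable def sentence (x : List A) (N : ℕ) : SafetyLTL R.Letter :=
  .and (anyOf IsStart) (.and (.next (R.zerosF N)) (.and (.next (R.initF x 0 N))
    (.and (R.addrsF N) (always (caseLetter (R.letterF N))))))

theorem sat_zerosF (N : ℕ) (σ : DataWord R.Letter) (i : ℕ) (D : σ.Datum) :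
    (R.zerosF N).Sat σ i D ↔ ∀ j < N, HasBit false (σ.letter (i + j)) := by
  have : ∀ l : List ℕ,
      (l.foldr (fun _ φ => SafetyLTL.and (anyOf (HasBit false)) (.next φ)) .top).Sat σ i D ↔
        ∀ j < l.length, HasBit false (σ.letter (i + j)) := by
    intro l
    induction l generalizing i with
    | nil => simp [Sat]
    | cons a l ih =>
      rw [List.foldr_cons, Sat, Sat, ih, sat_anyOf, List.length_cons]
      constructor
      · rintro ⟨h, h'⟩ (_ | j) hj
        · exact h
        · rw [← Nat.add_assoc, Nat.add_right_comm]; exact h' j (by omega)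
      · intro h
        refine ⟨h 0 (by omega), fun j hj => ?_⟩
        rw [Nat.add_right_comm, Nat.add_assoc]; exact h (j + 1) (by omega)
  simpa [zerosF] using this (List.range N)

/-- Taken for both values of `b`, this is equality of bit `j` in any two cells with the same datum.
-/
theorem sat_addrF (j : ℕ) (b : Bool) (σ : DataWord R.Letter) (D : σ.Datum) :
    (R.addrF j b).Sat σ 0 D ↔ ∀ p p', p < p' → IsCell (σ.letter p) → IsCell (σ.letter p') →
      σ.cls p' = σ.cls p → HasBit b (σ.letter (p + 1 + j)) → HasBit b (σ.letter (p' + 1 + j)) := by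
  have hc : ∀ a : R.Letter, IsBit a ↔ ¬IsCell a := fun a => by cases a <;> simp [IsBit, IsCell]
  simp only [addrF, sat_always, Sat, sat_anyOf, sat_nexts, hc]
  constructor
  · intro h p p' hp h₁ h₂ h₃ h₄
    rcases h p (by omega) with h | h | h
    · exact absurd h₁ h
    · exact absurd h₄ h
    · rcases h p' (by omega) with h | h | h
      · exact absurd h₂ h
      · exact absurd h₃ h
      · exact h
  · intro h p _
    by_cases h₁ : IsCell (σ.letter p)
    · by_cases h₄ : HasBit b (σ.letter (p + 1 + j))
      · refine .inr (.inr fun p' hp => ?_)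
        by_cases h₂ : IsCell (σ.letter p')
        · by_cases h₃ : σ.cls p' = σ.cls p
          · exact .inr (.inr (h p p' (by omega) h₁ h₂ h₃ h₄))
          · exact .inr (.inl h₃)
        · exact .inl h₂
      · exact .inr (.inl h₄)
    · exact .inl h₁

theorem sat_addrsF (N : ℕ) (σ : DataWord R.Letter) (i : ℕ) (D : σ.Datum) :
    (R.addrsF N).Sat σ i D ↔ ∀ j < N, ∀ b, (R.addrF j b).Sat σ i D := by
  have : ∀ l : List ℕ, (l.foldr (fun j φ => SafetyLTL.and (R.addrF j true)
      (.and (R.addrF j false) φ)) .top).Sat σ i D ↔ ∀ j ∈ l, ∀ b, (R.addrF j b).Sat σ i D := by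
    intro l
    induction l with
    | nil => simp [Sat]
    | cons a l ih => rw [List.foldr_cons, Sat, Sat, ih]; simp; tauto
  simp [addrsF, this]

theorem isSentence_caseLetter {B : Type} [Fintype B] {F : B → SafetyLTL B}
    (h : ∀ a, (F a).IsSentence) : (caseLetter F).IsSentence := by
  rw [caseLetter]
  induction (Finset.univ : Finset B).toList with
  | nil => trivial
  | cons a l ih => exact ⟨⟨trivial, h a⟩, ih⟩

theorem isSentence_anyOf {B : Type} [Fintype B] (P : B → Prop) : (anyOf P).IsSentence :=
  isSentence_caseLetter fun a => by split_ifs <;> trivial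

theorem isSentence_nexts {B : Type} (n : ℕ) {φ : SafetyLTL B} (h : φ.IsSentence) :
    (nexts n φ).IsSentence := by
  induction n with
  | zero => exact h
  | succ n ih => exact ih

theorem isSentence_sentence (x : List A) (N : ℕ) : (R.sentence x N).IsSentence := by
  refine ⟨isSentence_anyOf _, ?_, ?_, ?_, trivial, isSentence_caseLetter fun a => ?_⟩
  · show (R.zerosF N).IsSentence
    rw [zerosF]
    induction List.range N with
    | nil => trivial
    | cons a l ih => exact ⟨isSentence_anyOf _, ih⟩
  · show (R.initF x 0 N).IsSentence
    rw [initF]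
    induction List.range' 0 N with
    | nil => exact ⟨isSentence_anyOf _, isSentence_anyOf _, isSentence_anyOf _, isSentence_anyOf _⟩
    | cons a l ih =>
      exact ⟨isSentence_anyOf _, isSentence_anyOf _, isSentence_anyOf _, isSentence_anyOf _, ih⟩
  · rw [addrsF]
    have : ∀ j b, (R.addrF j b).IsSentence := fun j b =>
      ⟨trivial, isSentence_anyOf _, isSentence_nexts j (isSentence_anyOf _), trivial⟩
    induction List.range N with
    | nil => trivial
    | cons a l ih => exact ⟨this _ _, this _ _, ih⟩
  · refine ⟨by split_ifs <;> trivial, isSentence_anyOf _, isSentence_nexts N (isSentence_anyOf _), ?_⟩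
    rcases a with a | a <;> trivial

end CellRule

/-! ## The automaton -/

namespace PosBool

variable {Q Q₂ : Type}

/-- Renaming of states. -/
def map (g : Q → Q₂) : PosBool Q → PosBool Q₂
  | .keep q => .keep (g q)
  | .down q => .down (g q)
  | .top => .top
  | .bot => .bot
  | .and φ ψ => .and (φ.map g) (ψ.map g)
  | .or φ ψ => .or (φ.map g) (ψ.map g)

theorem sat_map (g : Q → Q₂) (S T : Set Q₂) (φ : PosBool Q) :
    (φ.map g).Sat S T ↔ φ.Sat (g ⁻¹' S) (g ⁻¹' T) := by
  induction φ with
  | keep q => rfl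
  | down q => rfl
  | top => rfl
  | bot => rfl
  | and φ ψ h₁ h₂ => exact and_congr h₁ h₂
  | or φ ψ h₁ h₂ => exact or_congr h₁ h₂

/-- Positivity lets the successor sets chosen in a run be replaced by all states admitted by a
predicate, as in `SafetyARA.accepts_iff`. -/
theorem Sat.mono {S S' T T' : Set Q} (hS : S ⊆ S') (hT : T ⊆ T') {φ : PosBool Q}
    (h : φ.Sat S T) : φ.Sat S' T' := by
  induction φ with
  | keep q => exact hS h
  | down q => exact hT h
  | top => trivial
  | bot => exact h
  | and φ ψ h₁ h₂ => exact ⟨h₁ h.1, h₂ h.2⟩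
  | or φ ψ h₁ h₂ => exact h.imp h₁ h₂

end PosBool

/-- Acceptance as the existence of a predicate on states, positions and register values that is
compatible with the transition function. -/
theorem SafetyARA.accepts_iff {A Q : Type} (M : SafetyARA A Q) (σ : DataWord A) :
    M.Accepts σ ↔ ∃ V : Q → ℕ → σ.Datum → Prop, V M.start 0 (σ.cls 0) ∧
      ∀ q i D, V q i D → (M.rule σ i (q, D)).Sat {q' | V q' (i + 1) D}
        {q' | V q' (i + 1) (σ.cls i)} := by
  constructor
  · rintro ⟨F, h0, h⟩
    refine ⟨fun q i D => (q, D) ∈ F i, by simp [h0], fun q i D hq => ?_⟩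
    obtain ⟨S, T, hST, hF⟩ := h i
    refine (hST _ hq).mono (fun q' hq' => ?_) fun q' hq' => ?_
    · show _ ∈ F (i + 1)
      rw [hF]; exact .inl ⟨_, hq, hq', rfl⟩
    · show _ ∈ F (i + 1)
      rw [hF]; exact .inr ⟨_, hq, hq', rfl⟩
  · rintro ⟨V, h0, h⟩
    let S : ℕ → Config Q σ → Set Q := fun i c => {q' | V q' (i + 1) c.2}
    let T : ℕ → Config Q σ → Set Q := fun i _ => {q' | V q' (i + 1) (σ.cls i)}
    -- `S` and `T` choose every successor that `V` admits, so by construction all configurations of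
    -- the run satisfy `V`.
    let F : ℕ → Set (Config Q σ) := fun i => Nat.rec {(M.start, σ.cls 0)} (fun i F =>
      {d | ∃ c ∈ F, d.1 ∈ S i c ∧ d.2 = c.2} ∪ {d | ∃ c ∈ F, d.1 ∈ T i c ∧ d.2 = σ.cls i}) i
    have hF : ∀ i, ∀ c ∈ F i, V c.1 i c.2 := by
      intro i
      rcases i with _ | i
      · rintro c rfl; exact h0
      · rintro ⟨q, D⟩ (⟨c, -, hc, rfl⟩ | ⟨c, -, hc, rfl⟩)
        · exact hc
        · exact hc
    exact ⟨F, rfl, fun i => ⟨S i, T i, fun c hc => h c.1 i c.2 (hF i c hc), rfl⟩⟩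

/-- The automaton states that a counter is combined with. -/
inductive Ctrl (X Y : Type) : Type
  | start
  | main
  | zero
  | init
  | addr
  | watch (b : Bool)
  | check (b : Bool)
  | dist (a : X)
  | adj (a : X)
  | wait (γ : Y)
  | waitLate (γ : Y)
  deriving Fintype

/-- References to values of the counter of a state, relative to the current value. -/
inductive Ref : Type
  | zero | one | max | pred | same | succ

/-- The value for a reference, where the counter ranges from `0` to `N + 1`. -/
def Ref.val (N J : ℕ) : Ref → ℕ
  | .zero => 0
  | .one => 1
  | .max => N
  | .pred => J - 1
  | .same => J
  | .succ => min (J + 1) (N + 1)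

theorem Ref.val_le {N J : ℕ} (hJ : J ≤ N + 1) (r : Ref) : r.val N J ≤ N + 1 := by
  cases r <;> simp [Ref.val] <;> omega

/-- Kinds of values of the counter: `0`, between `1` and `N`, and `N + 1`. Values between
`1` and `N` come with the initial contents of the corresponding cell. -/
inductive CtrKind (Y : Type) : Type
  | low
  | mid (γ : Y)
  | high

/-! ### Transition formulae and compatible predicates -/

namespace CellRule

open Letter

variable {A : Type} (R : CellRule A)

/-- The kind of a value of the counter, for the input `x`. -/
def kind (x : List A) (N : ℕ) : ℕ → CtrKind R.Γ
  | 0 => .low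
  | J + 1 => if J < N then .mid (R.inpAt x[J]?) else .high

open Classical in
/-- The truth value of a proposition, as a formula. -/
noncomputable def ofProp {Q : Type} (p : Prop) : PosBool Q := if p then .top else .bot

theorem sat_ofProp {Q : Type} (p : Prop) (S T : Set Q) : (ofProp p).Sat S T ↔ p := by
  unfold ofProp; split_ifs with h <;> simp [PosBool.Sat, h]

/-- The transition formula for the state `main`. -/
noncomputable def mainRule (a : R.Letter) : PosBool (Ref × Ctrl R.Letter R.Γ) :=
  .and (ofProp (Valid a)) (.and (.keep (.zero, .main)) (.and (.keep (.zero, .adj a))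
    (.and (.keep (.max, .dist a)) (match a with
      | .inl (_, l, c, r) =>
        .and (.down (.zero, .addr)) (.down (.zero, .wait (R.next l c r)))
      | .inr _ => .top))))

open Classical in
/-- The transition formulae. -/
noncomputable def rule (k : CtrKind R.Γ) (q : Ctrl R.Letter R.Γ) (a : R.Letter) (up : Bool) :
    PosBool (Ref × Ctrl R.Letter R.Γ) :=
  match q with
  | .start => .and (ofProp (IsStart a)) (.and (.keep (.max, .zero)) (.and (.keep (.one, .init))
      (R.mainRule a)))
  | .main => R.mainRule a
  | .zero => match k with
    | .mid _ => .and (ofProp (HasBit false a)) (.keep (.pred, .zero))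
    | _ => .top
  | .init => match k, a with
    | .low, _ => .top
    | _, .inr _ => .keep (.same, .init)
    | .mid γ, .inl (f, _, c, _) => if f then .top else .and (ofProp (c = γ)) (.keep (.succ, .init))
    | .high, .inl (f, _, c, _) =>
        if f then .top else .and (ofProp (c = R.blank)) (.keep (.same, .init))
  | .addr => match k, a with
    | .high, _ => .top
    | _, .inl _ => .top
    | _, .inr (b, _) => .and (.keep (.same, .watch b)) (.keep (.succ, .addr))
  | .watch b => .and (.keep (.same, .watch b))
      (if IsCell a ∧ up = true then .keep (.same, .check b) else .top)
  | .check b => match k with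
    | .low => ofProp (HasBit b a)
    | .mid _ => .keep (.pred, .check b)
    | .high => .top
  | .dist a' => match k with
    | .low => ofProp (Shift a' a)
    | .mid _ => .keep (.pred, .dist a')
    | .high => .top
  | .adj a' => ofProp (Adj a' a)
  | .wait γ => match a with
    | .inr _ => .keep (.zero, .wait γ)
    | .inl (f, _, c, _) => if up then ofProp (c = γ)
        else if f then .keep (.zero, .waitLate γ) else .keep (.zero, .wait γ)
  | .waitLate γ => match a with
    | .inr _ => .keep (.zero, .waitLate γ)
    | .inl (f, _, c, _) => if f then .bot else if up then ofProp (c = γ)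
        else .keep (.zero, .waitLate γ)

/-- States of the automaton: a counter and a control state. -/
abbrev AState (N : ℕ) : Type := Fin (N + 2) × Ctrl R.Letter R.Γ

/-- The state for a reference. -/
def resolve (N : ℕ) (J : Fin (N + 2)) (r : Ref × Ctrl R.Letter R.Γ) : R.AState N :=
  (⟨r.1.val N J, Nat.lt_succ_of_le (Ref.val_le (Nat.le_of_lt_succ J.2) r.1)⟩, r.2)

/-- The automaton for the input `x` and `2 ^ N` cells. -/
noncomputable def automaton (x : List A) (N : ℕ) : SafetyARA R.Letter (R.AState N) where
  start := (0, .start)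
  trans q a up := (R.rule (R.kind x N q.1) q.2 a up).map (R.resolve N q.1)

open Classical in
/-- Compatibility of a predicate with the transition formulae. -/
def Compatible (x : List A) (N : ℕ) (σ : DataWord R.Letter)
    (V : ℕ → Ctrl R.Letter R.Γ → ℕ → σ.Datum → Prop) : Prop :=
  ∀ J ≤ N + 1, ∀ q i D, V J q i D →
    (R.rule (R.kind x N J) q (σ.letter i) (decide (D = σ.cls i))).Sat
      {r | V (r.1.val N J) r.2 (i + 1) D} {r | V (r.1.val N J) r.2 (i + 1) (σ.cls i)}

/-- Counters become natural numbers, so that references are evaluated without bound proofs inside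
the states. -/
theorem automaton_accepts_iff (x : List A) (N : ℕ) (σ : DataWord R.Letter) :
    (R.automaton x N).Accepts σ ↔ ∃ V : ℕ → Ctrl R.Letter R.Γ → ℕ → σ.Datum → Prop,
      V 0 .start 0 (σ.cls 0) ∧ R.Compatible x N σ V := by
  rw [SafetyARA.accepts_iff]
  constructor
  · rintro ⟨V, h0, h⟩
    refine ⟨fun J q i D => ∃ hJ : J < N + 2, V (⟨J, hJ⟩, q) i D, ⟨by omega, h0⟩,
      fun J hJ q i D ⟨hJ', hV⟩ => ?_⟩
    have := h _ _ _ hV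
    rw [SafetyARA.rule, automaton, PosBool.sat_map] at this
    refine this.mono (fun r hr => ?_) fun r hr => ?_
    · exact ⟨_, (show V _ _ _ from hr)⟩
    · exact ⟨_, (show V _ _ _ from hr)⟩
  · rintro ⟨V, h0, h⟩
    refine ⟨fun q => V q.1 q.2, h0, fun q i D hV => ?_⟩
    rw [SafetyARA.rule, automaton, PosBool.sat_map]
    exact h q.1 (Nat.le_of_lt_succ q.1.2) _ _ _ hV

/-! ### Words accepted by the automaton -/

/-- Whether the lowest `j` bits of `q` are all `true`. -/
def lowOnes (q : ℕ) : ℕ → Bool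
  | 0 => true
  | j + 1 => lowOnes q j && q.testBit j

theorem lowOnes_succ (q j : ℕ) : lowOnes q (j + 1) = (q.testBit 0 && lowOnes (q / 2) j) := by
  induction j with
  | zero => simp [lowOnes]
  | succ j ih =>
    rw [lowOnes, ih, lowOnes, Nat.testBit_succ, Bool.and_assoc]

/-- Binary increment: a bit flips exactly when all lower bits are `true`. This is the condition that
`Shift` puts on bit letters. -/
theorem testBit_add_one (q j : ℕ) :
    (q + 1).testBit j = xor (q.testBit j) (lowOnes q j) := by
  induction j generalizing q with
  | zero =>
    simp only [Nat.testBit_zero, lowOnes]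
    rcases Nat.mod_two_eq_zero_or_one q with h | h <;> simp [Nat.add_mod, h]
  | succ j ih =>
    rw [lowOnes_succ, Nat.testBit_succ, Nat.testBit_succ]
    rcases Nat.mod_two_eq_zero_or_one q with h | h
    · have : (q + 1) / 2 = q / 2 := by omega
      simp [this, h, Nat.testBit_zero]
    · have : (q + 1) / 2 = q / 2 + 1 := by omega
      simp [this, h, ih, Nat.testBit_zero]

/-- For `j = N` this identifies the carry after the last address bit with the flag of the next cell
being a first one. -/
theorem lowOnes_iff (q j : ℕ) : lowOnes q j = true ↔ 2 ^ j ∣ q + 1 := by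
  induction j generalizing q with
  | zero => simp [lowOnes]
  | succ j ih =>
    rw [lowOnes_succ, Bool.and_eq_true, ih, Nat.testBit_zero, decide_eq_true_eq, pow_succ']
    constructor
    · rintro ⟨h, c, hc⟩
      exact ⟨c, by rw [Nat.mul_assoc, ← hc]; omega⟩
    · rintro ⟨c, hc⟩
      rw [Nat.mul_assoc] at hc
      exact ⟨by omega, c, by omega⟩

/-- Local conditions determine the structure of a word. -/
theorem letter_structure {N : ℕ} (hN : 0 < N) {a : ℕ → R.Letter} (h0 : IsStart (a 0))
    (hz : ∀ j < N, HasBit false (a (1 + j))) (hadj : ∀ i, Adj (a i) (a (i + 1)))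
    (hdist : ∀ i, Shift (a i) (a (i + 1 + N))) (q : ℕ) :
    (∃ l c r, a (q * (N + 1)) = .inl (decide (2 ^ N ∣ q), l, c, r)) ∧
      ∀ j < N, a (q * (N + 1) + 1 + j) = .inr (q.testBit j, lowOnes q j) := by
  -- The flags follow from the bits: `Adj` sets the flag to `true` after a cell letter and then
  -- conjoins one bit at a time.
  have carry : ∀ q, IsCell (a (q * (N + 1))) →
      (∀ j < N, HasBit (q.testBit j) (a (q * (N + 1) + 1 + j))) →
      ∀ j < N, a (q * (N + 1) + 1 + j) = .inr (q.testBit j, lowOnes q j) := by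
    intro q hc hb j hj
    induction j with
    | zero =>
      have h1 := hadj (q * (N + 1))
      have h2 := hb 0 hj
      revert h1 h2 hc
      simp only [Nat.add_zero]
      rcases a (q * (N + 1)) with u | u <;> rcases a (q * (N + 1) + 1) with v | ⟨v, v'⟩ <;>
        simp [IsCell, HasBit, Adj, lowOnes]
      tauto
    | succ j ih =>
      have h1 := hadj (q * (N + 1) + 1 + j)
      have h2 := hb (j + 1) hj
      rw [ih (by omega)] at h1
      rw [← Nat.add_assoc] at h2 ⊢
      revert h1 h2
      rcases a (q * (N + 1) + 1 + j + 1) with v | ⟨v, v'⟩ <;>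
        simp [HasBit, Adj, lowOnes]
      tauto
  induction q with
  | zero =>
    have hc : ∃ l c r, a 0 = .inl (true, l, c, r) := by
      revert h0
      rcases a 0 with ⟨f, l, c, r⟩ | v <;> simp [IsStart]
      tauto
    refine ⟨by simpa using hc, carry 0 ?_ ?_⟩
    · obtain ⟨l, c, r, h⟩ := hc
      simp [h, IsCell]
    · simpa using hz
  | succ q ih =>
    obtain ⟨⟨l, c, r, hc⟩, hb⟩ := ih
    have hw : (q + 1) * (N + 1) = q * (N + 1) + 1 + N := by ring
    -- `Shift` at distance `N + 1` forces a cell letter here, and `Adj` from the last bit makes its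
    -- flag the final carry.
    have hc' : ∃ l c r, a ((q + 1) * (N + 1)) = .inl (decide (2 ^ N ∣ q + 1), l, c, r) := by
      have h1 := hdist (q * (N + 1))
      have h2 := hadj (q * (N + 1) + 1 + (N - 1))
      rw [hb _ (by omega), show q * (N + 1) + 1 + (N - 1) + 1 = (q + 1) * (N + 1) by
        rw [hw]; omega] at h2
      rw [hc, ← hw] at h1
      have h3 : decide (2 ^ N ∣ q + 1) = (lowOnes q (N - 1) && q.testBit (N - 1)) := by
        have : lowOnes q N = (lowOnes q (N - 1) && q.testBit (N - 1)) := by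
          obtain ⟨n, rfl⟩ : ∃ n, N = n + 1 := ⟨N - 1, by omega⟩
          rfl
        rw [← this, Bool.eq_iff_iff, lowOnes_iff, decide_eq_true_eq]
      rw [h3]
      revert h1 h2
      rcases a ((q + 1) * (N + 1)) with ⟨f, l', c', r'⟩ | v <;> simp [Shift, Adj]
    refine ⟨hc', carry (q + 1) ?_ fun j hj => ?_⟩
    · obtain ⟨l, c, r, h⟩ := hc'
      simp [h, IsCell]
    · have h1 := hdist (q * (N + 1) + 1 + j)
      rw [hb j hj, show q * (N + 1) + 1 + j + 1 + N = (q + 1) * (N + 1) + 1 + j by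
        rw [hw]; omega] at h1
      rw [testBit_add_one]
      revert h1
      rcases a ((q + 1) * (N + 1) + 1 + j) with v | v <;> simp [Shift, HasBit]

/-! ### What the control states enforce -/

section Compatible

variable {R} {x : List A} {N : ℕ} {σ : DataWord R.Letter}
  {V : ℕ → Ctrl R.Letter R.Γ → ℕ → σ.Datum → Prop}

theorem kind_of_pos {J : ℕ} (h : 0 < J) (h' : J ≤ N) :
    R.kind x N J = .mid (R.inpAt x[J - 1]?) := by
  obtain ⟨j, rfl⟩ : ∃ j, J = j + 1 := ⟨J - 1, by omega⟩
  simp [kind]; omega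

theorem Compatible.zero (hV : R.Compatible x N σ V) {J i : ℕ} {D : σ.Datum} (hJ : J ≤ N)
    (h : V J .zero i D) : ∀ j < J, HasBit false (σ.letter (i + j)) := by
  induction J generalizing i with
  | zero => intro j hj; omega
  | succ J ih =>
    have := hV _ (by omega) _ _ _ h
    rw [kind_of_pos (by omega) hJ] at this
    simp only [rule, PosBool.Sat, sat_ofProp] at this
    rintro (_ | j) hj
    · exact this.1
    · have := ih (by omega) this.2 j (by omega)
      rwa [Nat.add_right_comm, Nat.add_assoc] at this

theorem Compatible.check (hV : R.Compatible x N σ V) {J i : ℕ} {b : Bool} {D : σ.Datum}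
    (hJ : J ≤ N) (h : V J (.check b) i D) : HasBit b (σ.letter (i + J)) := by
  induction J generalizing i with
  | zero =>
    have := hV _ (by omega) _ _ _ h
    simpa only [rule, kind, sat_ofProp, Nat.add_zero] using this
  | succ J ih =>
    have := hV _ (by omega) _ _ _ h
    rw [kind_of_pos (by omega) hJ] at this
    have := ih (by omega) this
    rwa [Nat.add_right_comm, Nat.add_assoc] at this

/-- The counter is a timer: it decreases once per position, and the remembered letter is compared
when it reaches `0`. -/
theorem Compatible.dist (hV : R.Compatible x N σ V) {J i : ℕ} {a : R.Letter} {D : σ.Datum}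
    (hJ : J ≤ N) (h : V J (.dist a) i D) : Shift a (σ.letter (i + J)) := by
  induction J generalizing i with
  | zero =>
    have := hV _ (by omega) _ _ _ h
    simpa only [rule, kind, sat_ofProp, Nat.add_zero] using this
  | succ J ih =>
    have := hV _ (by omega) _ _ _ h
    rw [kind_of_pos (by omega) hJ] at this
    have := ih (by omega) this
    rwa [Nat.add_right_comm, Nat.add_assoc] at this

/-- The state `main` reproduces itself and the start state includes its formula, so the formula
governs every position. The timer `N` is set on the transition to position `i + 1`, hence the
distance `N + 1`. -/
theorem Compatible.main (hV : R.Compatible x N σ V) (h : V 0 .start 0 (σ.cls 0)) (i : ℕ) :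
    Valid (σ.letter i) ∧ Adj (σ.letter i) (σ.letter (i + 1)) ∧
      Shift (σ.letter i) (σ.letter (i + 1 + N)) ∧ ∀ f l c r, σ.letter i = .inl (f, l, c, r) →
        V 0 .addr (i + 1) (σ.cls i) ∧ V 0 (.wait (R.next l c r)) (i + 1) (σ.cls i) := by
  have key : ∀ i, (R.mainRule (σ.letter i)).Sat
      {r | V (r.1.val N 0) r.2 (i + 1) (σ.cls 0)} {r | V (r.1.val N 0) r.2 (i + 1) (σ.cls i)} := by
    intro i
    induction i with
    | zero => exact (hV _ (by omega) _ _ _ h).2.2.2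
    | succ i ih => exact hV 0 (by omega) .main _ _ ih.2.1
  obtain ⟨h1, h2, h3, h4, h5⟩ := key i
  refine ⟨(sat_ofProp _ _ _).1 h1, ?_, hV.dist le_rfl h4, fun f l c r e => ?_⟩
  · exact (sat_ofProp _ _ _).1 (hV 0 (by omega) (.adj _) _ _ h3)
  · rw [e] at h5
    exact h5

/-- The state persists forever with its counter unchanged. At a cell with the stored datum it spawns
a `check` whose timer expires exactly at bit `J` of that cell. -/
theorem Compatible.watch (hV : R.Compatible x N σ V) {J i i' : ℕ} {b : Bool} {D : σ.Datum}
    (hJ : J ≤ N) (h : V J (.watch b) i D) (hi : i ≤ i') (hc : IsCell (σ.letter i'))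
    (hD : D = σ.cls i') : HasBit b (σ.letter (i' + 1 + J)) := by
  have key : V J (.watch b) i' D := by
    have : ∀ d, V J (.watch b) (i + d) D := by
      intro d
      induction d with
      | zero => exact h
      | succ d ih => exact (hV _ (by omega) _ _ _ ih).1
    have := this (i' - i)
    rwa [Nat.add_sub_cancel' hi] at this
  have := (hV _ (by omega) _ _ _ key).2
  rw [if_pos ⟨hc, by simpa using hD⟩] at this
  exact hV.check hJ this

end Compatible

end CellRule

namespace CellRule

open Letter

variable {A : Type} {R : CellRule A}

section Compatible

variable {x : List A} {N : ℕ} {σ : DataWord R.Letter}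
  {V : ℕ → Ctrl R.Letter R.Γ → ℕ → σ.Datum → Prop}

/-- While passing over the address the counter equals the index of the current bit. The `watch` left
behind there keeps the index in its counter and the value in its control state. -/
theorem Compatible.addr (hV : R.Compatible x N σ V) {q : ℕ} {D : σ.Datum}
    (hb : ∀ j < N, σ.letter (q * (N + 1) + 1 + j) = .inr (q.testBit j, lowOnes q j))
    (h : V 0 .addr (q * (N + 1) + 1) D) {j : ℕ} (hj : j < N) :
    V j (.watch (q.testBit j)) (q * (N + 1) + 1 + j + 1) D := by
  have step : ∀ j < N, V j .addr (q * (N + 1) + 1 + j) D →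
      V j (.watch (q.testBit j)) (q * (N + 1) + 1 + j + 1) D ∧
        V (j + 1) .addr (q * (N + 1) + 1 + (j + 1)) D := by
    intro j hj h
    have := hV j (by omega) _ _ _ h
    rw [hb j hj] at this
    have hs : Ref.succ.val N j = j + 1 := by simp [Ref.val]; omega
    suffices V j (.watch (q.testBit j)) (q * (N + 1) + 1 + j + 1) D ∧
        V (Ref.succ.val N j) .addr (q * (N + 1) + 1 + j + 1) D by rwa [hs] at this
    rcases Nat.eq_zero_or_pos j with rfl | hj0
    · exact this
    · rw [kind_of_pos hj0 hj.le] at this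
      exact this
  have key : ∀ j ≤ N, V j .addr (q * (N + 1) + 1 + j) D := by
    intro j hj
    induction j with
    | zero => exact h
    | succ j ih => exact (step j hj (ih (by omega))).2
  exact (step j hj (key j hj.le)).1

/-- States that are kept at bits are kept up to the next cell. -/
theorem keep_bits {q : ℕ} {P : ℕ → Prop}
    (hb : ∀ j < N, σ.letter (q * (N + 1) + 1 + j) = .inr (q.testBit j, lowOnes q j))
    (hP : ∀ i u, σ.letter i = .inr u → P i → P (i + 1)) (h : P (q * (N + 1) + 1)) :
    P ((q + 1) * (N + 1)) := by
  have key : ∀ j ≤ N, P (q * (N + 1) + 1 + j) := by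
    intro j hj
    induction j with
    | zero => exact h
    | succ j ih => exact hP _ _ (hb j hj) (ih (by omega))
  have := key N le_rfl
  rwa [show q * (N + 1) + 1 + N = (q + 1) * (N + 1) by ring] at this

end Compatible

theorem mod_two_pow_eq {N q q' : ℕ} (h : ∀ j < N, q.testBit j = q'.testBit j) :
    q % 2 ^ N = q' % 2 ^ N := by
  refine Nat.eq_of_testBit_eq fun j => ?_
  rw [Nat.testBit_mod_two_pow, Nat.testBit_mod_two_pow]
  by_cases hj : j < N
  · rw [h j hj]
  · simp [hj]

/-- Words accepted by the automaton represent computations. -/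
theorem exists_run_of_accepts {x : List A} {N : ℕ} (hN : 0 < N) (hx : x.length ≤ N)
    {σ : DataWord R.Letter} (h : (R.automaton x N).Accepts σ) :
    ∃ row, R.Run x (2 ^ N) row := by
  obtain ⟨V, h0, hV⟩ := (R.automaton_accepts_iff x N σ).1 h
  have hm := hV.main h0
  have hst := hV 0 (by omega) _ _ _ h0
  have hs := R.letter_structure hN ((sat_ofProp _ _ _).1 hst.1)
    (by simpa using hV.zero le_rfl hst.2.1) (fun i => (hm i).2.1) (fun i => (hm i).2.2.1)
  have hinit : V 1 .init 1 (σ.cls 0) := hst.2.2.1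
  choose l c r hcell using fun q => (hs q).1
  have hbit := fun q => (hs q).2
  have hK : 0 < 2 ^ N := by positivity
  generalize hKe : 2 ^ N = K at *
  -- Bits are watched independently of each other, yet together they force equal addresses for equal
  -- data.
  have hsame : ∀ q q', q < q' → σ.cls (q * (N + 1)) = σ.cls (q' * (N + 1)) →
      q % K = q' % K := by
    intro q q' hq hD
    rw [← hKe]
    refine mod_two_pow_eq fun j hj => ?_
    have h1 := hV.addr (hbit q) ((hm _).2.2.2 _ _ _ _ (hcell q)).1 hj
    have hle : (q + 1) * (N + 1) ≤ q' * (N + 1) := Nat.mul_le_mul_right _ hq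
    have hle' : (q + 1) * (N + 1) = q * (N + 1) + 1 + N := by ring
    have h2 := hV.watch hj.le h1 (i' := q' * (N + 1)) (by omega) (by simp [hcell, IsCell]) hD
    rw [hbit q' j hj] at h2
    exact h2.symm
  -- If the corresponding cell of the next configuration had wrong contents, the waiting state could
  -- never be discharged and would survive until it is rejected at the deadline.
  have hnext : ∀ q, c (q + K) = R.next (l q) (c q) (r q) := by
    intro q
    by_contra hne
    have hw := ((hm _).2.2.2 _ _ _ _ (hcell q)).2
    set γ := R.next (l q) (c q) (r q)
    set D := σ.cls (q * (N + 1))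
    have hq1 := Nat.div_add_mod q K
    have hq2 := Nat.mod_lt q hK
    set e := q / K
    -- Equal data force a distance divisible by `K`; below `2 * K` only the cell `q + K` remains,
    -- and its contents differ from `γ` by assumption.
    have hfound : ∀ q', q < q' → q' < q + 2 * K → D = σ.cls (q' * (N + 1)) → c q' ≠ γ := by
      intro q' h1 h2 h3 h4
      have h5 := hsame q q' h1 h3
      obtain ⟨d, rfl⟩ := Nat.exists_eq_add_of_lt h1
      have h6 : K ∣ d + 1 := by
        have := (Nat.modEq_iff_dvd' (n := K) (show q ≤ q + d + 1 by omega)).1 h5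
        rwa [show q + d + 1 - q = d + 1 by omega] at this
      obtain ⟨m, hm⟩ := h6
      have hm1 : m = 1 := by
        rcases m with _ | _ | m
        · omega
        · rfl
        · have : K * (m + 1 + 1) = K * m + 2 * K := by ring
          omega
      subst hm1
      rw [show q + d + 1 = q + K by omega] at h4
      exact hne h4
    have hKe' : K * (e + 1) = K * e + K := by ring
    have hKe2 : K * (e + 2) = K * e + 2 * K := by ring
    have nodvd : ∀ m q', K * m < q' → q' < K * m + K → ¬K ∣ q' := by
      rintro m q' h1 h2 ⟨d, rfl⟩
      have h3 : m < d := Nat.lt_of_mul_lt_mul_left h1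
      have h4 : d < m + 1 := Nat.lt_of_mul_lt_mul_left (a := K) (by rw [Nat.mul_add]; omega)
      omega
    -- The obligation is carried up to the next first cell, which has number `K * (e + 1)`.
    have hA : ∀ d, q + 1 + d ≤ K * (e + 1) → V 0 (.wait γ) ((q + 1 + d) * (N + 1)) D := by
      intro d
      induction d with
      | zero =>
        intro _
        refine keep_bits (hbit q) (P := fun i => V 0 (.wait γ) i D) (fun i u hu hP => ?_) hw
        have := hV 0 (by omega) _ _ _ hP
        rw [hu] at this
        exact this
      | succ d ih =>
        intro hd
        refine keep_bits (hbit (q + 1 + d)) (P := fun i => V 0 (.wait γ) i D)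
          (fun i u hu hP => ?_) ?_
        · have := hV 0 (by omega) _ _ _ hP
          rw [hu] at this
          exact this
        · have := hV 0 (by omega) _ _ _ (ih (by omega))
          rw [hcell, decide_eq_false (nodvd e _ (by omega) (by omega))] at this
          by_cases hD : D = σ.cls ((q + 1 + d) * (N + 1))
          · simp only [rule, hD, decide_true, Bool.false_eq_true, if_false, if_true, sat_ofProp] at this
            exact absurd this (hfound _ (by omega) (by omega) hD)
          · simp only [rule, hD, decide_false, Bool.false_eq_true, if_false] at this
            exact this
    -- After that first cell the obligation continues as `waitLate`, up to the next but one first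
    -- cell `K * (e + 2)`.
    have hB : ∀ d, K * (e + 1) + 1 + d ≤ K * (e + 2) →
        V 0 (.waitLate γ) ((K * (e + 1) + 1 + d) * (N + 1)) D := by
      intro d
      have hbits : ∀ i u, σ.letter i = .inr u → V 0 (.waitLate γ) i D →
          V 0 (.waitLate γ) (i + 1) D := fun i u hu hP => by
        have := hV 0 (by omega) _ _ _ hP
        rw [hu] at this
        exact this
      induction d with
      | zero =>
        intro _
        refine keep_bits (hbit _) (P := fun i => V 0 (.waitLate γ) i D) hbits ?_
        have h1 := hA (K * (e + 1) - q - 1) (by omega)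
        rw [show q + 1 + (K * (e + 1) - q - 1) = K * (e + 1) by omega] at h1
        have := hV 0 (by omega) _ _ _ h1
        rw [hcell, decide_eq_true ⟨_, rfl⟩] at this
        by_cases hD : D = σ.cls (K * (e + 1) * (N + 1))
        · simp only [rule, hD, decide_true, if_true, sat_ofProp] at this
          exact absurd this (hfound _ (by omega) (by omega) hD)
        · simp only [rule, hD, decide_false, Bool.false_eq_true, if_false, if_true] at this
          exact this
      | succ d ih =>
        intro hd
        refine keep_bits (hbit _) (P := fun i => V 0 (.waitLate γ) i D) hbits ?_
        have := hV 0 (by omega) _ _ _ (ih (by omega))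
        rw [hcell, decide_eq_false (nodvd (e + 1) _ (by omega) (by omega))] at this
        by_cases hD : D = σ.cls ((K * (e + 1) + 1 + d) * (N + 1))
        · simp only [rule, hD, decide_true, Bool.false_eq_true, if_false, if_true, sat_ofProp] at this
          exact absurd this (hfound _ (by omega) (by omega) hD)
        · simp only [rule, hD, decide_false, Bool.false_eq_true, if_false] at this
          exact this
    -- At the deadline `waitLate` meets a first cell, where its transition formula is `bot`.
    have h1 := hB (K - 1) (by omega)
    rw [show K * (e + 1) + 1 + (K - 1) = K * (e + 2) by omega] at h1
    have := hV 0 (by omega) _ _ _ h1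
    rw [hcell, decide_eq_true ⟨_, rfl⟩] at this
    exact this
  have hlater : ∀ k, 0 < k → k < K → decide (K ∣ k) = false := fun k h1 h2 =>
    decide_eq_false fun h => absurd (Nat.le_of_dvd h1 h) (by omega)
  -- The counter of `init` is one more than the index of the input symbol expected next and
  -- saturates at `N + 1`, where only blanks are allowed. By `hlater` no first cell ends the check
  -- within the first configuration.
  have hinp : ∀ k, k + 1 < K → V (min (k + 1) (N + 1)) .init (k * (N + 1) + 1) (σ.cls 0) →
      c (k + 1) = R.inpAt x[k]? ∧
        V (min (k + 1 + 1) (N + 1)) .init ((k + 1) * (N + 1) + 1) (σ.cls 0) := by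
    intro k hk hi
    by_cases hkN : k < N
    · rw [min_eq_left (by omega)] at hi
      have hkind : R.kind x N (k + 1) = .mid (R.inpAt x[k]?) := by simp [kind, hkN]
      have h1 := keep_bits (hbit k) (P := fun i => V (k + 1) .init i (σ.cls 0))
        (fun i u hu hP => by
          have := hV (k + 1) (by omega) _ _ _ hP
          rw [hu, hkind] at this
          exact this) hi
      have := hV (k + 1) (by omega) _ _ _ h1
      rw [hcell, hlater _ (by omega) hk, hkind] at this
      exact ⟨(sat_ofProp _ _ _).1 this.1, this.2⟩
    · rw [min_eq_right (by omega)] at hi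
      have hkind : R.kind x N (N + 1) = .high := by simp [kind]
      have h1 := keep_bits (hbit k) (P := fun i => V (N + 1) .init i (σ.cls 0))
        (fun i u hu hP => by
          have := hV (N + 1) le_rfl _ _ _ hP
          rw [hu, hkind] at this
          exact this) hi
      have := hV (N + 1) le_rfl _ _ _ h1
      rw [hcell, hlater _ (by omega) hk, hkind] at this
      rw [min_eq_right (by omega), List.getElem?_eq_none (by omega)]
      exact ⟨(sat_ofProp _ _ _).1 this.1, this.2⟩
  have hinit' : ∀ k < K, V (min (k + 1) (N + 1)) .init (k * (N + 1) + 1) (σ.cls 0) := by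
    intro k hk
    induction k with
    | zero => simpa using hinit
    | succ k ih => exact (hinp k hk (ih (by omega))).2
  -- Cells are numbered consecutively through the word, with `K` of them per row.
  refine ⟨fun t k => c (t * K + k), fun k hk => ?_, fun t k hk => ⟨?_, ?_⟩⟩
  · simp only [Nat.zero_mul, Nat.zero_add]
    rcases k with _ | k
    · have h1 := (sat_ofProp _ _ _).1 hst.1
      have h2 := hcell 0
      rw [Nat.zero_mul] at h2
      rw [h2] at h1
      exact h1.2
    · exact (hinp k hk (hinit' k (by omega))).1
  · have := (hm ((t * K + k) * (N + 1))).1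
    rw [hcell] at this
    exact this.1
  · have hdvd : ∀ t k, K ∣ t * K + k ↔ K ∣ k := fun t k =>
      (Nat.dvd_add_right (Dvd.intro_left t rfl))
    have hsh : ∀ q, (K ∣ q + 1 → r q = R.blank) ∧ (¬K ∣ q + 1 → l (q + 1) = c q ∧ c (q + 1) = r q) := by
      intro q
      have := (hm (q * (N + 1))).2.2.1
      rw [show q * (N + 1) + 1 + N = (q + 1) * (N + 1) by ring, hcell, hcell] at this
      exact ⟨fun h => this.1 (by simpa using h), fun h => this.2 (by simpa using h)⟩
    show c ((t + 1) * K + k) = R.next (if k = 0 then R.first else c (t * K + (k - 1)))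
      (c (t * K + k)) (if k + 1 = K then R.blank else c (t * K + (k + 1)))
    rw [show (t + 1) * K + k = t * K + k + K by ring, hnext]
    congr 1
    · by_cases hk0 : k = 0
      · rw [if_pos hk0, hk0]
        have := (hm ((t * K + 0) * (N + 1))).1
        rw [hcell] at this
        exact this.2 (by simp)
      · rw [if_neg hk0]
        have := (hsh (t * K + (k - 1))).2 (by
          rw [Nat.add_assoc, hdvd, Nat.sub_add_cancel (by omega)]
          exact fun h => absurd (Nat.le_of_dvd (by omega) h) (by omega))
        rw [Nat.add_assoc, Nat.sub_add_cancel (by omega)] at this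
        exact this.1
    · by_cases hk1 : k + 1 = K
      · rw [if_pos hk1]
        exact (hsh _).1 (by rw [Nat.add_assoc, hdvd, hk1])
      · rw [if_neg hk1, ← Nat.add_assoc]
        exact ((hsh _).2 (by
          rw [Nat.add_assoc, hdvd]
          exact fun h => absurd (Nat.le_of_dvd (by omega) h) (by omega))).2.symm

end CellRule

namespace CellRule

open Letter SafetyLTL

variable {A : Type} {R : CellRule A}

/-! ### Satisfaction of the sentence by words that represent computations -/

/-- The data word for a space-time diagram on `2 ^ N` cells. -/
def wordOf (row : ℕ → ℕ → R.Γ) (N : ℕ) : DataWord R.Letter where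
  letter i := match i % (N + 1) with
    | 0 => .inl (decide (2 ^ N ∣ i / (N + 1)),
        if i / (N + 1) % 2 ^ N = 0 then R.first
        else row (i / (N + 1) / 2 ^ N) (i / (N + 1) % 2 ^ N - 1),
        row (i / (N + 1) / 2 ^ N) (i / (N + 1) % 2 ^ N),
        if i / (N + 1) % 2 ^ N + 1 = 2 ^ N then R.blank
        else row (i / (N + 1) / 2 ^ N) (i / (N + 1) % 2 ^ N + 1))
    | j + 1 => .inr ((i / (N + 1)).testBit j, lowOnes (i / (N + 1)) j)
  sim := Setoid.ker fun i => i % (2 ^ N * (N + 1))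

section WordOf

variable {row : ℕ → ℕ → R.Γ} {N : ℕ}

theorem wordOf_cell (q : ℕ) : (wordOf row N).letter (q * (N + 1)) = .inl (decide (2 ^ N ∣ q),
    if q % 2 ^ N = 0 then R.first else row (q / 2 ^ N) (q % 2 ^ N - 1),
    row (q / 2 ^ N) (q % 2 ^ N),
    if q % 2 ^ N + 1 = 2 ^ N then R.blank else row (q / 2 ^ N) (q % 2 ^ N + 1)) := by
  simp only [wordOf, Nat.mul_mod_left, Nat.mul_div_cancel q (Nat.succ_pos N)]

theorem wordOf_bit (q : ℕ) {j : ℕ} (hj : j < N) :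
    (wordOf row N).letter (q * (N + 1) + 1 + j) = .inr (q.testBit j, lowOnes q j) := by
  have h1 : (q * (N + 1) + 1 + j) % (N + 1) = j + 1 := by
    rw [Nat.add_assoc, Nat.mul_comm, Nat.mul_add_mod, Nat.mod_eq_of_lt (by omega), Nat.add_comm]
  have h2 : (q * (N + 1) + 1 + j) / (N + 1) = q := by
    rw [Nat.add_assoc, Nat.mul_comm, Nat.mul_add_div (by omega), Nat.div_eq_of_lt (by omega),
      Nat.add_zero]
  simp only [wordOf, h1, h2]

theorem exists_position (N i : ℕ) :
    ∃ q, i = q * (N + 1) ∨ ∃ j < N, i = q * (N + 1) + 1 + j := by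
  have h1 := Nat.div_add_mod i (N + 1)
  have h2 : i % (N + 1) < N + 1 := Nat.mod_lt i (Nat.succ_pos N)
  refine ⟨i / (N + 1), ?_⟩
  rw [Nat.mul_comm] at h1
  rcases h : i % (N + 1) with _ | j
  · left; omega
  · right; exact ⟨j, by omega, by omega⟩

/-- Data are positions modulo the length of a configuration, so a cell meets its datum again exactly
once in each later configuration. -/
theorem wordOf_cls (q q' : ℕ) :
    (wordOf row N).cls (q * (N + 1)) = (wordOf row N).cls (q' * (N + 1)) ↔
      q % 2 ^ N = q' % 2 ^ N := by
  rw [DataWord.cls, DataWord.cls, Quotient.eq]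
  show q * (N + 1) % (2 ^ N * (N + 1)) = q' * (N + 1) % (2 ^ N * (N + 1)) ↔ _
  rw [Nat.mul_mod_mul_right, Nat.mul_mod_mul_right]
  exact Nat.mul_left_inj (by omega)

theorem exists_of_isCell {i : ℕ} (h : IsCell ((wordOf row N).letter i)) :
    ∃ q, i = q * (N + 1) := by
  obtain ⟨q, rfl | ⟨j, hj, rfl⟩⟩ := exists_position N i
  · exact ⟨q, rfl⟩
  · rw [wordOf_bit q hj] at h; exact h.elim

theorem mod_ne_of_lt {K q q' : ℕ} (h : q < q') (h' : q' < q + K) : q' % K ≠ q % K := by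
  intro he
  have h1 := (Nat.modEq_iff_dvd' h.le).1 he.symm
  have := Nat.le_of_dvd (by omega) h1
  omega

/-- The datum of a cell recurs in the next configuration. -/
theorem sat_hereF (q : ℕ) : (R.hereF (row (q / 2 ^ N + 1) (q % 2 ^ N))).Sat (wordOf row N)
    ((q + 2 ^ N) * (N + 1)) ((wordOf row N).cls (q * (N + 1))) := by
  have hK : 0 < 2 ^ N := by positivity
  refine ⟨(sat_anyOf _ _ _ _).2 ?_, (wordOf_cls _ _).2 (by simp)⟩
  rw [wordOf_cell]
  simp [Holds, Nat.add_div_right _ hK]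

theorem lt_of_cell_lt {q q' i : ℕ} (h : q * (N + 1) + i ≤ q' * (N + 1)) (hi : 0 < i) : q < q' :=
  Nat.lt_of_mul_lt_mul_right (a := N + 1) (by omega)

theorem le_of_cell_le {q q' : ℕ} (h : q * (N + 1) ≤ q' * (N + 1)) : q ≤ q' :=
  Nat.le_of_mul_le_mul_right h (by omega)

/-- The release happens at cell `q + 2 ^ N`. No first cell lies strictly after `q'` up to there,
since first cells are `2 ^ N` apart. -/
theorem sat_waitLateF {q q' : ℕ} (h : q < q') (h' : q' < q + 2 ^ N) (hd : 2 ^ N ∣ q') :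
    (R.waitLateF (row (q / 2 ^ N + 1) (q % 2 ^ N))).Sat (wordOf row N) (q' * (N + 1) + 1)
      ((wordOf row N).cls (q * (N + 1))) := by
  refine .inr ⟨(q + 2 ^ N) * (N + 1), ?_, sat_hereF q, fun k hk hk' => ?_⟩
  · exact Nat.mul_lt_mul_of_pos_right h' (by omega)
  obtain ⟨p, rfl | ⟨j, hj, rfl⟩⟩ := exists_position N k
  · have h1 : q' < p := lt_of_cell_lt hk (by omega)
    have h2 : p ≤ q + 2 ^ N := le_of_cell_le hk'
    have h3 : ¬2 ^ N ∣ p := fun h3 => by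
      have h4 := (Nat.dvd_sub h3 hd)
      have := Nat.le_of_dvd (by omega) h4
      omega
    refine .inr ⟨(sat_anyOf _ _ _ _).2 (by rw [wordOf_cell]; simpa [IsLater] using h3), ?_⟩
    rcases h2.eq_or_lt with rfl | h2
    · exact .inr (sat_hereF q)
    · refine .inl ?_
      simp only [Sat, ne_eq, wordOf_cls]
      exact mod_ne_of_lt (by omega) h2
  · exact .inl ((sat_anyOf _ _ _ _).2 (by rw [wordOf_bit p hj]; trivial))

/-- Strictly between `q` and `q + 2 ^ N` the datum does not occur, and at most one first cell is
passed; there the obligation is handed to `waitLateF`. -/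
theorem sat_waitF (q : ℕ) :
    (R.waitF (row (q / 2 ^ N + 1) (q % 2 ^ N))).Sat (wordOf row N) (q * (N + 1) + 1)
      ((wordOf row N).cls (q * (N + 1))) := by
  have hK : 0 < 2 ^ N := by positivity
  refine .inr ⟨(q + 2 ^ N) * (N + 1), ?_, sat_hereF q, fun k hk hk' => ?_⟩
  · exact Nat.mul_lt_mul_of_pos_right (by omega) (by omega)
  obtain ⟨p, rfl | ⟨j, hj, rfl⟩⟩ := exists_position N k
  · have h1 : q < p := lt_of_cell_lt hk (by omega)
    have h2 : p ≤ q + 2 ^ N := le_of_cell_le hk'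
    right
    rcases h2.eq_or_lt with rfl | h2
    · exact .inl (sat_hereF q)
    · refine .inr ⟨?_, ?_⟩
      · simp only [Sat, ne_eq, wordOf_cls]
        exact mod_ne_of_lt (by omega) h2
      · by_cases hd : 2 ^ N ∣ p
        · exact .inr ⟨(sat_anyOf _ _ _ _).2 (by rw [wordOf_cell]; simpa [IsFirst] using hd),
            sat_waitLateF h1 h2 hd⟩
        · exact .inl ((sat_anyOf _ _ _ _).2 (by rw [wordOf_cell]; simpa [IsLater] using hd))
  · exact .inl ((sat_anyOf _ _ _ _).2 (by rw [wordOf_bit p hj]; trivial))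

theorem sat_initF {x : List A} (hx : x.length ≤ N) (hr : R.Run x (2 ^ N) row)
    (D : (wordOf row N).Datum) (n : ℕ) : ∀ j, j + n = N →
      (R.initF x j n).Sat (wordOf row N) (j * (N + 1) + 1) D := by
  have hNK : N < 2 ^ N := Nat.lt_two_pow_self
  have hin : ∀ k, k + 1 < 2 ^ N → Holds (R.inpAt x[k]?) ((wordOf row N).letter ((k + 1) * (N + 1))) := by
    intro k hk
    rw [wordOf_cell, Nat.div_eq_of_lt hk, Nat.mod_eq_of_lt hk]
    exact hr.1 (k + 1) hk
  induction n with
  | zero =>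
    rintro j rfl
    have hf : IsFirst ((wordOf row (j + 0)).letter (2 ^ (j + 0) * (j + 0 + 1))) := by
      rw [wordOf_cell]; simp [IsFirst]
    -- The release point is the start of the second configuration; it lies ahead because `N < 2 ^
    -- N`. All cells in between are beyond the input, hence blank.
    refine .inr ⟨2 ^ (j + 0) * (j + 0 + 1), Nat.mul_lt_mul_of_pos_right hNK (by omega),
      (sat_anyOf _ _ _ _).2 hf, fun k hk hk' => ?_⟩
    obtain ⟨p, rfl | ⟨i, hi, rfl⟩⟩ := exists_position (j + 0) k
    · have h1 : j < p := lt_of_cell_lt hk (by omega)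
      have h2 : p ≤ 2 ^ (j + 0) := le_of_cell_le hk'
      right
      rcases h2.eq_or_lt with rfl | h2
      · exact .inl ((sat_anyOf _ _ _ _).2 hf)
      · obtain ⟨p, rfl⟩ : ∃ p', p = p' + 1 := ⟨p - 1, by omega⟩
        have := hin p h2
        rw [List.getElem?_eq_none (by omega)] at this
        exact .inr ((sat_anyOf _ _ _ _).2 this)
    · exact .inl ((sat_anyOf _ _ _ _).2 (by rw [wordOf_bit p hi]; trivial))
  | succ n ih =>
    intro j hj
    rw [initF, List.range'_succ, List.foldr_cons]
    refine .inr ⟨(j + 1) * (N + 1), Nat.mul_lt_mul_of_pos_right (by omega) (by omega),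
      (sat_anyOf _ _ _ _).2 (by rw [wordOf_cell]; trivial), fun k hk hk' => ?_⟩
    obtain ⟨p, rfl | ⟨i, hi, rfl⟩⟩ := exists_position N k
    · have h1 : j < p := lt_of_cell_lt hk (by omega)
      have h2 : p ≤ j + 1 := le_of_cell_le hk'
      obtain rfl : p = j + 1 := by omega
      exact .inr (.inr ⟨(sat_anyOf _ _ _ _).2 (hin j (by omega)), ih (j + 1) (by omega)⟩)
    · exact .inl ((sat_anyOf _ _ _ _).2 (by rw [wordOf_bit p hi]; trivial))

theorem div_mod_succ {K q : ℕ} (hK : 0 < K) (h : ¬K ∣ q + 1) :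
    (q + 1) / K = q / K ∧ (q + 1) % K = q % K + 1 ∧ q % K + 1 ≠ K := by
  have h1 := Nat.div_add_mod q K
  have h2 := Nat.mod_lt q hK
  have h3 : q % K + 1 ≠ K := fun h3 => h ⟨q / K + 1, by rw [Nat.mul_add]; omega⟩
  have h4 : (q + 1) / K = q / K := Nat.succ_div_of_not_dvd h
  have h5 := Nat.div_add_mod (q + 1) K
  rw [h4] at h5
  exact ⟨h4, by omega, h3⟩

theorem sat_letterF {x : List A} (hN : 0 < N) (hr : R.Run x (2 ^ N) row) (i : ℕ)
    (D : (wordOf row N).Datum) :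
    (R.letterF N ((wordOf row N).letter i)).Sat (wordOf row N) i D := by
  have hK : 0 < 2 ^ N := by positivity
  obtain ⟨q, rfl | ⟨j, hj, rfl⟩⟩ := exists_position N i
  · have hk : q % 2 ^ N < 2 ^ N := Nat.mod_lt _ hK
    have hrun := hr.2 (q / 2 ^ N) _ hk
    refine ⟨?_, (sat_anyOf _ _ _ _).2 ?_, (sat_nexts _ _ _ _ _).2 ((sat_anyOf _ _ _ _).2 ?_), ?_⟩
    · have : Valid ((wordOf row N).letter (q * (N + 1))) := by
        rw [wordOf_cell]
        refine ⟨hrun.1, fun h => if_pos ?_⟩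
        exact Nat.mod_eq_zero_of_dvd (by simpa using h)
      rw [if_pos this]; trivial
    · have := wordOf_bit (row := row) q hN
      rw [Nat.add_zero] at this
      rw [wordOf_cell, this]
      rfl
    · rw [show q * (N + 1) + 1 + N = (q + 1) * (N + 1) by ring, wordOf_cell, wordOf_cell]
      refine ⟨fun h => if_pos ?_, fun h => ?_⟩
      · have h : 2 ^ N ∣ q + 1 := by simpa using h
        by_contra hne
        obtain ⟨d, hd⟩ := h
        have h1 := Nat.div_add_mod q (2 ^ N)
        have h2 : q % 2 ^ N + 1 = 2 ^ N * (d - q / 2 ^ N) := by rw [Nat.mul_sub]; omega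
        have := Nat.le_of_dvd (by omega) (⟨_, h2⟩ : 2 ^ N ∣ q % 2 ^ N + 1)
        omega
      · obtain ⟨h1, h2, h3⟩ := div_mod_succ hK (q := q) (by simpa using h)
        rw [h1, h2, if_neg (by omega), if_neg h3]
        exact ⟨rfl, rfl⟩
    -- The run condition identifies the value of the rule with the contents one row later, where the
    -- datum recurs.
    · have := sat_waitF (R := R) (row := row) (N := N) q
      rw [hrun.2] at this
      rw [wordOf_cell]
      exact this
  · refine ⟨?_, (sat_anyOf _ _ _ _).2 ?_, (sat_nexts _ _ _ _ _).2 ((sat_anyOf _ _ _ _).2 ?_), ?_⟩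
    · rw [wordOf_bit q hj, if_pos (show Valid (.inr _ : R.Letter) from trivial)]; trivial
    · rw [wordOf_bit q hj]
      by_cases hj' : j + 1 < N
      · rw [Nat.add_assoc _ j 1, wordOf_bit q hj']
        rfl
      · rw [show q * (N + 1) + 1 + j + 1 = (q + 1) * (N + 1) by
          rw [show N = j + 1 by omega]; ring, wordOf_cell]
        -- After the last bit, the accumulated carry must announce a first cell exactly when the
        -- address wraps around.
        have : decide (2 ^ N ∣ q + 1) = lowOnes q N := by
          rw [Bool.eq_iff_iff, lowOnes_iff, decide_eq_true_eq]
        obtain rfl : N = j + 1 := by omega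
        exact this
    · rw [show q * (N + 1) + 1 + j + 1 + N = (q + 1) * (N + 1) + 1 + j by ring,
        wordOf_bit q hj, wordOf_bit (q + 1) hj]
      exact testBit_add_one q j
    · rw [wordOf_bit q hj]; trivial

theorem sat_sentence {x : List A} (hN : 0 < N) (hx : x.length ≤ N) (hr : R.Run x (2 ^ N) row) :
    wordOf row N ∈ (R.sentence x N).lang := by
  intro D
  refine ⟨(sat_anyOf _ _ _ _).2 ?_, (R.sat_zerosF _ _ _ _).2 fun j hj => ?_, ?_,
    (R.sat_addrsF _ _ _ _).2 fun j hj b => (R.sat_addrF _ _ _ _).2 ?_,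
    (sat_always _ _ _ _).2 fun i _ => (sat_caseLetter _ _ _ _).2 (sat_letterF hN hr i D)⟩
  · have := wordOf_cell (row := row) (N := N) 0
    rw [Nat.zero_mul] at this
    rw [this]
    have h := hr.1 0 (by positivity)
    exact ⟨by simp, by simpa [initial] using h⟩
  · have := wordOf_bit (row := row) 0 hj
    rw [Nat.zero_mul] at this
    rw [this]
    simp [HasBit]
  · have := sat_initF hx hr D N 0 (by omega)
    rwa [Nat.zero_mul] at this
  · intro p p' _ hp hp' hD hb
    obtain ⟨q, rfl⟩ := exists_of_isCell hp
    obtain ⟨q', rfl⟩ := exists_of_isCell hp'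
    rw [wordOf_cls] at hD
    rw [wordOf_bit _ hj] at hb ⊢
    have h1 := Nat.testBit_mod_two_pow q N j
    have h2 := Nat.testBit_mod_two_pow q' N j
    rw [hD] at h2
    simp only [hj, decide_true, Bool.true_and] at h1 h2
    simp only [HasBit] at hb ⊢
    rw [← h2, h1, hb]

end WordOf

/-! ### The automaton accepts the words that satisfy the sentence -/

theorem kind_cases (R : CellRule A) (x : List A) {J N : ℕ} (hJ : J ≤ N + 1) :
    (J = 0 ∧ R.kind x N J = .low) ∨ (0 < J ∧ J ≤ N ∧ R.kind x N J = .mid (R.inpAt x[J - 1]?)) ∨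
      (J = N + 1 ∧ R.kind x N J = .high) := by
  rcases Nat.eq_zero_or_pos J with rfl | h
  · exact .inl ⟨rfl, rfl⟩
  · rcases Nat.lt_or_ge N J with h' | h'
    · obtain rfl : J = N + 1 := by omega
      exact .inr (.inr ⟨rfl, by simp [kind]⟩)
    · exact .inr (.inl ⟨h, h', kind_of_pos h h'⟩)

/-- Each state is interpreted by the part of the sentence that it monitors, and this interpretation
is shown to be compatible with the transition formulae. -/
theorem automaton_accepts_of_sat {x : List A} {N : ℕ} {σ : DataWord R.Letter}
    (h : σ ∈ (R.sentence x N).lang) : (R.automaton x N).Accepts σ := by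
  rw [automaton_accepts_iff]
  obtain ⟨hstart, hzero, hinit, haddr, hmain⟩ := h (σ.cls 0)
  rw [sat_anyOf] at hstart
  rw [Sat, sat_zerosF] at hzero
  rw [sat_addrsF] at haddr
  rw [Sat] at hinit
  have hmain : ∀ i, _ := fun i => (sat_caseLetter _ _ _ _).1 ((sat_always _ _ _ _).1 hmain i (by omega))
  have hvalid : ∀ i, Valid (σ.letter i) := fun i => by
    by_contra hv
    have := (hmain i).1
    rw [if_neg hv] at this
    exact this
  have hadj : ∀ i, Adj (σ.letter i) (σ.letter (i + 1)) := fun i =>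
    (sat_anyOf _ _ _ _).1 (hmain i).2.1
  have hshift : ∀ i, Shift (σ.letter i) (σ.letter (i + 1 + N)) := fun i =>
    (sat_anyOf _ _ _ _).1 ((sat_nexts _ _ _ _ _).1 (hmain i).2.2.1)
  have hwait : ∀ i f l c r, σ.letter i = .inl (f, l, c, r) →
      (R.waitF (R.next l c r)).Sat σ (i + 1) (σ.cls i) := fun i f l c r e => by
    have := (hmain i).2.2.2
    rw [e] at this
    exact this
  -- The guards `J ≤ N` reflect that `zero`, `check` and `dist` have no obligation at the value `N +
  -- 1`. In `init` the value `J` means that the input from position `J - 1` on is still to be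
  -- checked.
  let V : ℕ → Ctrl R.Letter R.Γ → ℕ → σ.Datum → Prop := fun J q i D => match q with
    | .start => J = 0 ∧ i = 0 ∧ D = σ.cls 0
    | .main => True
    | .zero => J ≤ N → ∀ j < J, HasBit false (σ.letter (i + j))
    | .init => 0 < J ∧ (R.initF x (J - 1) (N + 1 - J)).Sat σ i D
    | .addr => ∃ p, IsCell (σ.letter p) ∧ D = σ.cls p ∧ i = p + 1 + J
    | .watch b => J < N ∧ ∃ p, IsCell (σ.letter p) ∧ D = σ.cls p ∧ p < i ∧
        HasBit b (σ.letter (p + 1 + J))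
    | .check b => J ≤ N → HasBit b (σ.letter (i + J))
    | .dist a => J ≤ N → Shift a (σ.letter (i + J))
    | .adj a => Adj a (σ.letter i)
    | .wait γ => (R.waitF γ).Sat σ i D
    | .waitLate γ => (R.waitLateF γ).Sat σ i D
  have hmainRule : ∀ (J i : ℕ) (D : σ.Datum), (R.mainRule (σ.letter i)).Sat
      {r | V (r.1.val N J) r.2 (i + 1) D} {r | V (r.1.val N J) r.2 (i + 1) (σ.cls i)} := by
    intro J i D
    refine ⟨(sat_ofProp _ _ _).2 (hvalid i), trivial, hadj i, fun _ => hshift i, ?_⟩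
    rcases e : σ.letter i with ⟨f, l, c, r⟩ | u
    · exact ⟨⟨i, by rw [e]; trivial, rfl, rfl⟩, hwait i f l c r e⟩
    · trivial
  refine ⟨V, ⟨rfl, rfl, rfl⟩, fun J hJ q i D hV => ?_⟩
  cases q with
  | start =>
    obtain ⟨rfl, rfl, rfl⟩ := hV
    exact ⟨(sat_ofProp _ _ _).2 hstart, fun _ => hzero, ⟨Nat.one_pos, by simpa [Ref.val] using hinit⟩,
      hmainRule _ _ _⟩
  | main => exact hmainRule _ _ _
  | zero =>
    rcases kind_cases R x hJ with ⟨rfl, hk⟩ | ⟨h0, h1, hk⟩ | ⟨rfl, hk⟩ <;> rw [hk]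
    · trivial
    · have hV := hV h1
      refine ⟨(sat_ofProp _ _ _).2 (hV 0 h0), fun _ j hj => ?_⟩
      have := hV (j + 1) (by simp only [Ref.val] at hj; omega)
      rwa [Nat.add_comm j 1, ← Nat.add_assoc] at this
    · trivial
  | init =>
    obtain ⟨h0, hV⟩ := hV
    rcases kind_cases R x hJ with ⟨rfl, hk⟩ | ⟨h0, h1, hk⟩ | ⟨rfl, hk⟩ <;> rw [hk]
    · trivial
    · have e : R.initF x (J - 1) (N + 1 - J) =
          R.initStepF (R.inpAt x[J - 1]?) (R.initF x J (N - J)) := by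
        rw [show N + 1 - J = N - J + 1 by omega, initF, List.range'_succ, List.foldr_cons,
          Nat.sub_add_cancel h0]
        rfl
      have hV' := hV
      rw [e, initStepF, sat_release_iff, ← initStepF, ← e] at hV'
      simp only [Sat, sat_anyOf] at hV'
      rcases hl : σ.letter i with ⟨f, l, c, r⟩ | u <;> rw [hl] at hV'
      · cases f with
        | true => trivial
        | false =>
          have h2 : Holds (R.inpAt x[J - 1]?) (.inl (false, l, c, r)) ∧
              (R.initF x J (N - J)).Sat σ (i + 1) D := by
            simpa [IsBit, IsFirst] using hV'.1
          refine ⟨(sat_ofProp _ _ _).2 h2.1, ?_⟩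
          show 0 < min (J + 1) (N + 1) ∧
            (R.initF x (min (J + 1) (N + 1) - 1) (N + 1 - min (J + 1) (N + 1))).Sat σ (i + 1) D
          rw [min_eq_left (by omega), Nat.add_sub_cancel, Nat.add_sub_add_right]
          exact ⟨by omega, h2.2⟩
      · exact ⟨h0, hV'.2.resolve_left id⟩
    · have e : R.initF x (N + 1 - 1) (N + 1 - (N + 1)) = R.initEndF := by
        rw [Nat.sub_self]; rfl
      have hV' := hV
      rw [e, initEndF, sat_release_iff, ← initEndF, ← e] at hV'
      simp only [Sat, sat_anyOf] at hV'
      rcases hl : σ.letter i with ⟨f, l, c, r⟩ | u <;> rw [hl] at hV'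
      · cases f with
        | true => trivial
        | false =>
          refine ⟨(sat_ofProp _ _ _).2 (by simpa [IsBit, IsFirst, Holds] using hV'.1), h0,
            hV'.2.resolve_left (by simp [IsFirst])⟩
      · exact ⟨h0, hV'.2.resolve_left id⟩
  | addr =>
    obtain ⟨p, hp, rfl, rfl⟩ := hV
    have key : ∀ b e, J ≤ N → σ.letter (p + 1 + J) = .inr (b, e) →
        V J (.watch b) (p + 1 + J + 1) (σ.cls p) ∧
          V (min (J + 1) (N + 1)) .addr (p + 1 + J + 1) (σ.cls p) := by
      intro b e hJN hl
      refine ⟨⟨?_, p, hp, rfl, by omega, by rw [hl]; exact rfl⟩, p, hp, rfl, by omega⟩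
      -- At counter `N` a bit letter would stand `N + 1` positions after the cell letter at `p`,
      -- contrary to `Shift`.
      rcases hJN.eq_or_lt with rfl | hJN
      · have := hshift p
        rw [hl] at this
        revert this hp
        cases σ.letter p <;> simp [Shift, IsCell]
      · exact hJN
    rcases kind_cases R x hJ with ⟨rfl, hk⟩ | ⟨h0, h1, hk⟩ | ⟨rfl, hk⟩ <;> rw [hk]
    · rcases hl : σ.letter (p + 1 + 0) with u | ⟨b, e⟩
      · trivial
      · exact key b e (by omega) hl
    · rcases hl : σ.letter (p + 1 + J) with u | ⟨b, e⟩
      · trivial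
      · exact key b e h1 hl
    · trivial
  | watch b =>
    obtain ⟨hJN, p, hp, rfl, hpi, hb⟩ := hV
    refine ⟨⟨hJN, p, hp, rfl, by omega, hb⟩, ?_⟩
    split_ifs with hc
    · exact fun _ => (R.sat_addrF _ _ _ _).1 (haddr J hJN b) p i hpi hp hc.1
        (Eq.symm (by simpa using hc.2)) hb
    · trivial
  | check b =>
    rcases kind_cases R x hJ with ⟨rfl, hk⟩ | ⟨h0, h1, hk⟩ | ⟨rfl, hk⟩ <;> rw [hk]
    · exact (sat_ofProp _ _ _).2 (hV (by omega))
    · intro _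
      have := hV h1
      rwa [show i + J = i + 1 + (J - 1) by omega] at this
    · trivial
  | dist a =>
    rcases kind_cases R x hJ with ⟨rfl, hk⟩ | ⟨h0, h1, hk⟩ | ⟨rfl, hk⟩ <;> rw [hk]
    · exact (sat_ofProp _ _ _).2 (hV (by omega))
    · intro _
      have := hV h1
      rwa [show i + J = i + 1 + (J - 1) by omega] at this
    · trivial
  | adj a => exact (sat_ofProp _ _ _).2 hV
  | wait γ =>
    have hV' : (R.waitF γ).Sat σ i D := hV
    rw [waitF, sat_release_iff, ← waitF] at hV'
    simp only [Sat, hereF, sat_anyOf] at hV'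
    rcases hl : σ.letter i with ⟨f, l, c, r⟩ | u <;> rw [hl] at hV'
    · by_cases hD : D = σ.cls i
      · simp only [rule, hD, decide_true, if_true, sat_ofProp]
        simpa [IsBit, Holds, hD] using hV'.1
      · have hD' : ¬σ.cls i = D := fun h => hD h.symm
        simp only [rule, hD, decide_false, Bool.false_eq_true, if_false]
        cases f with
        | true => exact (by simpa [IsBit, hD', IsLater, IsFirst] using hV'.1 :
            (R.waitLateF γ).Sat σ (i + 1) D)
        | false => exact hV'.2.resolve_left fun h => hD' h.2
    · exact hV'.2.resolve_left fun h => h.1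
  | waitLate γ =>
    have hV' : (R.waitLateF γ).Sat σ i D := hV
    rw [waitLateF, sat_release_iff, ← waitLateF] at hV'
    simp only [Sat, hereF, sat_anyOf] at hV'
    rcases hl : σ.letter i with ⟨f, l, c, r⟩ | u <;> rw [hl] at hV'
    · have hf : f = false := by
        cases f with
        | true => simp [IsBit, IsLater] at hV'
        | false => rfl
      subst hf
      by_cases hD : D = σ.cls i
      · simp only [rule, hD, decide_true, if_true, Bool.false_eq_true, if_false, sat_ofProp]
        simpa [IsBit, IsLater, Holds, hD] using hV'.1
      · have hD' : ¬σ.cls i = D := fun h => hD h.symm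
        simp only [rule, hD, decide_false, Bool.false_eq_true, if_false]
        exact hV'.2.resolve_left fun h => hD' h.2
    · exact hV'.2.resolve_left fun h => h.1

end CellRule

/-! ## Generation of the instances -/

namespace SafetyLTL

variable {B B₂ : Type}

/-- Renaming of letters. -/
def map (e : B → B₂) : SafetyLTL B → SafetyLTL B₂
  | .letter a => .letter (e a)
  | .top => .top
  | .bot => .bot
  | .and φ ψ => .and (φ.map e) (ψ.map e)
  | .or φ ψ => .or (φ.map e) (ψ.map e)
  | .next φ => .next (φ.map e)
  | .release φ ψ => .release (φ.map e) (ψ.map e)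
  | .freeze φ => .freeze (φ.map e)
  | .up => .up
  | .notUp => .notUp

theorem isSentence_map (e : B → B₂) (φ : SafetyLTL B) : (φ.map e).IsSentence ↔ φ.IsSentence := by
  induction φ <;> simp_all [map, IsSentence]

end SafetyLTL

/-- Renaming of the letters of a data word. -/
def DataWord.map {B B₂ : Type} (e : B → B₂) (σ : DataWord B) : DataWord B₂ where
  letter i := e (σ.letter i)
  sim := σ.sim

theorem DataWord.map_map_symm {B B₂ : Type} (e : B ≃ B₂) (σ : DataWord B) :
    (σ.map e).map e.symm = σ := by
  cases σ; simp [DataWord.map]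

namespace SafetyLTL

variable {B B₂ : Type}

theorem sat_map (e : B ≃ B₂) (φ : SafetyLTL B) (σ : DataWord B₂) (i : ℕ) (D : σ.Datum) :
    (φ.map e).Sat σ i D ↔ φ.Sat (σ.map e.symm) i D := by
  induction φ generalizing i D with
  | letter a => simp only [map, Sat, DataWord.map, Equiv.symm_apply_eq]
  | top => rfl
  | bot => rfl
  | and φ ψ h₁ h₂ => exact and_congr (h₁ i D) (h₂ i D)
  | or φ ψ h₁ h₂ => exact or_congr (h₁ i D) (h₂ i D)
  | next φ h => exact h (i + 1) D
  | release φ ψ h₁ h₂ => simp only [map, Sat, h₁, h₂]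
  | freeze φ h => exact h i _
  | up => rfl
  | notUp => rfl

theorem lang_map_nonempty (e : B ≃ B₂) (φ : SafetyLTL B) :
    (φ.map e).lang.Nonempty ↔ φ.lang.Nonempty := by
  constructor
  · rintro ⟨σ, hσ⟩
    exact ⟨σ.map e.symm, fun D => (sat_map e φ σ 0 D).1 (hσ D)⟩
  · rintro ⟨σ, hσ⟩
    refine ⟨σ.map e, fun D => (sat_map e φ _ 0 D).2 ?_⟩
    have h : (σ.map e).map e.symm ∈ φ.lang := by rwa [DataWord.map_map_symm]
    exact h D

end SafetyLTL

namespace SafetyARA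

variable {B B₂ Q Q₂ : Type}

/-- Renaming of letters and states. -/
def reindex (e : B ≃ B₂) (g : Q ≃ Q₂) (M : SafetyARA B Q) : SafetyARA B₂ Q₂ where
  start := g M.start
  trans q a up := (M.trans (g.symm q) (e.symm a) up).map g

theorem reindex_accepts (e : B ≃ B₂) (g : Q ≃ Q₂) (M : SafetyARA B Q) (σ : DataWord B₂) :
    (M.reindex e g).Accepts σ ↔ M.Accepts (σ.map e.symm) := by
  rw [accepts_iff, accepts_iff]
  constructor
  · rintro ⟨V, h0, h⟩
    refine ⟨fun q => V (g q), h0, fun q i D hV => ?_⟩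
    have := h _ _ _ hV
    rw [rule, reindex, PosBool.sat_map, Equiv.symm_apply_apply] at this
    exact this
  · rintro ⟨V, h0, h⟩
    refine ⟨fun q => V (g.symm q), ?_, fun q i D hV => ?_⟩
    · show V (g.symm (g M.start)) _ _
      rw [Equiv.symm_apply_apply]; exact h0
    · have := h _ _ _ hV
      rw [rule, reindex, PosBool.sat_map]
      refine this.mono (fun q' hq' => ?_) fun q' hq' => ?_
      · show V (g.symm (g q')) _ _
        rw [Equiv.symm_apply_apply]; exact hq'
      · show V (g.symm (g q')) _ _
        rw [Equiv.symm_apply_apply]; exact hq'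

theorem lang_reindex_nonempty (e : B ≃ B₂) (g : Q ≃ Q₂) (M : SafetyARA B Q) :
    (M.reindex e g).lang.Nonempty ↔ M.lang.Nonempty := by
  constructor
  · rintro ⟨σ, hσ⟩
    exact ⟨σ.map e.symm, (reindex_accepts e g M σ).1 hσ⟩
  · rintro ⟨σ, hσ⟩
    refine ⟨σ.map e, (reindex_accepts e g M _).2 ?_⟩
    rw [DataWord.map_map_symm]
    exact hσ

end SafetyARA

/-! ### Printing formulae -/

section GenFormula

open SafetyLTL

variable {A B : Type} {b m : ℕ} (e : B → Fin m)

/-- The strings of the formulae `φ N j` can be generated. -/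
def GenF (A : Type) (b : ℕ) (e : B → Fin m) (φ : ℕ → ℕ → SafetyLTL B) : Prop :=
  Gen A b fun N j => ((φ N j).map e).encodeFormula

variable {e}

theorem GenF.const (φ : SafetyLTL B) : GenF A b e fun _ _ => φ := Gen.const _

theorem GenF.and {φ ψ : ℕ → ℕ → SafetyLTL B} (h : GenF A b e φ) (h' : GenF A b e ψ) :
    GenF A b e fun N j => .and (φ N j) (ψ N j) := (h.append h').cons _

theorem GenF.or {φ ψ : ℕ → ℕ → SafetyLTL B} (h : GenF A b e φ) (h' : GenF A b e ψ) :
    GenF A b e fun N j => .or (φ N j) (ψ N j) := (h.append h').cons _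

theorem GenF.next {φ : ℕ → ℕ → SafetyLTL B} (h : GenF A b e φ) :
    GenF A b e fun N j => .next (φ N j) := h.cons _

theorem GenF.freeze {φ : ℕ → ℕ → SafetyLTL B} (h : GenF A b e φ) :
    GenF A b e fun N j => .freeze (φ N j) := h.cons _

theorem GenF.always {φ : ℕ → ℕ → SafetyLTL B} (h : GenF A b e φ) :
    GenF A b e fun N j => SafetyLTL.always (φ N j) :=
  Gen.cons LTLSym.release (Gen.cons LTLSym.bot h)

theorem encodeFormula_map_nexts (n : ℕ) (φ : SafetyLTL B) :
    ((nexts n φ).map e).encodeFormula =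
      (List.replicate n [LTLSym.next]).flatten ++ (φ.map e).encodeFormula := by
  induction n with
  | zero => rfl
  | succ n ih => simp [nexts, SafetyLTL.map, encodeFormula, ih, List.replicate_succ]

theorem GenF.nexts_range {φ : ℕ → ℕ → SafetyLTL B} (h : GenF A b e φ) :
    GenF A b e fun N j => nexts N (φ N j) :=
  ((Gen.replicate_range [LTLSym.next]).append h).congr fun _ _ _ =>
    (encodeFormula_map_nexts _ _).symm

theorem GenF.nexts_counter {φ : ℕ → ℕ → SafetyLTL B} (h : GenF A b e φ) :
    GenF A b e fun N j => nexts j (φ N j) :=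
  ((Gen.replicate_counter [LTLSym.next]).append h).congr fun _ _ _ =>
    (encodeFormula_map_nexts _ _).symm

/-- In Polish notation a fold step that only wraps a formula on its left prepends a string, so a
nested formula of unbounded depth is printed by a plain loop. -/
theorem encodeFormula_map_foldr {X : Type} (l : List X) (F : X → SafetyLTL B → SafetyLTL B)
    (φ : SafetyLTL B) (pre : X → List LTLSym)
    (h : ∀ a ψ, ((F a ψ).map e).encodeFormula = pre a ++ (ψ.map e).encodeFormula) :
    ((l.foldr F φ).map e).encodeFormula = l.flatMap pre ++ (φ.map e).encodeFormula := by
  induction l with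
  | nil => rfl
  | cons a l ih => rw [List.foldr_cons, h, ih, List.flatMap_cons, List.append_assoc]

theorem GenF.caseLetter [Fintype B] {F : B → ℕ → ℕ → SafetyLTL B} (h : ∀ a, GenF A b e (F a)) :
    GenF A b e fun N j => SafetyLTL.caseLetter fun a => F a N j := by
  have : Gen A b fun N j => (Finset.univ.toList.flatMap fun a =>
      LTLSym.or :: .and :: (((SafetyLTL.letter a).map e).encodeFormula ++
        ((F a N j).map e).encodeFormula)) ++ [.bot] :=
    (Gen.flatMap _ fun a _ => (((Gen.const _).append (h a)).cons _).cons _).append (Gen.const _)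
  refine this.congr fun N j _ => ?_
  refine (encodeFormula_map_foldr (e := e) Finset.univ.toList
    (fun a φ => .or (.and (.letter a) (F a N j)) φ) .bot (fun a =>
      LTLSym.or :: .and :: (((SafetyLTL.letter a).map e).encodeFormula ++
        ((F a N j).map e).encodeFormula)) fun a ψ => ?_).symm
  simp [SafetyLTL.map, encodeFormula]

end GenFormula

namespace CellRule

open SafetyLTL Letter

variable {A : Type} (R : CellRule A)

theorem genF_addrF {b m : ℕ} (e : R.Letter → Fin m) (c : Bool) :
    GenF A b e fun _ j => R.addrF j c :=
  ((GenF.const _).or ((GenF.const _).nexts_counter.next.or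
    ((GenF.const _).or ((GenF.const .notUp).or
      (GenF.const _).nexts_counter.next)).always.next.freeze)).always

/-- The only dependence on `N` is the number of `next` operators; everything else is a fixed string.
-/
theorem genF_letterF {b m : ℕ} (e : R.Letter → Fin m) (a : R.Letter) :
    GenF A b e fun N _ => R.letterF N a :=
  (GenF.const _).and ((GenF.const _).next.and ((GenF.const _).nexts_range.next.and (GenF.const _)))

/-- The string splits into fixed pieces, repetitions, one loop that reads the input and one loop
over the bits of the addresses. -/
theorem genFrom_sentence [Fintype A] (b : ℕ) {m : ℕ} (e : R.Letter → Fin m) :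
    GenFrom (A := A) b fun x N => ((R.sentence x N).map e).encode := by
  let enc : SafetyLTL R.Letter → List LTLSym := fun φ => (φ.map e).encodeFormula
  let initPre : R.Γ → List LTLSym := fun γ => .release :: (enc (anyOf IsCell) ++ .or ::
    (enc (anyOf IsBit) ++ .or :: (enc (anyOf IsFirst) ++ .and :: (enc (anyOf (Holds γ)) ++ [.next]))))
  have h₁ : Gen A b fun N _ => unary LTLSym.tick .sep m ++ (.and :: (enc (anyOf IsStart) ++
      .and :: .next :: ((List.replicate N (.and :: (enc (anyOf (HasBit false)) ++ [.next]))).flatten ++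
        [.top, .and, .next]))) :=
    (Gen.const _).append (((Gen.const _).append ((((Gen.replicate_range _).append
      (Gen.const _)).cons _).cons _)).cons _)
  have h₂ := GenFrom.input_range (A := A) (b := b) (O := LTLSym)
    (g := fun o _ _ => initPre (R.inpAt o)) fun _ => Gen.const _
  have h₃ : Gen A b fun _ j => LTLSym.and :: (enc (R.addrF j true) ++
      .and :: enc (R.addrF j false)) :=
    ((R.genF_addrF e true).append ((R.genF_addrF e false).cons _)).cons _
  have h₄ : Gen A b fun N _ => LTLSym.top :: enc (always (caseLetter (R.letterF N))) :=
    (Gen.cons _ (GenF.always (GenF.caseLetter fun a => R.genF_letterF e a)))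
  have := (((GenFrom.gen_append h₁ h₂).append_gen (Gen.const (enc R.initEndF ++ [.and]))).append_range
    h₃).append_gen h₄
  convert this using 3 with x N
  have e₁ : enc (R.zerosF N) =
      (List.replicate N (.and :: (enc (anyOf (HasBit false)) ++ [.next]))).flatten ++ [.top] := by
    rw [← flatMap_range_const]
    exact encodeFormula_map_foldr _ _ _ _ fun _ ψ => by simp [SafetyLTL.map, encodeFormula, enc]
  have e₂ : enc (R.initF x 0 N) =
      (List.range N).flatMap (fun j => initPre (R.inpAt x[j]?)) ++ enc R.initEndF := by
    rw [List.range_eq_range']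
    exact encodeFormula_map_foldr _ _ _ (fun j => initPre (R.inpAt x[j]?)) fun _ ψ => by
      simp [SafetyLTL.map, encodeFormula, enc, initPre, initStepF]
  have e₃ : enc (R.addrsF N) = (List.range N).flatMap (fun j => LTLSym.and ::
      (enc (R.addrF j true) ++ .and :: enc (R.addrF j false))) ++ [.top] :=
    encodeFormula_map_foldr _ _ _ (fun j => LTLSym.and ::
      (enc (R.addrF j true) ++ .and :: enc (R.addrF j false))) fun _ ψ => by
      simp [SafetyLTL.map, encodeFormula, enc]
  have e₀ : ((R.sentence x N).map e).encode = unary LTLSym.tick .sep m ++ (.and ::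
      (enc (anyOf IsStart) ++ .and :: (.next :: enc (R.zerosF N) ++ .and ::
        (.next :: enc (R.initF x 0 N) ++ .and :: (enc (R.addrsF N) ++
          enc (always (caseLetter (R.letterF N)))))))) := rfl
  rw [e₀, e₁, e₂, e₃]
  simp

end CellRule

/-! ### Printing the transition table -/

theorem flatten_replicate_replicate {B : Type} (n k : ℕ) (s : B) :
    (List.replicate n (List.replicate k s)).flatten = List.replicate (n * k) s := by
  induction n with
  | zero => simp
  | succ n ih =>
    rw [List.replicate_succ, List.flatten_cons, ih, List.replicate_append_replicate,
      Nat.succ_mul, Nat.add_comm]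

section GenUnary

variable {A O : Type} {b : ℕ} (s t : O)

theorem Gen.unary_range (d k c : ℕ) : Gen A b fun N _ => unary s t (d + k * (N + c)) :=
  ((Gen.replicate_range (List.replicate k s)).append (Gen.const (unary s t (d + k * c)))).congr
    fun N j _ => by
      rw [flatten_replicate_replicate, unary, unary, ← List.append_assoc,
        List.replicate_append_replicate]
      congr 2
      ring

theorem Gen.unary_counter (d k c : ℕ) : Gen A b fun _ j => unary s t (d + k * (j + c)) :=
  ((Gen.replicate_counter (List.replicate k s)).append (Gen.const (unary s t (d + k * c)))).congr
    fun N j _ => by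
      rw [flatten_replicate_replicate, unary, unary, ← List.append_assoc,
        List.replicate_append_replicate]
      congr 2
      ring

end GenUnary

/-- States are numbered with the counter as the leading component, so the table falls into
consecutive groups, one for each counter value. -/
theorem finRange_mul (n k : ℕ) : List.finRange (n * k) =
    (List.finRange n).flatMap fun i => (List.finRange k).map fun j => finProdFinEquiv (i, j) := by
  apply List.map_injective_iff.2 Fin.val_injective
  rw [List.map_coe_finRange_eq_range, List.map_flatMap]
  simp only [List.map_map, Function.comp_def, finProdFinEquiv_apply_val]
  have h : ∀ i : ℕ, ((List.finRange k).map fun j : Fin k => (j : ℕ) + k * i) =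
      (List.range k).map fun j => j + k * i := fun i => by
    rw [← List.map_coe_finRange_eq_range, List.map_map]; rfl
  simp only [h]
  rw [show ((List.finRange n).flatMap fun i : Fin n =>
        (List.range k).map fun j => j + k * (i : ℕ)) =
      (List.range n).flatMap fun i => (List.range k).map fun j => j + k * i by
    rw [← List.map_coe_finRange_eq_range (n := n), List.flatMap_map]]
  induction n with
  | zero => simp
  | succ n ih =>
    rw [Nat.succ_mul, List.range_add, ih, List.range_succ, List.flatMap_append]
    simp [Nat.add_comm, Nat.mul_comm]

theorem flatMap_finRange_add_two {B : Type} (N : ℕ) (G : ℕ → List B) :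
    ((List.finRange (N + 2)).flatMap fun J : Fin (N + 2) => G J) =
      G 0 ++ ((List.range N).flatMap fun j => G (j + 1)) ++ G (N + 1) := by
  have : ((List.finRange (N + 2)).flatMap fun J : Fin (N + 2) => G J) = (List.range (N + 2)).flatMap G := by
    rw [← List.map_coe_finRange_eq_range, List.flatMap_map]
  rw [this, List.range_succ, List.range_succ_eq_map]
  simp [List.flatMap_map]

namespace CellRule

open Letter

variable {A : Type} (R : CellRule A)

section Table

variable {m T : ℕ} (e : R.Letter ≃ Fin m) (g : Ctrl R.Letter R.Γ ≃ Fin T)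

/-- The string of a formula over references. -/
def encodeRef (N J : ℕ) : PosBool (Ref × Ctrl R.Letter R.Γ) → List ARASym
  | .keep q => .keep :: unary .tick .sep (g q.2 + T * q.1.val N J)
  | .down q => .down :: unary .tick .sep (g q.2 + T * q.1.val N J)
  | .top => [.top]
  | .bot => [.bot]
  | .and φ ψ => .and :: (encodeRef N J φ ++ encodeRef N J ψ)
  | .or φ ψ => .or :: (encodeRef N J φ ++ encodeRef N J ψ)

/-- The part of the transition table for the states with a given value of the counter. -/
noncomputable def encodeGroup (N J : ℕ) (k : CtrKind R.Γ) : List ARASym :=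
  (List.finRange T).flatMap fun q => (List.finRange m).flatMap fun a =>
    R.encodeRef g N J (R.rule k (g.symm q) (e.symm a) true) ++
      R.encodeRef g N J (R.rule k (g.symm q) (e.symm a) false)

/-- Numbering of the states. -/
def stateEquiv (N : ℕ) : R.AState N ≃ Fin ((N + 2) * T) :=
  ((Equiv.refl _).prodCongr g).trans finProdFinEquiv

theorem encode_map_resolve (N : ℕ) (J : Fin (N + 2)) (φ : PosBool (Ref × Ctrl R.Letter R.Γ)) :
    ((φ.map (R.resolve N J)).map (R.stateEquiv g N)).encode = R.encodeRef g N J φ := by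
  induction φ with
  | keep q | down q =>
    simp [PosBool.map, PosBool.encode, encodeRef, stateEquiv, resolve]
  | top | bot => rfl
  | and φ ψ h₁ h₂ | or φ ψ h₁ h₂ => simp [PosBool.map, PosBool.encode, encodeRef, h₁, h₂]

/-- Within a group the formulae depend only on the kind of the counter value, so there is one block
for `0`, a loop over the input for `1` to `N`, and one block for `N + 1`. -/
theorem encode_automaton (x : List A) (N : ℕ) :
    ((R.automaton x N).reindex e (R.stateEquiv g N)).encode =
      unary .tick .sep m ++ unary .tick .sep (0 + T * (N + 2)) ++
        unary .tick .sep (g .start) ++ R.encodeGroup e g N 0 .low ++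
        ((List.range N).flatMap fun j => R.encodeGroup e g N (j + 1) (.mid (R.inpAt x[j]?))) ++
        R.encodeGroup e g N (N + 1) .high := by
  have htab : ((List.finRange ((N + 2) * T)).flatMap fun q => (List.finRange m).flatMap fun a =>
      (((R.automaton x N).reindex e (R.stateEquiv g N)).trans q a true).encode ++
        (((R.automaton x N).reindex e (R.stateEquiv g N)).trans q a false).encode) =
      (List.finRange (N + 2)).flatMap fun J : Fin (N + 2) =>
        R.encodeGroup e g N J (R.kind x N J) := by
    rw [finRange_mul, List.flatMap_assoc]
    congr 1
    funext J
    rw [List.flatMap_map, encodeGroup]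
    congr 1
    funext q
    congr 1
    funext a
    have hq : (R.stateEquiv g N).symm (finProdFinEquiv (J, q)) = (J, g.symm q) := by
      simp [stateEquiv]
    simp only [SafetyARA.reindex, hq, automaton, encode_map_resolve]
  rw [SafetyARA.encode, htab, flatMap_finRange_add_two N
    (fun J => R.encodeGroup e g N J (R.kind x N J))]
  have h0 : (((R.automaton x N).reindex e (R.stateEquiv g N)).start : ℕ) = g .start := by
    simp [SafetyARA.reindex, automaton, stateEquiv]
  have hmid : ((List.range N).flatMap fun j => R.encodeGroup e g N (j + 1) (R.kind x N (j + 1))) =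
      (List.range N).flatMap fun j => R.encodeGroup e g N (j + 1) (.mid (R.inpAt x[j]?)) := by
    simp only [List.flatMap]
    congr 1
    refine List.map_congr_left fun j hj => ?_
    simp [kind, List.mem_range.1 hj]
  have hlast : R.kind x N (N + 1) = .high := by simp [kind]
  rw [h0, hmid, hlast, Nat.zero_add, Nat.mul_comm T]
  simp [kind]

theorem gen_encodeRef {b : ℕ} {J : ℕ → ℕ → ℕ}
    (hJ : ∀ d (r : Ref), Gen A b fun N j => unary ARASym.tick .sep (d + T * r.val N (J N j)))
    (φ : PosBool (Ref × Ctrl R.Letter R.Γ)) :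
    Gen A b fun N j => R.encodeRef g N (J N j) φ := by
  induction φ with
  | keep q => exact (hJ _ _).cons _
  | down q => exact (hJ _ _).cons _
  | top | bot => exact Gen.const _
  | and φ ψ h₁ h₂ | or φ ψ h₁ h₂ => exact (h₁.append h₂).cons _

/-- A group has a fixed shape; only the unary state numbers vary, and `hJ` supplies these for each
kind of reference. -/
theorem gen_encodeGroup {b : ℕ} {J : ℕ → ℕ → ℕ}
    (hJ : ∀ d (r : Ref), Gen A b fun N j => unary ARASym.tick .sep (d + T * r.val N (J N j)))
    (k : CtrKind R.Γ) : Gen A b fun N j => R.encodeGroup e g N (J N j) k :=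
  Gen.flatMap _ fun _ _ => Gen.flatMap _ fun _ _ =>
    (R.gen_encodeRef g hJ _).append (R.gen_encodeRef g hJ _)

theorem genFrom_automaton [Fintype A] (b : ℕ) :
    GenFrom (A := A) b fun x N => ((R.automaton x N).reindex e (R.stateEquiv g N)).encode := by
  have hlow : ∀ d (r : Ref), Gen A b fun N _ => unary ARASym.tick .sep (d + T * r.val N 0) := by
    intro d r
    cases r with
    | max => exact Gen.unary_range _ _ d T 0
    | zero | one | pred | same => simp only [Ref.val]; exact Gen.const _
    | succ =>
      refine (Gen.const (unary ARASym.tick .sep (d + T * 1))).congr fun N j _ => ?_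
      simp [Ref.val]
  have hmid : ∀ d (r : Ref), Gen A b fun N j => unary ARASym.tick .sep (d + T * r.val N (j + 1)) := by
    intro d r
    cases r with
    | max => exact Gen.unary_range _ _ d T 0
    | zero | one => simp only [Ref.val]; exact Gen.const _
    | pred => exact Gen.unary_counter _ _ d T 0
    | same => exact Gen.unary_counter _ _ d T 1
    | succ =>
      refine (Gen.unary_counter ARASym.tick .sep d T 2).congr fun N j hj => ?_
      -- Here `j < N`, so the successor does not saturate.
      simp only [Ref.val]
      rw [min_eq_left (by omega)]
  have hhigh : ∀ d (r : Ref), Gen A b fun N _ =>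
      unary ARASym.tick .sep (d + T * r.val N (N + 1)) := by
    intro d r
    cases r with
    | max | pred => exact Gen.unary_range _ _ d T 0
    | zero | one => simp only [Ref.val]; exact Gen.const _
    | same => exact Gen.unary_range _ _ d T 1
    | succ =>
      refine (Gen.unary_range ARASym.tick .sep d T 1).congr fun N j hj => ?_
      simp only [Ref.val]
      rw [min_eq_right (by omega)]
  have h₁ : Gen A b fun N _ => unary .tick .sep m ++ unary .tick .sep (0 + T * (N + 2)) ++
        unary .tick .sep (g .start) ++ R.encodeGroup e g N 0 .low :=
    (((Gen.const _).append (Gen.unary_range _ _ 0 T 2)).append (Gen.const _)).append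
      (R.gen_encodeGroup e g (J := fun _ _ => 0) hlow _)
  have h₂ := GenFrom.input_range (A := A) (b := b)
    (g := fun o N j => R.encodeGroup e g N (j + 1) (.mid (R.inpAt o)))
    fun _ => R.gen_encodeGroup e g (J := fun _ j => j + 1) hmid _
  have h₃ := R.gen_encodeGroup e g (J := fun N _ => N + 1) hhigh .high
  have := (GenFrom.gen_append h₁ h₂).append_gen h₃
  simpa only [encode_automaton] using this

end Table

end CellRule

/-! ## Hardness -/

theorem add_pow_le_pow_add (u v : ℕ) (s : ℕ) :
    u ^ (s + 1) + v ^ (s + 1) ≤ (u + v) ^ (s + 1) := by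
  rw [pow_succ, pow_succ, pow_succ, Nat.mul_add]
  exact Nat.add_le_add (Nat.mul_le_mul_right _ (Nat.pow_le_pow_left (by omega) _))
    (Nat.mul_le_mul_right _ (Nat.pow_le_pow_left (by omega) _))

/-- For monomials `n < 2 ^ n.size` absorbs `n ^ k` into the base `2 ^ k`, and the coefficient is
absorbed likewise; for sums the bases are added. -/
theorem exists_eval_le_counterRange (p : Polynomial ℕ) :
    ∃ b, ∀ n, p.eval n ≤ counterRange b n := by
  induction p using Polynomial.induction_on' with
  | add p q hp hq =>
    obtain ⟨b, hb⟩ := hp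
    obtain ⟨c, hc⟩ := hq
    refine ⟨b + c + 2, fun n => ?_⟩
    rw [Polynomial.eval_add]
    refine (Nat.add_le_add (hb n) (hc n)).trans ((add_pow_le_pow_add _ _ _).trans ?_)
    exact Nat.pow_le_pow_left (by omega) _
  | monomial k a =>
    refine ⟨(a + 2) * 2 ^ k, fun n => ?_⟩
    rw [Polynomial.eval_monomial, counterRange]
    have h1 : a ≤ (a + 2) ^ (n.size + 1) :=
      (show a ≤ a + 2 by omega).trans (Nat.le_self_pow (by omega) _)
    have h2 : n ^ k ≤ (2 ^ k) ^ (n.size + 1) := by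
      rw [← pow_mul, Nat.mul_comm, pow_mul]
      refine Nat.pow_le_pow_left ?_ k
      exact (Nat.lt_size_self n).le.trans (Nat.pow_le_pow_right (by omega) (by omega))
    calc a * n ^ k ≤ (a + 2) ^ (n.size + 1) * (2 ^ k) ^ (n.size + 1) := Nat.mul_le_mul h1 h2
      _ = ((a + 2) * 2 ^ k) ^ (n.size + 1) := (mul_pow _ _ _).symm
      _ ≤ _ := Nat.pow_le_pow_left (by omega) _

/-- Membership in a language of exponential space in terms of the sentences and of the automata. -/
theorem InExpSpace.exists_instances {A : Type} {L : Language A} (h : InExpSpace L) :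
    ∃ (R : CellRule A) (b : ℕ), ∀ x : List A,
      (x ∈ L ↔ (R.sentence x (counterRange b x.length)).lang.Nonempty) ∧
      (x ∈ L ↔ (R.automaton x (counterRange b x.length)).lang.Nonempty) := by
  obtain ⟨R, p, hp⟩ := h.exists_cellRule
  -- The summand `X` ensures that the initial check of `N` cells covers the whole input.
  obtain ⟨b, hb⟩ := exists_eval_le_counterRange (p + Polynomial.X)
  refine ⟨R, b, fun x => ?_⟩
  have hN : 0 < counterRange b x.length := by unfold counterRange; positivity
  have hbx := hb x.length
  rw [Polynomial.eval_add, Polynomial.eval_X] at hbx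
  rw [hp x _ (Nat.le_of_add_right_le hbx)]
  have hx : x.length ≤ counterRange b x.length := by omega
  have h₁ : (∃ row, R.Run x (2 ^ counterRange b x.length) row) →
      (R.sentence x (counterRange b x.length)).lang.Nonempty :=
    fun ⟨_, hr⟩ => ⟨_, CellRule.sat_sentence hN hx hr⟩
  have h₂ : (R.sentence x (counterRange b x.length)).lang.Nonempty →
      (R.automaton x (counterRange b x.length)).lang.Nonempty :=
    fun ⟨_, hσ⟩ => ⟨_, CellRule.automaton_accepts_of_sat hσ⟩
  have h₃ : (R.automaton x (counterRange b x.length)).lang.Nonempty →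
      ∃ row, R.Run x (2 ^ counterRange b x.length) row :=
    fun ⟨_, hσ⟩ => CellRule.exists_run_of_accepts hN hx hσ
  exact ⟨⟨h₁, fun h => h₃ (h₂ h)⟩, ⟨fun h => h₂ (h₁ h), h₃⟩⟩

theorem SafetyARA.encode_mem_iff {m k : ℕ} (M : SafetyARA (Fin m) (Fin k)) :
    M.encode ∈ safetyARANonemptiness ↔ M.lang.Nonempty := by
  constructor
  · rintro ⟨m', k', M', e, h⟩
    obtain ⟨rfl, rfl, e⟩ := SafetyARA.encode_inj e
    rwa [eq_of_heq e]
  · exact fun h => ⟨m, k, M, rfl, h⟩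

theorem SafetyLTL.encode_mem_iff {m : ℕ} {φ : SafetyLTL (Fin m)} (hφ : φ.IsSentence) :
    φ.encode ∈ safetyLTLSatisfiability ↔ φ.lang.Nonempty := by
  constructor
  · rintro ⟨m', φ', e, -, h⟩
    obtain ⟨rfl, e⟩ := SafetyLTL.encode_inj e
    rwa [eq_of_heq e]
  · exact fun h => ⟨m, φ, rfl, hφ, h⟩

theorem mainTheorem2 :
    ExpSpaceHard safetyARANonemptiness ∧ ExpSpaceHard safetyLTLSatisfiability := by
  constructor <;> intro A _ L hL <;> obtain ⟨R, b, h⟩ := hL.exists_instances <;>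
    have := Fintype.ofFinite A
  -- The numberings depend on the language only and not on `x`, so they are built into the
  -- transducer.
  · let e := Fintype.equivFin R.Letter
    let g := Fintype.equivFin (Ctrl R.Letter R.Γ)
    refine ⟨_, (R.genFrom_automaton e g b).logspaceComputable, fun x => ?_⟩
    rw [SafetyARA.encode_mem_iff, SafetyARA.lang_reindex_nonempty]
    exact (h x).2
  · let e := Fintype.equivFin R.Letter
    refine ⟨_, (R.genFrom_sentence b e).logspaceComputable, fun x => ?_⟩
    rw [SafetyLTL.encode_mem_iff ((SafetyLTL.isSentence_map _ _).2 (R.isSentence_sentence _ _)),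
      SafetyLTL.lang_map_nonempty]
    exact (h x).1
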